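/- Let $\Lambda>0$, $a\neq0$, $M,e\in\mathbb R$ be such that $\Delta_r=(r^2+a^2)(1-\frac{\Lambda}{3}r^2)-2Mr+e^2$ has four real roots $r_n<0<r_-<r_+<r_c$ (subextremal Kerr--Newman--de Sitter), and fix $r_0\in(r_-,r_+)$. Put $\Delta_\theta=1+\frac{\Lambda}{3}a^2\cos^2\theta$, $\rho^2=r^2+a^2\cos^2\theta$, $\Xi=1+\frac{\Lambda}{3}a^2$, $\Upsilon=(r^2+a^2)^2\Delta_\theta-a^2\sin^2\theta\,\Delta_r$, and let $$g=\frac{\rho^2}{\Delta_r}dr^2+\frac{\rho^2}{\Delta_\theta}d\theta^2+\frac{a^2\sin^2\theta\,\Delta_\theta-\Delta_r}{\rho^2}dt^2+\frac{\sin^2\theta}{\Xi^2\rho^2}\Upsilon\,d\phi^2-\frac{2a\sin^2\theta}{\Xi\rho^2}\big((r^2+a^2)\Delta_\theta-\Delta_r\big)d\phi\,dt$$ in the region $r_-<r<r_+$. Coordinates. Let $\hat P(\theta,\lambda)=\sqrt{a^2(\lambda\Delta_\theta-\sin^2\theta)}$, $\hat Q(r,\lambda)=\sqrt{(r^2+a^2)^2-a^2\lambda\Delta_r}$.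 For $\theta\in(0,\frac\pi2)$ let $\theta_\star(r,\theta)\in[\theta,\frac\pi2)$ be the solution of $$\int_{\theta_\star}^{\theta}\frac{d\theta'}{\hat P(\theta',\sin^2\theta_\star)}+\int_r^{r_+}\frac{dr'}{\hat Q(r',\sin^2\theta_\star)}=0,$$ and let $\theta_\star(r,0)=0$, $\theta_\star(r,\frac\pi2)=\frac\pi2$. For $\theta\in[0,\frac\pi2]$ let $r_\star(r,\theta)=\varrho(r,\theta,\sin^2\theta_\star(r,\theta))$ with $$\varrho(r,\theta,\lambda)=\int_{r_0}^r\frac{r'^2+a^2}{\Delta_{r'}}dr'+\int_r^{r_+}\frac{r'^2+a^2-\hat Q(r',\lambda)}{\Delta_{r'}}dr'+\int_0^\theta\frac{\hat P(\theta',\lambda)}{\Delta_{\theta'}}d\theta'+\frac{a^2}{2}f(\lambda),$$ where $f(0)=0$ and $f'(\lambda)=-\int_0^{\arcsin\sqrt\lambda}\frac{d\theta'}{\hat P(\theta',\lambda)}$. Extend to $\theta\in(\frac\pi2,\pi]$ by $\theta_\star(r,\theta)=\pi-\theta_\star(r,\pi-\theta)$, $r_\star(r,\theta)=r_\star(r,\pi-\theta)$.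 Regard $r$ and $\theta$ as functions of $(r_\star,\theta_\star)\in\mathbb R\times[0,\pi]$ through the inverse of $(r,\theta)\mapsto(r_\star,\theta_\star)$ on $(r_-,r_+)\times[0,\pi]$. With $B=\Xi a\big((r^2+a^2)\Delta_\theta-\Delta_r\big)/\Upsilon$, let $h(r_\star,\theta_\star)$ satisfy $\partial_{r_\star}h=-B$, $h(0,\theta_\star)=0$, and put $u=\frac{r_\star-t}2$, $v=\frac{r_\star+t}2$, $\phi_\star=\phi-h(r_\star,\theta_\star)$. Let $\gamma_{\theta_\star\theta_\star},\gamma_{\theta_\star\phi_\star},\gamma_{\phi_\star\phi_\star}$ be the components of $g$ on $\partial_{\theta_\star},\partial_{\phi_\star}$ in the coordinates $(u,v,\theta_\star,\phi_\star)$, and let $\Omega^2=-\rho^2\Delta_r\Delta_\theta/\Upsilon$, $b^{\phi_\star}=2B$. Call a function of $(r_\star,\theta_\star)$ smooth if it has derivatives of all orders with respect to $\partial_{r_\star}$ and $\frac{1}{\sin2\theta_\star}\partial_{\theta_\star}$, taken in any order, which are continuous on $\mathbb R\times[0,\pi]$; where $\sin 2\theta_\star=0$, expressions that are there of the form $0/0$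 or that involve $\theta_\star$-derivatives at the endpoints are understood as their continuous extensions. Then, for $0<\theta_\star<\pi$, $$g=-2\Omega^2(du\otimes dv+dv\otimes du)+\gamma_{\theta_\star\theta_\star}d\theta_\star\otimes d\theta_\star+\gamma_{\theta_\star\phi_\star}\big(d\theta_\star\otimes\beta+\beta\otimes d\theta_\star\big)+\gamma_{\phi_\star\phi_\star}\beta\otimes\beta,\qquad \beta=d\phi_\star-b^{\phi_\star}dv,$$ and the functions $$\frac{1}{\sin 2\theta_\star}\partial_{\theta_\star}h,\quad b^{\phi_\star},\quad \gamma_{\theta_\star\theta_\star},\quad \frac{\gamma_{\theta_\star\phi_\star}}{\sin^2\theta_\star\,\sin2\theta_\star},\quad \frac{\gamma_{\phi_\star\phi_\star}}{\sin^2\theta_\star},\quad \frac{1}{\sin^2\theta_\star}\Big(\gamma_{\theta_\star\theta_\star}-\frac{\gamma_{\phi_\star\phi_\star}}{\sin^2\theta_\star}\Big)$$ are smooth. -/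

import Mathlib

open Real Set

noncomputable section

/-- Parameters of a subextremal Kerr--Newman--de Sitter spacetime (cosmological constant `Lam`, mass
parameter `M`, rotation parameter `a`, charge parameter `e`) with the four distinct real roots
`rn < 0 < rm < rp < rc` of `Δ_r`, and the base radius `r0` used to normalise `r⋆`. -/
structure KNdS where
  Lam : ℝ
  M : ℝ
  a : ℝ
  e : ℝ
  rn : ℝ
  rm : ℝ
  rp : ℝ
  rc : ℝ
  r0 : ℝ
  Lam_pos : 0 < Lam
  a_ne_zero : a ≠ 0
  rn_neg : rn < 0
  rm_pos : 0 < rm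
  rm_lt_rp : rm < rp
  rp_lt_rc : rp < rc
  root_rn : (rn ^ 2 + a ^ 2) * (1 - Lam / 3 * rn ^ 2) - 2 * M * rn + e ^ 2 = 0
  root_rm : (rm ^ 2 + a ^ 2) * (1 - Lam / 3 * rm ^ 2) - 2 * M * rm + e ^ 2 = 0
  root_rp : (rp ^ 2 + a ^ 2) * (1 - Lam / 3 * rp ^ 2) - 2 * M * rp + e ^ 2 = 0
  root_rc : (rc ^ 2 + a ^ 2) * (1 - Lam / 3 * rc ^ 2) - 2 * M * rc + e ^ 2 = 0
  r0_mem : r0 ∈ Ioo rm rp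

namespace KNdS

variable (K : KNdS)

/-! ### The metric in Boyer--Lindquist coordinates -/

/-- `Δ_r` -/
def DeltaR (r : ℝ) : ℝ :=
  (r ^ 2 + K.a ^ 2) * (1 - K.Lam / 3 * r ^ 2) - 2 * K.M * r + K.e ^ 2

/-- `Δ_θ` -/
def DeltaTheta (θ : ℝ) : ℝ := 1 + K.Lam / 3 * K.a ^ 2 * cos θ ^ 2

/-- `ρ²` -/
def rhoSq (r θ : ℝ) : ℝ := r ^ 2 + K.a ^ 2 * cos θ ^ 2

/-- `Ξ` -/
def Xi : ℝ := 1 + K.Lam / 3 * K.a ^ 2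

/-- `Υ = (r² + a²)² Δ_θ - a² sin²θ Δ_r` -/
def Upsilon (r θ : ℝ) : ℝ :=
  (r ^ 2 + K.a ^ 2) ^ 2 * K.DeltaTheta θ - K.a ^ 2 * sin θ ^ 2 * K.DeltaR r

def gtt (r θ : ℝ) : ℝ := (K.a ^ 2 * sin θ ^ 2 * K.DeltaTheta θ - K.DeltaR r) / K.rhoSq r θ

def gtphi (r θ : ℝ) : ℝ :=
  -(K.a * sin θ ^ 2 / (K.Xi * K.rhoSq r θ) *
    ((r ^ 2 + K.a ^ 2) * K.DeltaTheta θ - K.DeltaR r))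

def gphiphi (r θ : ℝ) : ℝ :=
  sin θ ^ 2 / (K.Xi ^ 2 * K.rhoSq r θ) *
    ((r ^ 2 + K.a ^ 2) ^ 2 * K.DeltaTheta θ - K.a ^ 2 * sin θ ^ 2 * K.DeltaR r)

/-- The Kerr--Newman--de Sitter metric at a point with coordinates `r, θ`, as a bilinear form on
tangent vectors written in the Boyer--Lindquist frame `(∂_t, ∂_r, ∂_θ, ∂_φ)`. -/
def metricBL (r θ : ℝ) (X Y : Fin 4 → ℝ) : ℝ :=
  K.gtt r θ * (X 0 * Y 0)
    + K.rhoSq r θ / K.DeltaR r * (X 1 * Y 1)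
    + K.rhoSq r θ / K.DeltaTheta θ * (X 2 * Y 2)
    + K.gphiphi r θ * (X 3 * Y 3)
    + K.gtphi r θ * (X 0 * Y 3 + X 3 * Y 0)

/-! ### The coordinates `r⋆` and `θ⋆` as functions of `r` and `θ` -/

/-- `P̂(θ, l)`, the nonnegative root of `P̂² = a² (l Δ_θ - sin²θ)`; here `l = sin²θ⋆`. -/
def PHat (θ l : ℝ) : ℝ := √(K.a ^ 2 * (l * K.DeltaTheta θ - sin θ ^ 2))

/-- `Q̂(r, l)`, the nonnegative root of `Q̂² = (r² + a²)² - a² l Δ_r`. -/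
def QHat (r l : ℝ) : ℝ := √((r ^ 2 + K.a ^ 2) ^ 2 - K.a ^ 2 * l * K.DeltaR r)

/-- The function `F(r, θ, θ⋆)` whose zero defines `θ⋆(r, θ)`. -/
def F (r θ y : ℝ) : ℝ :=
  (∫ θ' in y..θ, 1 / K.PHat θ' (sin y ^ 2)) + ∫ r' in r..K.rp, 1 / K.QHat r' (sin y ^ 2)

/-- The function `f` on `[0, 1]` with `f(0) = 0` and
`f'(l) = - ∫_0^{arcsin √l} dθ' / P̂(θ', l)`. -/
def f (l : ℝ) : ℝ :=
  ∫ l' in (0 : ℝ)..l, -∫ θ' in (0 : ℝ)..arcsin √l', 1 / K.PHat θ' l'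

/-- The separated solution `ϱ(r, θ, l)` of the eikonal equation. -/
def varrho (r θ l : ℝ) : ℝ :=
  (∫ r' in K.r0..r, (r' ^ 2 + K.a ^ 2) / K.DeltaR r')
    + (∫ r' in r..K.rp, ((r' ^ 2 + K.a ^ 2) - K.QHat r' l) / K.DeltaR r')
    + (∫ θ' in (0 : ℝ)..θ, K.PHat θ' l / K.DeltaTheta θ')
    + K.a ^ 2 / 2 * K.f l

open Classical in
/-- `θ⋆(r, θ)` for `θ ∈ [0, π/2]`: the zero of `F(r, θ, ·)` in `[θ, π/2)` if `0 < θ < π/2`. -/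
def thetaStarNorth (r θ : ℝ) : ℝ :=
  if θ = 0 then 0
  else if θ = π / 2 then π / 2
  else Classical.epsilon fun y : ℝ => y ∈ Ico θ (π / 2) ∧ K.F r θ y = 0

open Classical in
/-- `θ⋆(r, θ)` for `θ ∈ [0, π]`, by reflection in the equator. -/
def thetaStar (r θ : ℝ) : ℝ :=
  if θ ≤ π / 2 then K.thetaStarNorth r θ else π - K.thetaStarNorth r (π - θ)

/-- `r⋆(r, θ) = ϱ(r, θ, sin²θ⋆(r, θ))` for `θ ∈ [0, π/2]`, extended to `θ ∈ [0, π]` by reflection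
in the equator. -/
def rStar (r θ : ℝ) : ℝ := K.varrho r (min θ (π - θ)) (sin (K.thetaStar r θ) ^ 2)

/-! ### `r` and `θ` as functions of `r⋆` and `θ⋆` -/

/-- The change of coordinates `(r, θ) ↦ (r⋆, θ⋆)`. -/
def toStar (p : ℝ × ℝ) : ℝ × ℝ := (K.rStar p.1 p.2, K.thetaStar p.1 p.2)

/-- The inverse of `(r, θ) ↦ (r⋆, θ⋆)` on `(rm, rp) × [0, π]`. -/
def ofStar (x y : ℝ) : ℝ × ℝ :=
  Function.invFunOn K.toStar (Ioo K.rm K.rp ×ˢ Icc 0 π) (x, y)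

/-- `r` as a function of `x = r⋆` and `y = θ⋆`. -/
def rOf (x y : ℝ) : ℝ := (K.ofStar x y).1

/-- `θ` as a function of `x = r⋆` and `y = θ⋆`. -/
def thetaOf (x y : ℝ) : ℝ := (K.ofStar x y).2

/-! ### The double null coordinates `(u, v, θ⋆, φ⋆)`

They are given by `u = (r⋆ - t) / 2`, `v = (r⋆ + t) / 2` and `φ⋆ = φ - h(r⋆, θ⋆)`. Scalars that do not
depend on `t` and `φ` are written as functions of `x = r⋆ = u + v` and `y = θ⋆`. -/

/-- `B`, as a function of `r` and `θ`. -/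
def B (r θ : ℝ) : ℝ :=
  K.Xi * K.a * ((r ^ 2 + K.a ^ 2) * K.DeltaTheta θ - K.DeltaR r) / K.Upsilon r θ

/-- The function `h` with `∂_{r⋆} h = -B` and `h(0, θ⋆) = 0`. -/
def h (x y : ℝ) : ℝ := ∫ x' in (0 : ℝ)..x, -K.B (K.rOf x' y) (K.thetaOf x' y)

/-- The differential of `(u, v, θ⋆, φ⋆) ↦ (t, r, θ, φ)`, that is of
`t = v - u`, `r = r(u + v, θ⋆)`, `θ = θ(u + v, θ⋆)`, `φ = φ⋆ + h(u + v, θ⋆)`,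
applied to the vector `V 0 ∂_u + V 1 ∂_v + V 2 ∂_{θ⋆} + V 3 ∂_{φ⋆}`. -/
def push (x y : ℝ) (V : Fin 4 → ℝ) : Fin 4 → ℝ :=
  ![V 1 - V 0,
    deriv (fun x' => K.rOf x' y) x * (V 0 + V 1) + deriv (fun y' => K.rOf x y') y * V 2,
    deriv (fun x' => K.thetaOf x' y) x * (V 0 + V 1) + deriv (fun y' => K.thetaOf x y') y * V 2,
    deriv (fun x' => K.h x' y) x * (V 0 + V 1) + deriv (fun y' => K.h x y') y * V 2 + V 3]

/-- The metric in the coordinates `(u, v, θ⋆, φ⋆)`. -/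
def metric (x y : ℝ) (V W : Fin 4 → ℝ) : ℝ :=
  K.metricBL (K.rOf x y) (K.thetaOf x y) (K.push x y V) (K.push x y W)

/-- `Ω²` -/
def OmegaSq (x y : ℝ) : ℝ :=
  -(K.rhoSq (K.rOf x y) (K.thetaOf x y) * K.DeltaR (K.rOf x y) * K.DeltaTheta (K.thetaOf x y) /
    K.Upsilon (K.rOf x y) (K.thetaOf x y))

/-- `b^{φ⋆} = 2B` -/
def b (x y : ℝ) : ℝ := 2 * K.B (K.rOf x y) (K.thetaOf x y)

/-- `γ_{θ⋆θ⋆} = g(∂_{θ⋆}, ∂_{θ⋆})` -/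
def gammaThetaTheta (x y : ℝ) : ℝ := K.metric x y ![0, 0, 1, 0] ![0, 0, 1, 0]

/-- `γ_{θ⋆φ⋆} = g(∂_{θ⋆}, ∂_{φ⋆})` -/
def gammaThetaPhi (x y : ℝ) : ℝ := K.metric x y ![0, 0, 1, 0] ![0, 0, 0, 1]

/-- `γ_{φ⋆φ⋆} = g(∂_{φ⋆}, ∂_{φ⋆})` -/
def gammaPhiPhi (x y : ℝ) : ℝ := K.metric x y ![0, 0, 0, 1] ![0, 0, 0, 1]

end KNdS

/-! ### Smooth functions of `r⋆` and `θ⋆`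

A function of `(r⋆, θ⋆) ∈ ℝ × [0, π]` is smooth if it has derivatives of all orders with respect to
`∂_{r⋆}` and `(1 / sin 2θ⋆) ∂_{θ⋆}`. The second operator and some of the functions are given by
expressions that are of the form `0 / 0` at the poles and at the equator. Their values there are the
limits, and all the derivatives have to be continuous on `ℝ × [0, π]`. -/

/-- The angles `θ⋆ ∈ [0, π]` away from the poles and from the equator. -/
def regularAngles : Set ℝ := Ioo 0 π \ {π / 2}

/-- `∂_{r⋆} f` -/
def dRStar (f : ℝ → ℝ → ℝ) (x y : ℝ) : ℝ := deriv (fun x' => f x' y) x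

/-- `(1 / sin 2θ⋆) ∂_{θ⋆} f` -/
def dThetaStar (f : ℝ → ℝ → ℝ) (x y : ℝ) : ℝ := 1 / sin (2 * y) * deriv (fun y' => f x y') y

/-- `f`, given for angles in `S`, is the restriction of a continuous function on `ℝ × [0, π]`. -/
def HasContinuousExtension (S : Set ℝ) (f : ℝ → ℝ → ℝ) : Prop :=
  ∃ G : ℝ × ℝ → ℝ, ContinuousOn G (univ ×ˢ Icc 0 π) ∧ ∀ x, ∀ y ∈ S, G (x, y) = f x y

/-- `f`, given for angles in `S`, has all derivatives of order at most `n` with respect to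
`∂_{r⋆}` and `(1 / sin 2θ⋆) ∂_{θ⋆}`, taken in any order, and they are continuous on `ℝ × [0, π]`. -/
def IsSmoothOfOrder : ℕ → Set ℝ → (ℝ → ℝ → ℝ) → Prop
  | 0, S, f => HasContinuousExtension S f
  | n + 1, S, f =>
      HasContinuousExtension S f ∧
      (∀ x, ∀ y ∈ S, DifferentiableAt ℝ (fun x' => f x' y) x) ∧
      (∀ x, ∀ y ∈ regularAngles, DifferentiableAt ℝ (fun y' => f x y') y) ∧
      IsSmoothOfOrder n S (dRStar f) ∧
      IsSmoothOfOrder n regularAngles (dThetaStar f)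

/-- `f`, given for angles in `S ⊇ regularAngles`, is a smooth function of `r⋆` and `θ⋆`. -/
def IsSmoothStar (S : Set ℝ) (f : ℝ → ℝ → ℝ) : Prop := ∀ n, IsSmoothOfOrder n S f

end

noncomputable section

open Filter Topology MeasureTheory
open scoped ContDiff Interval

/-! ### Smooth dependence of integrals on parameters -/

section ParametricIntegral

universe u

/-! All scalars are exhibited as smooth functions of `x = r⋆` and `l = sin² θ⋆` on the closed strip
`ℝ × [0, 1]`. On functions of `l` one has `∂_{θ⋆} = sin 2θ⋆ ∂_l`, so the two operators in the
definition of smoothness are the coordinate derivatives of the strip, and smoothness up to the edges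
`l = 0` (poles) and `l = 1` (equator) is exactly what is required (`isSmoothStar_of_contDiffOn`).

The integrals that define `θ⋆` and `r⋆` degenerate at these edges. Writing `sin² θ = l (1 - (1 - l)
q)` removes the degeneracy: with `κ = Λ a² / 3` one gets `cos² θ = (1 - l)(1 + l q)` and `P̂² = a² l
(1 - l)(κ + (1 + l κ) q)`, and `dθ / P̂` becomes, up to sign, `dq` times the reciprocal of `2 |a|`
times the square root of the cubic `(1 - (1 - l) q)(1 + l q)(κ + (1 + l κ) q)`. The equation for
`θ⋆` reads `polarTime (q, l) = radialTime (r, l)` and has nonzero `q`-derivative for every `l ∈ [0,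
1]`. It is solvable because `|a|` times the radial time is below `π/2 - arctan √κ`, which comes from
`Λ r_+² / 3 < 1`, and the polar time attains all such values. The solution `polarParam` is smooth by
the implicit function theorem, and `sin² θ` is strictly increasing in `l` at fixed `r`
(`sinSq_strictMonoOn`).

The `l`-derivative of `ϱ` at fixed `(r, θ)` is a multiple of the left side of the equation for `θ⋆`,
hence zero, so `dr⋆ = (Q̂ / Δ_r) dr + (P̂ / Δ_θ) dθ` in the northern hemisphere. In the variables
`(r, l)` this is `hasDerivAt_tortoise_fst` and `hasDerivAt_tortoise_snd`. At fixed `l` the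
derivative of `r⋆` in `r` is `Υ / (Δ_r Δ_θ Q̂) < 0`, with non-integrable singularities at `r_-` and
`r_+`, so `r ↦ r⋆` is a bijection onto `ℝ` with smooth inverse `radius`. The angle is recovered from
`cos θ = cos θ⋆ √cosRatio`.

For the metric, complete the square in `dφ`. Along `∂_{r⋆}` one has `dθ / P̂ = dr / Q̂`, and `Q̂²
Δ_θ + P̂² Δ_r = Υ` makes the length in the `(r, θ)` block equal to `-Ω²`. That `dr⋆` vanishes on
`∂_{θ⋆}` makes the mixed term of the block vanish, and `h` turns `dφ - B dt` into `dφ⋆ - 2B dv +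
∂_{θ⋆}h dθ⋆`. The components are then quotients of smooth functions on the strip. The last function
also needs divisibility by `l`, which is `gammaThetaThetaOf_sub`. -/

theorem exists_nhds_bound_of_continuousAt {E : Type u} [NormedAddCommGroup E] [NormedSpace ℝ E] [FiniteDimensional ℝ E]
    {F : Type*} [NormedAddCommGroup F]
    {g : E × ℝ → F} {a b : ℝ} {V : Set E} (hV : IsOpen V) {z₀ : E} (hz₀ : z₀ ∈ V)
    (hg : ∀ z ∈ V, ∀ t ∈ uIcc a b, ContinuousAt g (z, t)) :
    ∃ K ∈ 𝓝 z₀, K ⊆ V ∧ ∃ C : ℝ, ∀ z ∈ K, ∀ t ∈ uIcc a b, ‖g (z, t)‖ ≤ C := by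
  have : ProperSpace E := FiniteDimensional.proper ℝ E
  obtain ⟨K, hK, hKV, hKc⟩ := local_compact_nhds (hV.mem_nhds hz₀)
  have hc : ContinuousOn g (K ×ˢ uIcc a b) := fun p hp =>
    (hg p.1 (hKV hp.1) p.2 hp.2).continuousWithinAt
  obtain ⟨C, hC⟩ := (hKc.prod isCompact_uIcc).exists_bound_of_continuousOn hc
  exact ⟨K, hK, hKV, C, fun z hz t ht => hC (z, t) ⟨hz, ht⟩⟩

theorem continuousOn_slice_of_continuousAt {E : Type u} [NormedAddCommGroup E]
    {F : Type*} [NormedAddCommGroup F]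
    {g : E × ℝ → F} {s : Set ℝ} {z : E} (hg : ∀ t ∈ s, ContinuousAt g (z, t)) :
    ContinuousOn (fun t => g (z, t)) s := fun t ht =>
  ((hg t ht).comp (f := fun t : ℝ => (z, t)) (by fun_prop)).continuousWithinAt

theorem hasFDerivAt_intervalIntegral_of_contDiffAt {E : Type u} [NormedAddCommGroup E] [NormedSpace ℝ E] [FiniteDimensional ℝ E]
    {F : Type*} [NormedAddCommGroup F]
    [NormedSpace ℝ F] {g : E × ℝ → F} {a b : ℝ} {V : Set E}
    (hV : IsOpen V) {z₀ : E} (hz₀ : z₀ ∈ V)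
    (hg : ∀ z ∈ V, ∀ t ∈ uIcc a b, ContDiffAt ℝ 1 g (z, t)) :
    HasFDerivAt (fun z => ∫ t in a..b, g (z, t))
      (∫ t in a..b, (fderiv ℝ g (z₀, t)).comp (ContinuousLinearMap.inl ℝ E ℝ)) z₀ := by
  have hd : ∀ z ∈ V, ∀ t ∈ uIcc a b,
      ContinuousAt (fun p : E × ℝ => (fderiv ℝ g p).comp (ContinuousLinearMap.inl ℝ E ℝ)) (z, t) :=
    fun z hz t ht => (((hg z hz t ht).fderiv_right (m := 0) (by norm_num)).clm_comp
      contDiffAt_const).continuousAt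
  obtain ⟨K, hK, hKV, C, hC⟩ := exists_nhds_bound_of_continuousAt hV hz₀ hd
  refine intervalIntegral.hasFDerivAt_integral_of_dominated_of_fderiv_le (s := K)
    (F := fun z t => g (z, t))
    (F' := fun z t => (fderiv ℝ g (z, t)).comp (ContinuousLinearMap.inl ℝ E ℝ))
    (bound := fun _ => C) hK ?_ ?_ ?_ ?_ ?_ ?_
  · filter_upwards [hK] with z hz
    exact ((continuousOn_slice_of_continuousAt fun t ht =>
      (hg z (hKV hz) t ht).continuousAt).mono uIoc_subset_uIcc).aestronglyMeasurable
      measurableSet_uIoc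
  · exact (continuousOn_slice_of_continuousAt fun t ht =>
      (hg z₀ hz₀ t ht).continuousAt).intervalIntegrable
  · exact ((continuousOn_slice_of_continuousAt (hd z₀ hz₀)).mono
      uIoc_subset_uIcc).aestronglyMeasurable measurableSet_uIoc
  · exact Eventually.of_forall fun t ht z hz => hC z hz t (uIoc_subset_uIcc ht)
  · exact intervalIntegrable_const
  · refine Eventually.of_forall fun t ht z hz => ?_
    have h1 := ((hg z (hKV hz) t (uIoc_subset_uIcc ht)).differentiableAt (by norm_num)).hasFDerivAt
    exact h1.comp z (hasFDerivAt_prodMk_left z t)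

/-- The derivative is an integral of the same kind with values in `E →L[ℝ] F`. The induction
therefore runs over all `F`, and `E` and `F` share a universe. -/
theorem contDiffOn_intervalIntegral_of_contDiffAt (n : ℕ) {E : Type u} [NormedAddCommGroup E] [NormedSpace ℝ E] [FiniteDimensional ℝ E]
    {F : Type u} [NormedAddCommGroup F]
    [NormedSpace ℝ F] {g : E × ℝ → F} {a b : ℝ} {V : Set E} (hV : IsOpen V)
    (hg : ∀ z ∈ V, ∀ t ∈ uIcc a b, ContDiffAt ℝ n g (z, t)) :
    ContDiffOn ℝ n (fun z => ∫ t in a..b, g (z, t)) V := by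
  induction n generalizing F with
  | zero =>
    rw [Nat.cast_zero, contDiffOn_zero]
    intro z₀ hz₀
    have hc : ∀ z ∈ V, ∀ t ∈ uIcc a b, ContinuousAt g (z, t) :=
      fun z hz t ht => (hg z hz t ht).continuousAt
    obtain ⟨K, hK, hKV, C, hC⟩ := exists_nhds_bound_of_continuousAt hV hz₀ hc
    refine (intervalIntegral.continuousAt_of_dominated_interval (bound := fun _ => C)
      ?_ ?_ intervalIntegrable_const ?_).continuousWithinAt
    · filter_upwards [hK] with z hz
      exact ((continuousOn_slice_of_continuousAt (hc z (hKV hz))).mono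
        uIoc_subset_uIcc).aestronglyMeasurable measurableSet_uIoc
    · filter_upwards [hK] with z hz
      exact Eventually.of_forall fun t ht => hC z hz t (uIoc_subset_uIcc ht)
    · refine Eventually.of_forall fun t ht => ?_
      exact (hc z₀ hz₀ t (uIoc_subset_uIcc ht)).comp (f := fun z : E => (z, t)) (by fun_prop)
  | succ n ih =>
    have hg1 : ∀ z ∈ V, ∀ t ∈ uIcc a b, ContDiffAt ℝ 1 g (z, t) :=
      fun z hz t ht => (hg z hz t ht).of_le (by exact_mod_cast Nat.succ_le_succ (Nat.zero_le n))
    have hd := fun z hz => hasFDerivAt_intervalIntegral_of_contDiffAt (z₀ := z) hV hz hg1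
    rw [Nat.cast_add, Nat.cast_one, contDiffOn_succ_iff_fderiv_of_isOpen hV]
    refine ⟨fun z hz => (hd z hz).differentiableAt.differentiableWithinAt, by simp, ?_⟩
    refine (ih (F := E →L[ℝ] F)
      (g := fun p => (fderiv ℝ g p).comp (ContinuousLinearMap.inl ℝ E ℝ)) ?_).congr
      fun z hz => (hd z hz).fderiv
    intro z hz t ht
    exact ((hg z hz t ht).fderiv_right (by norm_cast)).clm_comp contDiffAt_const

/-- Compactness of the interval gives a uniform neighbourhood. The order is finite because being
`C^n` at a point is an open condition only for finite `n`. -/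
theorem eventually_contDiffAt_slice {E : Type u} [NormedAddCommGroup E] [NormedSpace ℝ E]
    {n : ℕ} {F : Type*} [NormedAddCommGroup F] [NormedSpace ℝ F]
    {g : E × ℝ → F} {a b : ℝ} {z₀ : E} (hg : ∀ t ∈ uIcc a b, ContDiffAt ℝ n g (z₀, t)) :
    ∃ V : Set E, IsOpen V ∧ z₀ ∈ V ∧ ∀ z ∈ V, ∀ t ∈ uIcc a b, ContDiffAt ℝ n g (z, t) := by
  have h : ∀ t ∈ uIcc a b, ∀ᶠ p : E × ℝ in 𝓝 z₀ ×ˢ 𝓝 t, ContDiffAt ℝ n g (p.1, p.2) := by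
    intro t ht
    rw [← nhds_prod_eq]
    exact (hg t ht).eventually (by simp)
  have h2 := isCompact_uIcc.eventually_forall_of_forall_eventually
    (x₀ := z₀) (P := fun z t => ContDiffAt ℝ n g (z, t)) fun t ht => by
      rw [nhds_prod_eq]; exact h t ht
  obtain ⟨V, hV, hVo, hz⟩ := eventually_nhds_iff.1 h2
  exact ⟨V, hVo, hz, hV⟩

theorem contDiffAt_intervalIntegral {E : Type u} [NormedAddCommGroup E] [NormedSpace ℝ E] [FiniteDimensional ℝ E]
    {F : Type u} [NormedAddCommGroup F]
    [NormedSpace ℝ F] {g : E × ℝ → F} {a b : ℝ} {z₀ : E}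
    (hg : ∀ t ∈ uIcc a b, ContDiffAt ℝ ∞ g (z₀, t)) :
    ContDiffAt ℝ ∞ (fun z => ∫ t in a..b, g (z, t)) z₀ := by
  rw [contDiffAt_infty]
  intro n
  obtain ⟨V, hV, hz, h⟩ := eventually_contDiffAt_slice fun t ht => contDiffAt_infty.1 (hg t ht) n
  exact (contDiffOn_intervalIntegral_of_contDiffAt n hV h).contDiffAt (hV.mem_nhds hz)

end ParametricIntegral

/-! ### Primitives with a parameter, and solving for one variable -/

/-- Rescaling the interval of integration to `[0, 1]` turns the upper limit into one more parameter.
-/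
theorem contDiffAt_primitive {p : ℝ × ℝ → ℝ} {c b l : ℝ}
    (hp : ∀ t ∈ uIcc c b, ContDiffAt ℝ ∞ p (t, l)) :
    ContDiffAt ℝ ∞ (fun z : ℝ × ℝ => ∫ t in c..z.1, p (t, z.2)) (b, l) := by
  have h : (fun z : ℝ × ℝ => ∫ t in c..z.1, p (t, z.2)) =
      fun z : ℝ × ℝ => (z.1 - c) * ∫ σ in (0 : ℝ)..1, p ((z.1 - c) * σ + c, z.2) := by
    funext z
    have := intervalIntegral.mul_integral_comp_mul_add (f := fun t => p (t, z.2)) (a := 0) (b := 1)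
      (z.1 - c) c
    simp only [mul_zero, zero_add, mul_one, sub_add_cancel] at this
    exact this.symm
  rw [h]
  refine ContDiffAt.mul (by fun_prop) ?_
  refine contDiffAt_intervalIntegral
    (g := fun w : (ℝ × ℝ) × ℝ => p ((w.1.1 - c) * w.2 + c, w.1.2)) fun σ hσ => ?_
  rw [uIcc_of_le zero_le_one] at hσ
  refine ContDiffAt.comp ((b, l), σ) (g := p)
    (f := fun w : (ℝ × ℝ) × ℝ => ((w.1.1 - c) * w.2 + c, w.1.2)) (hp _ ?_) (by fun_prop)
  have hc : segment ℝ c b = uIcc c b := segment_eq_uIcc c b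
  rw [← hc, segment_eq_image']
  exact ⟨σ, hσ, by simp only [smul_eq_mul]; ring⟩

theorem continuousOn_primitive_integrand {p : ℝ × ℝ → ℝ} {s : Set ℝ} {l : ℝ}
    (hp : ∀ t ∈ s, ContDiffAt ℝ ∞ p (t, l)) : ContinuousOn (fun t => p (t, l)) s := fun t ht =>
  ((hp t ht).continuousAt.comp (f := fun t : ℝ => (t, l)) (by fun_prop)).continuousWithinAt

theorem hasDerivAt_primitive_fst {p : ℝ × ℝ → ℝ} {c b l : ℝ}
    (hp : ∀ t ∈ uIcc c b, ContDiffAt ℝ ∞ p (t, l)) :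
    HasDerivAt (fun x => ∫ t in c..x, p (t, l)) (p (b, l)) b := by
  have hb := hp b right_mem_uIcc
  have h1 : ContDiffAt ℝ ∞ (fun t : ℝ => p (t, l)) b :=
    hb.comp (f := fun t : ℝ => (t, l)) b (by fun_prop)
  obtain ⟨u, hu, hcu⟩ := (h1.of_le (m := 1) (by exact_mod_cast le_top)).contDiffOn
    (m := 1) le_rfl (by simp)
  obtain ⟨w, hwu, hwo, hbw⟩ := mem_nhds_iff.1 (by simpa using hu : u ∈ 𝓝 b)
  refine intervalIntegral.integral_hasDerivAt_right
    (continuousOn_primitive_integrand hp).intervalIntegrable ?_ h1.continuousAt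
  exact (hcu.continuousOn.mono hwu).stronglyMeasurableAtFilter hwo b hbw

theorem hasDerivAt_integral_param {p : ℝ × ℝ → ℝ} {p' : ℝ → ℝ} {a b l : ℝ}
    (hp : ∀ t ∈ uIcc a b, ContDiffAt ℝ ∞ p (t, l))
    (hp' : ∀ t ∈ uIcc a b, HasDerivAt (fun l' => p (t, l')) (p' t) l) :
    HasDerivAt (fun l' => ∫ t in a..b, p (t, l')) (∫ t in a..b, p' t) l := by
  have hg : ∀ t ∈ uIcc a b, ContDiffAt ℝ (1 : ℕ) (fun w : ℝ × ℝ => p (w.2, w.1)) (l, t) :=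
    fun t ht => ((contDiffAt_infty.1 (hp t ht)) 1).comp (g := p)
      (f := fun w : ℝ × ℝ => (w.2, w.1)) (l, t) (by fun_prop)
  obtain ⟨V, hV, hz, h⟩ := eventually_contDiffAt_slice hg
  have h2 := hasFDerivAt_intervalIntegral_of_contDiffAt hV hz (by simpa using h)
  have h3 := h2.hasDerivAt
  have hint : IntervalIntegrable (fun t => (fderiv ℝ (fun w : ℝ × ℝ => p (w.2, w.1)) (l, t)).comp
      (ContinuousLinearMap.inl ℝ ℝ ℝ)) volume a b := by
    refine ContinuousOn.intervalIntegrable fun t ht => ?_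
    exact ((((hg t ht).fderiv_right (m := 0) (by norm_num)).clm_comp
      contDiffAt_const).continuousAt.comp (f := fun t : ℝ => (l, t))
      (g := fun w => (fderiv ℝ (fun w : ℝ × ℝ => p (w.2, w.1)) w).comp
      (ContinuousLinearMap.inl ℝ ℝ ℝ)) (by fun_prop)).continuousWithinAt
  rw [ContinuousLinearMap.intervalIntegral_apply hint] at h3
  convert! h3 using 1
  refine intervalIntegral.integral_congr fun t ht => ?_
  have h4 : HasFDerivAt (fun w : ℝ × ℝ => p (w.2, w.1)) _ (l, t) :=
    ((hg t ht).differentiableAt (by simp)).hasFDerivAt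
  have h5 := HasFDerivAt.comp (g := fun w : ℝ × ℝ => p (w.2, w.1)) (f := fun l' : ℝ => (l', t)) l
    h4 (hasFDerivAt_prodMk_left l t)
  exact (hp' t ht).unique h5.hasDerivAt

/-- The implicit function theorem for `((T, l), q) ↦ f (q, l) - T`. It serves twice: to solve
`polarTime = T` for `q`, and `tortoise = x` for `r`. -/
theorem exists_contDiffAt_partial_inverse {f : ℝ × ℝ → ℝ} {q l f' : ℝ}
    (hf : ContDiffAt ℝ ∞ f (q, l)) (hd : HasDerivAt (fun q' => f (q', l)) f' q) (hf' : f' ≠ 0) :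
    ∃ σ : ℝ × ℝ → ℝ, ContDiffAt ℝ ∞ σ (f (q, l), l) ∧ σ (f (q, l), l) = q ∧
      ∀ᶠ z in 𝓝 (f (q, l), l), f (σ z, z.2) = z.1 := by
  let G : (ℝ × ℝ) × ℝ → ℝ := fun w => f (w.2, w.1.2) - w.1.1
  have hG : ContDiffAt ℝ ∞ G ((f (q, l), l), q) :=
    (hf.comp (f := fun w : (ℝ × ℝ) × ℝ => (w.2, w.1.2)) ((f (q, l), l), q) (by fun_prop)).sub
      (by fun_prop)
  have hGd : HasDerivAt (fun q' => G ((f (q, l), l), q')) f' q := hd.sub_const _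
  have hcomp := (hG.differentiableAt (by simp)).hasFDerivAt.comp q
    (hasFDerivAt_prodMk_right (f (q, l), l) q)
  have hinv : (fderiv ℝ G ((f (q, l), l), q) ∘L .inr ℝ (ℝ × ℝ) ℝ).IsInvertible := by
    refine ⟨ContinuousLinearEquiv.unitsEquivAut ℝ (Units.mk0 f' hf'), ?_⟩
    ext
    have := hGd.unique hcomp.hasDerivAt
    simpa using this
  refine ⟨hG.implicitFunction (by simp) hinv, hG.contDiffAt_implicitFunction (by simp) hinv,
    hG.implicitFunction_apply_self (by simp) hinv, ?_⟩
  filter_upwards [hG.eventually_apply_implicitFunction (by simp) hinv] with z hz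
  simp only [G, sub_self] at hz
  linarith

/-! ### Smooth functions on the closed strip -/

/-- The strip `ℝ × [0, 1]`, the range of the coordinates `r⋆` and `sin² θ⋆`. -/
def strip : Set (ℝ × ℝ) := univ ×ˢ Icc 0 1

theorem uniqueDiffOn_strip : UniqueDiffOn ℝ strip :=
  uniqueDiffOn_univ.prod (uniqueDiffOn_Icc zero_lt_one)

theorem mem_strip {x l : ℝ} (hl : l ∈ Icc (0 : ℝ) 1) : (x, l) ∈ strip := ⟨mem_univ _, hl⟩

theorem sin_sq_mem_Icc (y : ℝ) : sin y ^ 2 ∈ Icc (0 : ℝ) 1 := ⟨sq_nonneg _, sin_sq_le_one y⟩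

/-- The derivative on `strip` with respect to the first coordinate. -/
def derivFst (G : ℝ × ℝ → ℝ) (p : ℝ × ℝ) : ℝ := fderivWithin ℝ G strip p (1, 0)

/-- The derivative on `strip` with respect to the second coordinate. -/
def derivSnd (G : ℝ × ℝ → ℝ) (p : ℝ × ℝ) : ℝ := fderivWithin ℝ G strip p (0, 1)

theorem contDiffOn_derivFst {G : ℝ × ℝ → ℝ} (hG : ContDiffOn ℝ ∞ G strip) :
    ContDiffOn ℝ ∞ (derivFst G) strip :=
  (hG.fderivWithin uniqueDiffOn_strip (m := ∞) (by simp)).clm_apply contDiffOn_const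

theorem contDiffOn_derivSnd {G : ℝ × ℝ → ℝ} (hG : ContDiffOn ℝ ∞ G strip) :
    ContDiffOn ℝ ∞ (derivSnd G) strip :=
  (hG.fderivWithin uniqueDiffOn_strip (m := ∞) (by simp)).clm_apply contDiffOn_const

/-- A curve that never leaves the strip has a two-sided derivative even where it touches an edge.
This lets `y ↦ sin y ^ 2` pass through the poles and the equator with no information on `G` outside
the strip. -/
theorem hasDerivAt_comp_strip {G : ℝ × ℝ → ℝ} (hG : ContDiffOn ℝ ∞ G strip)
    {γ : ℝ → ℝ × ℝ} {v : ℝ × ℝ} {t : ℝ} (hγ : ∀ t, γ t ∈ strip) (hv : HasDerivAt γ v t) :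
    HasDerivAt (fun t => G (γ t)) (fderivWithin ℝ G strip (γ t) v) t := by
  have h1 := (hG.differentiableOn (by simp) (γ t) (hγ t)).hasFDerivWithinAt
  have h2 := h1.comp_hasDerivWithinAt (s := univ) t hv.hasDerivWithinAt fun t _ => hγ t
  exact hasDerivWithinAt_univ.1 h2

theorem hasDerivAt_strip_fst {G : ℝ × ℝ → ℝ} (hG : ContDiffOn ℝ ∞ G strip) {x l : ℝ}
    (hl : l ∈ Icc (0 : ℝ) 1) : HasDerivAt (fun x => G (x, l)) (derivFst G (x, l)) x :=
  hasDerivAt_comp_strip hG (fun _ => mem_strip hl)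
    ((hasDerivAt_id x).prodMk (hasDerivAt_const x l))

theorem hasDerivAt_sin_sq (y : ℝ) : HasDerivAt (fun y => sin y ^ 2) (sin (2 * y)) y := by
  have := (hasDerivAt_sin y).pow 2
  rw [sin_two_mul]
  convert! this using 1
  norm_num

theorem hasDerivAt_strip_sin_sq {G : ℝ × ℝ → ℝ} (hG : ContDiffOn ℝ ∞ G strip) (x y : ℝ) :
    HasDerivAt (fun y => G (x, sin y ^ 2)) (sin (2 * y) * derivSnd G (x, sin y ^ 2)) y := by
  have := hasDerivAt_comp_strip hG (γ := fun y => (x, sin y ^ 2))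
    (fun y => mem_strip (sin_sq_mem_Icc y)) ((hasDerivAt_const y x).prodMk (hasDerivAt_sin_sq y))
  convert! this using 1
  rw [derivSnd, ← smul_eq_mul, ← map_smul]
  simp

theorem hasDerivWithinAt_strip_snd {G : ℝ × ℝ → ℝ} (hG : ContDiffOn ℝ ∞ G strip) {x l : ℝ}
    (hl : l ∈ Icc (0 : ℝ) 1) :
    HasDerivWithinAt (fun l => G (x, l)) (derivSnd G (x, l)) (Icc 0 1) l := by
  have h1 := (hG.differentiableOn (by simp) (x, l) (mem_strip hl)).hasFDerivWithinAt
  exact h1.comp_hasDerivWithinAt (f := fun l => (x, l)) l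
    ((hasDerivAt_const l x).prodMk (hasDerivAt_id l)).hasDerivWithinAt fun l hl => mem_strip hl

theorem isOpen_regularAngles : IsOpen regularAngles := isOpen_Ioo.sdiff isClosed_singleton

theorem sin_two_mul_ne_zero_of_mem_regularAngles {y : ℝ} (hy : y ∈ regularAngles) :
    sin (2 * y) ≠ 0 := by
  obtain ⟨⟨h0, hpi⟩, hne⟩ := hy
  rw [sin_two_mul]
  have h1 : cos y ≠ 0 := by
    intro h
    refine hne ?_
    have := injOn_cos ⟨h0.le, hpi.le⟩ (x₂ := π / 2) ⟨by positivity, by linarith [pi_pos]⟩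
      (by rw [h, cos_pi_div_two])
    exact this
  have h2 := (sin_pos_of_pos_of_lt_pi h0 hpi).ne'
  positivity

theorem hasContinuousExtension_of_contDiffOn {G : ℝ × ℝ → ℝ} (hG : ContDiffOn ℝ ∞ G strip)
    {S : Set ℝ} {f : ℝ → ℝ → ℝ} (hf : ∀ x, ∀ y ∈ S, f x y = G (x, sin y ^ 2)) :
    HasContinuousExtension S f := by
  refine ⟨fun p => G (p.1, sin p.2 ^ 2), ?_, fun x y hy => (hf x y hy).symm⟩
  exact hG.continuousOn.comp (by fun_prop) fun p _ => mem_strip (sin_sq_mem_Icc _)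

/-- Functions of the form `G (x, sin y ^ 2)` are stable under both operators, which act on `G` as
`derivFst` and `derivSnd`. The set `S` varies in the induction because it shrinks to `regularAngles`
after a `θ⋆`-derivative. -/
theorem isSmoothOfOrder_of_contDiffOn (n : ℕ) {G : ℝ × ℝ → ℝ} (hG : ContDiffOn ℝ ∞ G strip)
    {S : Set ℝ} (hS : regularAngles ⊆ S) {f : ℝ → ℝ → ℝ}
    (hf : ∀ x, ∀ y ∈ S, f x y = G (x, sin y ^ 2)) : IsSmoothOfOrder n S f := by
  induction n generalizing G S f with
  | zero => exact hasContinuousExtension_of_contDiffOn hG hf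
  | succ n ih =>
    have hx : ∀ x, ∀ y ∈ S,
        HasDerivAt (fun x' => f x' y) (derivFst G (x, sin y ^ 2)) x := by
      intro x y hy
      simpa only [funext fun x' => hf x' y hy] using hasDerivAt_strip_fst hG (sin_sq_mem_Icc y)
    have hy : ∀ x, ∀ y ∈ regularAngles, HasDerivAt (fun y' => f x y')
        (sin (2 * y) * derivSnd G (x, sin y ^ 2)) y := by
      intro x y hy
      refine (hasDerivAt_strip_sin_sq hG x y).congr_of_eventuallyEq ?_
      filter_upwards [isOpen_regularAngles.mem_nhds hy] with y' hy'
      exact hf x y' (hS hy')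
    refine ⟨hasContinuousExtension_of_contDiffOn hG hf,
      fun x y h => (hx x y h).differentiableAt, fun x y h => (hy x y h).differentiableAt,
      ih (contDiffOn_derivFst hG) hS fun x y h => (hx x y h).deriv,
      ih (contDiffOn_derivSnd hG) subset_rfl fun x y h => ?_⟩
    have := sin_two_mul_ne_zero_of_mem_regularAngles h
    rw [dThetaStar, (hy x y h).deriv]
    field_simp

theorem isSmoothStar_of_contDiffOn {G : ℝ × ℝ → ℝ} (hG : ContDiffOn ℝ ∞ G strip)
    {S : Set ℝ} (hS : regularAngles ⊆ S) {f : ℝ → ℝ → ℝ}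
    (hf : ∀ x, ∀ y ∈ S, f x y = G (x, sin y ^ 2)) : IsSmoothStar S f :=
  fun n => isSmoothOfOrder_of_contDiffOn n hG hS hf

/-! ### The radial functions -/

namespace KNdS

variable (K : KNdS)

/-! ### The roots of `Δ_r` -/

theorem divided_difference_two {x y : ℝ} (hxy : x ≠ y) (hx : K.DeltaR x = 0)
    (hy : K.DeltaR y = 0) :
    -(K.Lam / 3) * (x ^ 3 + x ^ 2 * y + x * y ^ 2 + y ^ 3)
      + (1 - K.Lam / 3 * K.a ^ 2) * (x + y) - 2 * K.M = 0 := by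
  refine mul_left_cancel₀ (sub_ne_zero.2 hxy) ?_
  unfold DeltaR at hx hy
  linear_combination hx - hy

/-- The second divided difference of `Δ_r` at three of its roots vanishes. `M` and `e` drop out,
leaving a relation between `Λ`, `a` and the roots. -/
theorem divided_difference_three {x y z : ℝ} (hxy : x ≠ y) (hxz : x ≠ z) (hyz : y ≠ z)
    (hx : K.DeltaR x = 0) (hy : K.DeltaR y = 0) (hz : K.DeltaR z = 0) :
    K.Lam / 3 * (K.a ^ 2 + x ^ 2 + y ^ 2 + z ^ 2 + x * y + x * z + y * z) = 1 := by
  have h1 := K.divided_difference_two hxy hx hy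
  have h2 := K.divided_difference_two hxz hx hz
  refine mul_left_cancel₀ (sub_ne_zero.2 hyz) ?_
  linear_combination h2 - h1

theorem lam_mul_eq_one :
    K.Lam / 3 * (K.a ^ 2 + K.rm ^ 2 + K.rp ^ 2 + K.rc ^ 2 + K.rm * K.rp + K.rm * K.rc
      + K.rp * K.rc) = 1 :=
  K.divided_difference_three K.rm_lt_rp.ne (K.rm_lt_rp.trans K.rp_lt_rc).ne K.rp_lt_rc.ne
    K.root_rm K.root_rp K.root_rc

/-- A quartic without cubic term has roots of sum zero, so the fourth root is `-(r_- + r_+ + r_c)`.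
-/
theorem deltaR_eq (r : ℝ) : K.DeltaR r =
    -((r - K.rm) * (K.rp - r) * (K.Lam / 3 * ((K.rc - r) * (r + (K.rm + K.rp + K.rc))))) := by
  have h1 := K.lam_mul_eq_one
  have h2 := K.divided_difference_two K.rm_lt_rp.ne K.root_rm K.root_rp
  have h3 : K.DeltaR K.rp = 0 := K.root_rp
  unfold DeltaR at h3 ⊢
  linear_combination h3 + (r - K.rp) * h2 - (r - K.rp) * (r - K.rm) * h1

theorem cofactor_pos {r : ℝ} (hr : r ∈ Icc K.rm K.rp) :
    0 < K.Lam / 3 * ((K.rc - r) * (r + (K.rm + K.rp + K.rc))) := by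
  have h1 := K.Lam_pos
  have h2 := K.rm_pos
  have h3 := K.rm_lt_rp
  have h4 := K.rp_lt_rc
  have h5 : 0 < K.rc - r := by linarith [hr.2]
  have h6 : 0 < r + (K.rm + K.rp + K.rc) := by linarith [hr.1]
  positivity

theorem deltaR_neg {r : ℝ} (hr : r ∈ Ioo K.rm K.rp) : K.DeltaR r < 0 := by
  rw [deltaR_eq, neg_lt_zero]
  exact mul_pos (mul_pos (sub_pos.2 hr.1) (sub_pos.2 hr.2)) (K.cofactor_pos (Ioo_subset_Icc_self hr))

theorem deltaR_nonpos {r : ℝ} (hr : r ∈ Icc K.rm K.rp) : K.DeltaR r ≤ 0 := by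
  rw [deltaR_eq, neg_nonpos]
  exact mul_nonneg (mul_nonneg (sub_nonneg.2 hr.1) (sub_nonneg.2 hr.2)) (K.cofactor_pos hr).le

theorem a_sq_pos : 0 < K.a ^ 2 := sq_pos_of_ne_zero K.a_ne_zero

theorem abs_a_pos : 0 < |K.a| := abs_pos.2 K.a_ne_zero

theorem r_pos {r : ℝ} (hr : r ∈ Icc K.rm K.rp) : 0 < r := K.rm_pos.trans_le hr.1

theorem rSq_add_pos (r : ℝ) : 0 < r ^ 2 + K.a ^ 2 := by
  have := K.a_sq_pos; positivity

/-- The rotation parameter in units of the cosmological constant, `Ξ - 1`. -/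
def kappa : ℝ := K.Lam / 3 * K.a ^ 2

theorem kappa_pos : 0 < K.kappa := by
  have := K.a_sq_pos
  have := K.Lam_pos
  unfold kappa
  positivity

theorem xi_eq : K.Xi = 1 + K.kappa := rfl

theorem xi_pos : 0 < K.Xi := by rw [xi_eq]; linarith [K.kappa_pos]

theorem deltaR_contDiff : ContDiff ℝ ∞ K.DeltaR := by unfold DeltaR; fun_prop

/-! ### The function `Q̂` -/

/-- The square of `Q̂`. -/
def qSq (r l : ℝ) : ℝ := (r ^ 2 + K.a ^ 2) ^ 2 - K.a ^ 2 * l * K.DeltaR r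

theorem sq_le_qSq {r l : ℝ} (hr : r ∈ Icc K.rm K.rp) (hl : 0 ≤ l) :
    (r ^ 2 + K.a ^ 2) ^ 2 ≤ K.qSq r l := by
  have h := mul_nonneg (mul_nonneg K.a_sq_pos.le hl) (neg_nonneg.2 (K.deltaR_nonpos hr))
  unfold qSq
  linarith

theorem qSq_pos {r l : ℝ} (hr : r ∈ Icc K.rm K.rp) (hl : 0 ≤ l) : 0 < K.qSq r l :=
  (pow_pos (K.rSq_add_pos r) 2).trans_le (K.sq_le_qSq hr hl)

theorem le_qHat {r l : ℝ} (hr : r ∈ Icc K.rm K.rp) (hl : 0 ≤ l) :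
    r ^ 2 + K.a ^ 2 ≤ K.QHat r l :=
  le_sqrt_of_sq_le (K.sq_le_qSq hr hl)

theorem qHat_pos {r l : ℝ} (hr : r ∈ Icc K.rm K.rp) (hl : 0 ≤ l) : 0 < K.QHat r l :=
  (K.rSq_add_pos r).trans_le (K.le_qHat hr hl)

theorem qHat_sq {r l : ℝ} (hr : r ∈ Icc K.rm K.rp) (hl : 0 ≤ l) :
    K.QHat r l ^ 2 = (r ^ 2 + K.a ^ 2) ^ 2 - K.a ^ 2 * l * K.DeltaR r :=
  sq_sqrt (K.qSq_pos hr hl).le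

theorem qHat_mono {r l l' : ℝ} (hr : r ∈ Icc K.rm K.rp) (hl : l ≤ l') :
    K.QHat r l ≤ K.QHat r l' := by
  refine sqrt_le_sqrt ?_
  have := mul_le_mul_of_nonpos_right (mul_le_mul_of_nonneg_left hl K.a_sq_pos.le)
    (K.deltaR_nonpos hr)
  linarith

theorem qHat_contDiffAt {r l : ℝ} (hr : r ∈ Icc K.rm K.rp) (hl : 0 ≤ l) :
    ContDiffAt ℝ ∞ (fun p : ℝ × ℝ => K.QHat p.1 p.2) (r, l) := by
  refine ContDiffAt.sqrt ?_ (K.qSq_pos hr hl).ne'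
  have := K.deltaR_contDiff
  fun_prop

theorem hasDerivAt_qHat_snd {r l : ℝ} (hr : r ∈ Icc K.rm K.rp) (hl : 0 ≤ l) :
    HasDerivAt (fun l => K.QHat r l) (-(K.a ^ 2 * K.DeltaR r) / (2 * K.QHat r l)) l := by
  have h : HasDerivAt (fun l => (r ^ 2 + K.a ^ 2) ^ 2 - K.a ^ 2 * l * K.DeltaR r)
      (-(K.a ^ 2 * K.DeltaR r)) l := by
    simpa using (((hasDerivAt_id l).const_mul (K.a ^ 2)).mul_const (K.DeltaR r)).const_sub
      ((r ^ 2 + K.a ^ 2) ^ 2)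
  exact h.sqrt (K.qSq_pos hr hl).ne'

theorem mem_Icc_of_mem_uIcc_rp {r t : ℝ} (hr : r ∈ Icc K.rm K.rp) (ht : t ∈ uIcc K.rp r) :
    t ∈ Icc K.rm K.rp := by
  rw [uIcc_of_ge hr.2] at ht
  exact ⟨hr.1.trans ht.1, ht.2⟩

theorem mem_Ioo_of_mem_uIcc_r0 {r t : ℝ} (hr : r ∈ Ioo K.rm K.rp) (ht : t ∈ uIcc K.r0 r) :
    t ∈ Ioo K.rm K.rp :=
  ordConnected_Ioo.uIcc_subset K.r0_mem hr ht

theorem mem_Icc_of_mem_Ioo {r : ℝ} (hr : r ∈ Ioo K.rm K.rp) : r ∈ Icc K.rm K.rp :=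
  Ioo_subset_Icc_self hr

/-- The integral of `1 / Q̂` from `r` to `r_+`. -/
def radialTime (p : ℝ × ℝ) : ℝ := -∫ t in K.rp..p.1, 1 / K.QHat t p.2

theorem radialTime_integrand {t l : ℝ} (ht : t ∈ Icc K.rm K.rp) (hl : 0 ≤ l) :
    ContDiffAt ℝ ∞ (fun p : ℝ × ℝ => 1 / K.QHat p.1 p.2) (t, l) :=
  contDiffAt_const.div (K.qHat_contDiffAt ht hl) (K.qHat_pos ht hl).ne'

theorem radialTime_contDiffAt {r l : ℝ} (hr : r ∈ Icc K.rm K.rp) (hl : 0 ≤ l) :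
    ContDiffAt ℝ ∞ K.radialTime (r, l) :=
  (contDiffAt_primitive (p := fun p : ℝ × ℝ => 1 / K.QHat p.1 p.2) fun _ ht =>
    K.radialTime_integrand (K.mem_Icc_of_mem_uIcc_rp hr ht) hl).neg

theorem hasDerivAt_radialTime {r l : ℝ} (hr : r ∈ Icc K.rm K.rp) (hl : 0 ≤ l) :
    HasDerivAt (fun r => K.radialTime (r, l)) (-(1 / K.QHat r l)) r :=
  (hasDerivAt_primitive_fst (p := fun p : ℝ × ℝ => 1 / K.QHat p.1 p.2) fun _ ht =>
    K.radialTime_integrand (K.mem_Icc_of_mem_uIcc_rp hr ht) hl).neg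

theorem radialTime_eq (r l : ℝ) :
    K.radialTime (r, l) = ∫ t in r..K.rp, 1 / K.QHat t l :=
  (intervalIntegral.integral_symm _ _).symm

theorem intervalIntegrable_radialTime {r l : ℝ} (hr : r ∈ Icc K.rm K.rp) (hl : 0 ≤ l) :
    IntervalIntegrable (fun t => 1 / K.QHat t l) volume r K.rp :=
  (continuousOn_primitive_integrand (p := fun p : ℝ × ℝ => 1 / K.QHat p.1 p.2) fun _ ht =>
    K.radialTime_integrand (K.mem_Icc_of_mem_uIcc_rp hr (by rwa [uIcc_comm])) hl).intervalIntegrable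

theorem radialTime_pos {r l : ℝ} (hr : r ∈ Ioo K.rm K.rp) (hl : 0 ≤ l) :
    0 < K.radialTime (r, l) := by
  rw [radialTime_eq]
  refine intervalIntegral.intervalIntegral_pos_of_pos_on
    (K.intervalIntegrable_radialTime (K.mem_Icc_of_mem_Ioo hr) hl) (fun t ht => ?_) hr.2
  exact one_div_pos.2 (K.qHat_pos ⟨(hr.1.trans ht.1).le, ht.2.le⟩ hl)

theorem radialTime_anti {r l l' : ℝ} (hr : r ∈ Icc K.rm K.rp) (hl : 0 ≤ l) (hll : l ≤ l') :
    K.radialTime (r, l') ≤ K.radialTime (r, l) := by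
  rw [radialTime_eq, radialTime_eq]
  refine intervalIntegral.integral_mono_on hr.2
    (K.intervalIntegrable_radialTime hr (hl.trans hll)) (K.intervalIntegrable_radialTime hr hl)
    fun t ht => ?_
  have ht' : t ∈ Icc K.rm K.rp := ⟨hr.1.trans ht.1, ht.2⟩
  exact one_div_le_one_div_of_le (K.qHat_pos ht' hl) (K.qHat_mono ht' hll)

theorem qHat_zero (r : ℝ) : K.QHat r 0 = r ^ 2 + K.a ^ 2 := by
  simp only [QHat, mul_zero, zero_mul, sub_zero]
  exact sqrt_sq (K.rSq_add_pos r).le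

theorem radialTime_zero {r : ℝ} (hr : r ∈ Icc K.rm K.rp) :
    K.radialTime (r, 0) = (arctan (K.rp / |K.a|) - arctan (r / |K.a|)) / |K.a| := by
  have ha := K.abs_a_pos
  rw [radialTime_eq, intervalIntegral.integral_eq_sub_of_hasDerivAt
    (f := fun t => arctan (t / |K.a|) / |K.a|) (fun t _ => ?_)
    (K.intervalIntegrable_radialTime hr le_rfl)]
  · ring
  · rw [qHat_zero, ← sq_abs K.a]
    refine ((((hasDerivAt_id t).div_const |K.a|).arctan).div_const |K.a|).congr_deriv ?_
    simp only [id]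
    field_simp
    ring

/-- Equivalent to `√κ r_+ / |a| < 1`, that is `Λ r_+² / 3 < 1`, and the latter is one of the
positive terms whose sum is `1` in `lam_mul_eq_one`. -/
theorem arctan_add_arctan_lt : arctan (K.rp / |K.a|) + arctan (√K.kappa) < π / 2 := by
  have ha := K.abs_a_pos
  have hp : 0 < K.rp := K.rm_pos.trans K.rm_lt_rp
  have hk := K.kappa_pos
  have h0 : 0 < K.rp / |K.a| := by positivity
  have hLam : K.Lam / 3 * K.rp ^ 2 < 1 := by
    have h1 := K.lam_mul_eq_one
    have h2 : 0 < K.a ^ 2 + K.rm ^ 2 + K.rc ^ 2 + K.rm * K.rp + K.rm * K.rc + K.rp * K.rc := by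
      have := K.rm_pos
      have := hp.trans K.rp_lt_rc
      have := K.a_sq_pos
      positivity
    have h3 := mul_pos (div_pos K.Lam_pos three_pos) h2
    linarith
  have h1 : √K.kappa < (K.rp / |K.a|)⁻¹ := by
    rw [sqrt_lt' (by positivity), inv_div, div_pow, sq_abs, lt_div_iff₀ (by positivity), kappa]
    have := mul_lt_mul_of_pos_right hLam K.a_sq_pos
    linarith
  have h2 := arctan_strictMono h1
  rw [arctan_inv_of_pos h0] at h2
  linarith

/-- `Q̂` increases with `l`, so `l = 0` is the worst case, and there the integral is an explicit
arctangent. The bound is the total polar time at `l = 0`, multiplied by `|a|`. -/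
theorem abs_mul_radialTime_lt {r l : ℝ} (hr : r ∈ Ioo K.rm K.rp) (hl : 0 ≤ l) :
    |K.a| * K.radialTime (r, l) < π / 2 - arctan (√K.kappa) := by
  have hr' := K.mem_Icc_of_mem_Ioo hr
  have h1 := K.radialTime_anti hr' le_rfl hl
  rw [K.radialTime_zero hr'] at h1
  have ha := K.abs_a_pos
  rw [le_div_iff₀ ha] at h1
  have h2 : 0 < arctan (r / |K.a|) := arctan_pos.2 (div_pos (K.r_pos hr') ha)
  linarith [K.arctan_add_arctan_lt]

end KNdS

theorem hasDerivAt_one_div_mul_sqrt {g : ℝ → ℝ} {g' x c : ℝ} (hg : HasDerivAt g g' x)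
    (hx : 0 < g x) (hc : c ≠ 0) :
    HasDerivAt (fun x => 1 / (c * √(g x))) (-(1 / (c * √(g x))) * (g' / (2 * g x))) x := by
  have hs : 0 < √(g x) := sqrt_pos.2 hx
  refine ((hasDerivAt_const x (1 : ℝ)).div ((hg.sqrt hx.ne').const_mul c)
    (by positivity)).congr_deriv ?_
  have h2 : √(g x) ^ 2 = g x := sq_sqrt hx.le
  field_simp
  rw [h2]
  ring

namespace KNdS

variable (K : KNdS)

/-! ### The polar motion

With `l = sin² θ⋆`, the value of `sin² θ` along the polar motion is written as `l * sinFactor q l`, that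
of `cos² θ` as `(1 - l) * cosFactor q l`, and `P̂²` as `a² l (1 - l) * polarFactor q l`. -/

def sinFactor (q l : ℝ) : ℝ := 1 - (1 - l) * q

def cosFactor (q l : ℝ) : ℝ := 1 + l * q

def polarFactor (q l : ℝ) : ℝ := K.kappa + (1 + l * K.kappa) * q

/-- The points `(q, l)` at which the three factors are positive. -/
def polarDomain : Set (ℝ × ℝ) :=
  {p | 0 < sinFactor p.1 p.2 ∧ 0 < cosFactor p.1 p.2 ∧ 0 < K.polarFactor p.1 p.2}

/-- The product of the three factors. -/
def cubic (q l : ℝ) : ℝ := sinFactor q l * cosFactor q l * K.polarFactor q l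

/-- The derivative of the polar time with respect to `q`. -/
def slowness (p : ℝ × ℝ) : ℝ := 1 / (2 * |K.a| * √(K.cubic p.1 p.2))

/-- The integral of `1 / P̂` between `θ` and `θ⋆`. -/
def polarTime (p : ℝ × ℝ) : ℝ := ∫ t in (0 : ℝ)..p.1, K.slowness (t, p.2)

/-- `Δ_θ` -/
def polarDelta (q l : ℝ) : ℝ := K.Xi - K.kappa * (l * sinFactor q l)

/-- The derivative of `r⋆` with respect to `sin² θ`. -/
def polarWeight (p : ℝ × ℝ) : ℝ :=
  K.a ^ 2 * K.polarFactor p.1 p.2 * K.slowness p / K.polarDelta p.1 p.2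

/-- The integral of `P̂ / Δ_θ` between `θ` and `θ⋆`. -/
def polarAction (p : ℝ × ℝ) : ℝ :=
  ∫ t in (0 : ℝ)..p.1, p.2 * (1 - p.2) * K.polarWeight (t, p.2)

/-- The integral of `1 / (P̂ Δ_θ)` between `θ` and `θ⋆`. -/
def polarTwist (p : ℝ × ℝ) : ℝ :=
  ∫ t in (0 : ℝ)..p.1, K.slowness (t, p.2) / K.polarDelta t p.2

theorem one_sub_mul_sinFactor (q l : ℝ) : 1 - l * sinFactor q l = (1 - l) * cosFactor q l := by
  unfold sinFactor cosFactor; ring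

/-- The reason for the parameter `q`: an explicit factor `l (1 - l)` splits off `P̂²`, and it
cancels when `dθ / P̂` is expressed through `dq`. -/
theorem pHatSq_eq (q l : ℝ) :
    l * K.polarDelta q l - l * sinFactor q l = l * (1 - l) * K.polarFactor q l := by
  unfold polarDelta polarFactor sinFactor; rw [xi_eq]; ring

variable {K}

theorem zero_mem_polarDomain (l : ℝ) : ((0 : ℝ), l) ∈ K.polarDomain := by
  simp [polarDomain, sinFactor, cosFactor, polarFactor, K.kappa_pos]

theorem mem_polarDomain_of_mem_segment {q₀ q₁ t l : ℝ} (h0 : (q₀, l) ∈ K.polarDomain)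
    (h1 : (q₁, l) ∈ K.polarDomain) (ht : t ∈ uIcc q₀ q₁) : (t, l) ∈ K.polarDomain := by
  rw [← segment_eq_uIcc] at ht
  obtain ⟨u, v, hu, hv, huv, rfl⟩ := ht
  obtain ⟨a1, a2, a3⟩ := h0
  obtain ⟨b1, b2, b3⟩ := h1
  have key : ∀ {x y : ℝ}, 0 < x → 0 < y → 0 < u * x + v * y := by
    intro x y hx hy
    rcases hu.eq_or_lt with rfl | hu'
    · rw [zero_add] at huv; subst huv; simpa using hy
    · have := mul_nonneg hv hy.le
      have := mul_pos hu' hx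
      linarith
  have hu1 : u = 1 - v := by linarith
  refine ⟨?_, ?_, ?_⟩
  · convert! key a1 b1 using 1; simp only [sinFactor, smul_eq_mul]; rw [hu1]; ring
  · convert! key a2 b2 using 1; simp only [cosFactor, smul_eq_mul]; rw [hu1]; ring
  · convert! key a3 b3 using 1; simp only [polarFactor, smul_eq_mul]; rw [hu1]; ring

theorem mem_polarDomain_of_mem_uIcc {q t l : ℝ} (h : (q, l) ∈ K.polarDomain)
    (ht : t ∈ uIcc 0 q) : (t, l) ∈ K.polarDomain :=
  mem_polarDomain_of_mem_segment (zero_mem_polarDomain l) h ht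

theorem mem_polarDomain {q l : ℝ} (hl : 0 ≤ l) (hq : 0 ≤ q) (h : 0 < sinFactor q l) :
    (q, l) ∈ K.polarDomain := by
  have := K.kappa_pos
  refine ⟨h, ?_, ?_⟩
  · simp only [cosFactor]; positivity
  · simp only [polarFactor]; positivity

theorem cubic_pos {q l : ℝ} (h : (q, l) ∈ K.polarDomain) : 0 < K.cubic q l :=
  mul_pos (mul_pos h.1 h.2.1) h.2.2

theorem slowness_pos {q l : ℝ} (h : (q, l) ∈ K.polarDomain) : 0 < K.slowness (q, l) := by
  have := K.abs_a_pos
  have := sqrt_pos.2 (cubic_pos h)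
  simp only [slowness]
  positivity

theorem one_le_polarDelta {q l : ℝ} (h : (q, l) ∈ K.polarDomain) (hl : l ∈ Icc (0 : ℝ) 1) :
    1 ≤ K.polarDelta q l := by
  have h1 := mul_nonneg (sub_nonneg.2 hl.2) h.2.1.le
  rw [← one_sub_mul_sinFactor] at h1
  have h2 := mul_nonneg K.kappa_pos.le h1
  rw [polarDelta, xi_eq]
  linarith

theorem polarDelta_pos {q l : ℝ} (h : (q, l) ∈ K.polarDomain) (hl : l ∈ Icc (0 : ℝ) 1) :
    0 < K.polarDelta q l := zero_lt_one.trans_le (one_le_polarDelta h hl)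

theorem slowness_contDiffAt {q l : ℝ} (h : (q, l) ∈ K.polarDomain) :
    ContDiffAt ℝ ∞ K.slowness (q, l) := by
  have h1 := sqrt_pos.2 (cubic_pos h)
  have h2 := K.abs_a_pos
  refine contDiffAt_const.div (contDiffAt_const.mul (ContDiffAt.sqrt ?_ (cubic_pos h).ne'))
    (by positivity)
  unfold cubic sinFactor cosFactor polarFactor
  fun_prop

theorem polarDelta_contDiff : ContDiff ℝ ∞ fun p : ℝ × ℝ => K.polarDelta p.1 p.2 := by
  unfold polarDelta sinFactor; fun_prop

theorem polarFactor_contDiff : ContDiff ℝ ∞ fun p : ℝ × ℝ => K.polarFactor p.1 p.2 := by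
  unfold polarFactor; fun_prop

theorem polarWeight_contDiffAt {q l : ℝ} (h : (q, l) ∈ K.polarDomain) (hl : l ∈ Icc (0 : ℝ) 1) :
    ContDiffAt ℝ ∞ K.polarWeight (q, l) :=
  ((contDiffAt_const.mul polarFactor_contDiff.contDiffAt).mul (slowness_contDiffAt h)).div
    polarDelta_contDiff.contDiffAt (polarDelta_pos h hl).ne'

theorem polarTime_contDiffAt {q l : ℝ} (h : (q, l) ∈ K.polarDomain) :
    ContDiffAt ℝ ∞ K.polarTime (q, l) :=
  contDiffAt_primitive (p := K.slowness) fun _ ht =>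
    slowness_contDiffAt (mem_polarDomain_of_mem_uIcc h ht)

theorem hasDerivAt_polarTime {q l : ℝ} (h : (q, l) ∈ K.polarDomain) :
    HasDerivAt (fun q => K.polarTime (q, l)) (K.slowness (q, l)) q :=
  hasDerivAt_primitive_fst (p := K.slowness) fun _ ht =>
    slowness_contDiffAt (mem_polarDomain_of_mem_uIcc h ht)

theorem polarTime_zero (l : ℝ) : K.polarTime (0, l) = 0 := by simp [polarTime]

theorem polarAction_integrand {q l : ℝ} (h : (q, l) ∈ K.polarDomain) (hl : l ∈ Icc (0 : ℝ) 1) :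
    ContDiffAt ℝ ∞ (fun p : ℝ × ℝ => p.2 * (1 - p.2) * K.polarWeight p) (q, l) :=
  ContDiffAt.mul (by fun_prop) (polarWeight_contDiffAt h hl)

theorem polarAction_contDiffAt {q l : ℝ} (h : (q, l) ∈ K.polarDomain) (hl : l ∈ Icc (0 : ℝ) 1) :
    ContDiffAt ℝ ∞ K.polarAction (q, l) :=
  contDiffAt_primitive (p := fun p : ℝ × ℝ => p.2 * (1 - p.2) * K.polarWeight p) fun _ ht =>
    polarAction_integrand (mem_polarDomain_of_mem_uIcc h ht) hl

theorem hasDerivAt_polarAction {q l : ℝ} (h : (q, l) ∈ K.polarDomain) (hl : l ∈ Icc (0 : ℝ) 1) :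
    HasDerivAt (fun q => K.polarAction (q, l)) (l * (1 - l) * K.polarWeight (q, l)) q :=
  hasDerivAt_primitive_fst (p := fun p : ℝ × ℝ => p.2 * (1 - p.2) * K.polarWeight p) fun _ ht =>
    polarAction_integrand (mem_polarDomain_of_mem_uIcc h ht) hl

theorem polarTwist_integrand {q l : ℝ} (h : (q, l) ∈ K.polarDomain) (hl : l ∈ Icc (0 : ℝ) 1) :
    ContDiffAt ℝ ∞ (fun p : ℝ × ℝ => K.slowness p / K.polarDelta p.1 p.2) (q, l) :=
  (slowness_contDiffAt h).div polarDelta_contDiff.contDiffAt (polarDelta_pos h hl).ne'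

theorem polarTwist_contDiffAt {q l : ℝ} (h : (q, l) ∈ K.polarDomain) (hl : l ∈ Icc (0 : ℝ) 1) :
    ContDiffAt ℝ ∞ K.polarTwist (q, l) :=
  contDiffAt_primitive (p := fun p : ℝ × ℝ => K.slowness p / K.polarDelta p.1 p.2) fun _ ht =>
    polarTwist_integrand (mem_polarDomain_of_mem_uIcc h ht) hl

theorem hasDerivAt_polarTwist {q l : ℝ} (h : (q, l) ∈ K.polarDomain) (hl : l ∈ Icc (0 : ℝ) 1) :
    HasDerivAt (fun q => K.polarTwist (q, l)) (K.slowness (q, l) / K.polarDelta q l) q :=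
  hasDerivAt_primitive_fst (p := fun p : ℝ × ℝ => K.slowness p / K.polarDelta p.1 p.2)
    fun _ ht => polarTwist_integrand (mem_polarDomain_of_mem_uIcc h ht) hl

theorem convex_polarDomain_slice (l : ℝ) : Convex ℝ {q : ℝ | (q, l) ∈ K.polarDomain} := by
  refine convex_iff_segment_subset.2 fun x hx y hy t ht => ?_
  rw [segment_eq_uIcc] at ht
  exact mem_polarDomain_of_mem_segment hx hy ht

theorem isOpen_polarDomain : IsOpen K.polarDomain := by
  have h1 : IsOpen {p : ℝ × ℝ | 0 < sinFactor p.1 p.2} :=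
    isOpen_lt continuous_const (by unfold sinFactor; fun_prop)
  have h2 : IsOpen {p : ℝ × ℝ | 0 < cosFactor p.1 p.2} :=
    isOpen_lt continuous_const (by unfold cosFactor; fun_prop)
  exact h1.inter (h2.inter (isOpen_lt continuous_const polarFactor_contDiff.continuous))

theorem polarTime_strictMonoOn (l : ℝ) :
    StrictMonoOn (fun q => K.polarTime (q, l)) {q : ℝ | (q, l) ∈ K.polarDomain} := by
  refine strictMonoOn_of_deriv_pos (convex_polarDomain_slice l)
    (fun q hq => (hasDerivAt_polarTime hq).continuousAt.continuousWithinAt) fun q hq => ?_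
  have hq' := interior_subset hq
  rw [(hasDerivAt_polarTime hq').deriv]
  exact slowness_pos hq'

theorem hasDerivAt_slowness_fst {q l : ℝ} (h : (q, l) ∈ K.polarDomain) :
    HasDerivAt (fun q => K.slowness (q, l)) (-K.slowness (q, l) *
      ((-(1 - l) / sinFactor q l + l / cosFactor q l
        + (1 + l * K.kappa) / K.polarFactor q l) / 2)) q := by
  have h1 : HasDerivAt (fun q => K.cubic q l) ((-(1 - l) * cosFactor q l + sinFactor q l * l)
      * K.polarFactor q l + sinFactor q l * cosFactor q l * (1 + l * K.kappa)) q := by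
    unfold cubic sinFactor cosFactor polarFactor
    refine ((HasDerivAt.mul ?_ ?_).mul ?_)
    · simpa using ((hasDerivAt_id q).const_mul (1 - l)).const_sub 1
    · simpa using ((hasDerivAt_id q).const_mul l).const_add 1
    · simpa using ((hasDerivAt_id q).const_mul (1 + l * K.kappa)).const_add K.kappa
  refine (hasDerivAt_one_div_mul_sqrt h1 (cubic_pos h)
    (mul_pos two_pos K.abs_a_pos).ne').congr_deriv ?_
  have := h.1.ne'
  have := h.2.1.ne'
  have := h.2.2.ne'
  simp only [slowness]
  congr 1
  unfold cubic
  field_simp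

theorem hasDerivAt_slowness_snd {q l : ℝ} (h : (q, l) ∈ K.polarDomain) :
    HasDerivAt (fun l => K.slowness (q, l)) (-K.slowness (q, l) *
      ((q / sinFactor q l + q / cosFactor q l + K.kappa * q / K.polarFactor q l) / 2)) l := by
  have h1 : HasDerivAt (fun l => K.cubic q l) ((q * cosFactor q l + sinFactor q l * q)
      * K.polarFactor q l + sinFactor q l * cosFactor q l * (K.kappa * q)) l := by
    unfold cubic sinFactor cosFactor polarFactor
    refine ((HasDerivAt.mul ?_ ?_).mul ?_)
    · simpa using (((hasDerivAt_id l).const_sub 1).mul_const q).const_sub 1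
    · simpa using ((hasDerivAt_id l).mul_const q).const_add 1
    · simpa using ((((hasDerivAt_id l).mul_const K.kappa).const_add 1).mul_const q).const_add
        K.kappa
  refine (hasDerivAt_one_div_mul_sqrt h1 (cubic_pos h)
    (mul_pos two_pos K.abs_a_pos).ne').congr_deriv ?_
  have := h.1.ne'
  have := h.2.1.ne'
  have := h.2.2.ne'
  simp only [slowness]
  congr 1
  unfold cubic
  field_simp

theorem hasDerivAt_polarDelta_fst (q l : ℝ) :
    HasDerivAt (fun q => K.polarDelta q l) (K.kappa * l * (1 - l)) q := by
  unfold polarDelta sinFactor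
  refine (((((hasDerivAt_id q).const_mul (1 - l)).const_sub 1).const_mul l).const_mul
    K.kappa).const_sub K.Xi |>.congr_deriv ?_
  ring

theorem hasDerivAt_polarDelta_snd (q l : ℝ) :
    HasDerivAt (fun l => K.polarDelta q l) (-(K.kappa * (1 - q + 2 * l * q))) l := by
  unfold polarDelta sinFactor
  refine ((((hasDerivAt_id l).mul ((((hasDerivAt_id l).const_sub 1).mul_const q).const_sub
    1))).const_mul K.kappa).const_sub K.Xi |>.congr_deriv ?_
  simp only [id]
  ring

theorem hasDerivAt_polarWeight_fst {q l : ℝ} (h : (q, l) ∈ K.polarDomain)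
    (hl : l ∈ Icc (0 : ℝ) 1) :
    HasDerivAt (fun q => K.polarWeight (q, l)) (K.polarWeight (q, l) *
      ((1 + l * K.kappa) / K.polarFactor q l
        - (-(1 - l) / sinFactor q l + l / cosFactor q l
          + (1 + l * K.kappa) / K.polarFactor q l) / 2
        - K.kappa * l * (1 - l) / K.polarDelta q l)) q := by
  have h1 : HasDerivAt (fun q => K.polarFactor q l) (1 + l * K.kappa) q := by
    unfold polarFactor
    simpa using ((hasDerivAt_id q).const_mul (1 + l * K.kappa)).const_add K.kappa
  have hD := polarDelta_pos h hl
  refine (((h1.const_mul (K.a ^ 2)).mul (hasDerivAt_slowness_fst h)).div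
    (hasDerivAt_polarDelta_fst q l) hD.ne').congr_deriv ?_
  have := h.1.ne'
  have := h.2.1.ne'
  have := h.2.2.ne'
  simp only [polarWeight, Pi.mul_apply]
  field_simp
  ring

theorem hasDerivAt_polarWeight_snd {q l : ℝ} (h : (q, l) ∈ K.polarDomain)
    (hl : l ∈ Icc (0 : ℝ) 1) :
    HasDerivAt (fun l => K.polarWeight (q, l)) (K.polarWeight (q, l) *
      (K.kappa * q / K.polarFactor q l
        - (q / sinFactor q l + q / cosFactor q l + K.kappa * q / K.polarFactor q l) / 2
        + K.kappa * (1 - q + 2 * l * q) / K.polarDelta q l)) l := by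
  have h1 : HasDerivAt (fun l => K.polarFactor q l) (K.kappa * q) l := by
    unfold polarFactor
    simpa using ((((hasDerivAt_id l).mul_const K.kappa).const_add 1).mul_const q).const_add
      K.kappa
  have hD := polarDelta_pos h hl
  refine (((h1.const_mul (K.a ^ 2)).mul (hasDerivAt_slowness_snd h)).div
    (hasDerivAt_polarDelta_snd q l) hD.ne').congr_deriv ?_
  have := h.1.ne'
  have := h.2.1.ne'
  have := h.2.2.ne'
  simp only [polarWeight, Pi.mul_apply]
  field_simp
  ring

/-- The derivative with respect to `l` of the integrand of `polarAction`. -/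
theorem hasDerivAt_polarAction_integrand {q l : ℝ} (h : (q, l) ∈ K.polarDomain)
    (hl : l ∈ Icc (0 : ℝ) 1) {m' : ℝ}
    (hm : HasDerivAt (fun q => (1 - (1 - 2 * l) * q) * K.polarWeight (q, l)) m' q) :
    HasDerivAt (fun l => l * (1 - l) * K.polarWeight (q, l))
      (K.a ^ 2 / 2 * K.slowness (q, l) - m') l := by
  have h1 : HasDerivAt (fun l : ℝ => l * (1 - l)) (1 - 2 * l) l := by
    refine ((hasDerivAt_id l).mul ((hasDerivAt_id l).const_sub 1)).congr_deriv ?_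
    simp only [id]; ring
  have h2 : HasDerivAt (fun q : ℝ => 1 - (1 - 2 * l) * q) (-(1 - 2 * l)) q := by
    simpa using ((hasDerivAt_id q).const_mul (1 - 2 * l)).const_sub 1
  -- Change of variables: `s = l (1 - (1 - l) q)` has `∂_q s = -l (1 - l)` and `∂_l s = 1 - (1 - 2l)
  -- q`. The `l`-derivative of `-w ∂_q s` at fixed `q` is therefore `-∂_q (w ∂_l s)` plus the
  -- contribution of `∂_l w` at fixed `s`. The latter is `a² / 2` times the slowness, because `∂_l
  -- P̂ = a² Δ_θ / (2 P̂)` at fixed `θ`.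
  rw [hm.unique (h2.mul (hasDerivAt_polarWeight_fst h hl))]
  refine (h1.mul (hasDerivAt_polarWeight_snd h hl)).congr_deriv ?_
  have hD := (polarDelta_pos h hl).ne'
  have hs := h.1.ne'
  have hc := h.2.1.ne'
  have hp := h.2.2.ne'
  dsimp only at hs hc hp
  have hw : K.slowness (q, l) =
      K.polarWeight (q, l) * K.polarDelta q l / (K.a ^ 2 * K.polarFactor q l) := by
    have := K.a_ne_zero
    simp only [polarWeight]
    field_simp
  rw [hw]
  have ha := K.a_ne_zero
  generalize K.polarWeight (q, l) = w
  have hDe : K.polarDelta q l = 1 + K.kappa - K.kappa * (l * sinFactor q l) := rfl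
  have hse : sinFactor q l = 1 - (1 - l) * q := rfl
  have hce : cosFactor q l = 1 + l * q := rfl
  have hpe : K.polarFactor q l = K.kappa + (1 + l * K.kappa) * q := rfl
  generalize K.polarDelta q l = D at *
  generalize sinFactor q l = s at *
  generalize cosFactor q l = c at *
  generalize K.polarFactor q l = p at *
  field_simp
  rw [hDe, hse, hce, hpe]
  ring

end KNdS

/-! ### Two facts on real functions: comparison through derivatives, and continuity of the
derivative -/

theorem sub_le_sub_of_hasDerivAt_le {f g f' g' : ℝ → ℝ} {a b : ℝ} (hb : a ≤ b)
    (hf : ∀ t ∈ Icc a b, HasDerivAt f (f' t) t) (hg : ∀ t ∈ Icc a b, HasDerivAt g (g' t) t)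
    (h : ∀ t ∈ Icc a b, f' t ≤ g' t) : f b - f a ≤ g b - g a := by
  have hd : ∀ t ∈ Icc a b, HasDerivAt (fun t => g t - f t) (g' t - f' t) t :=
    fun t ht => (hg t ht).sub (hf t ht)
  have hm : MonotoneOn (fun t => g t - f t) (Icc a b) := by
    refine monotoneOn_of_deriv_nonneg (convex_Icc a b)
      (fun t ht => (hd t ht).continuousAt.continuousWithinAt)
      (fun t ht => (hd t (interior_subset ht)).differentiableAt.differentiableWithinAt)
      fun t ht => ?_
    rw [(hd t (interior_subset ht)).deriv]
    exact sub_nonneg.2 (h t (interior_subset ht))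
  have := hm (left_mem_Icc.2 hb) (right_mem_Icc.2 hb) hb
  simp only at this
  linarith

theorem ContDiffAt.continuousAt_deriv_of_infty {f : ℝ → ℝ} {x : ℝ} (hf : ContDiffAt ℝ ∞ f x) :
    ContinuousAt (deriv f) x := by
  have h := ((hf.fderiv_right (m := 0) (by simp)).clm_apply
    (contDiffAt_const (c := (1 : ℝ)))).continuousAt
  simpa only [fderiv_apply_one_eq_deriv] using h

namespace KNdS

variable {K : KNdS}

/-! ### The derivative of the polar action with respect to `l` -/

/-- The `l`-derivative of the integrand is the derivative in the integration variable of an explicit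
function. Integration leaves its boundary values, with the polar time coming from the slowness. -/
theorem hasDerivAt_polarAction_snd {q l : ℝ} (h : (q, l) ∈ K.polarDomain)
    (hl : l ∈ Icc (0 : ℝ) 1) :
    HasDerivAt (fun l => K.polarAction (q, l)) (K.polarWeight (0, l)
      + K.a ^ 2 / 2 * K.polarTime (q, l) - (1 - (1 - 2 * l) * q) * K.polarWeight (q, l)) l := by
  set φ : ℝ → ℝ := fun t => K.a ^ 2 / 2 * K.polarTime (t, l)
    - (1 - (1 - 2 * l) * t) * K.polarWeight (t, l) with hφ
  have hdom : ∀ t ∈ uIcc 0 q, (t, l) ∈ K.polarDomain := fun t ht =>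
    mem_polarDomain_of_mem_uIcc h ht
  have hm : ∀ t ∈ uIcc 0 q,
      ContDiffAt ℝ ∞ (fun t => (1 - (1 - 2 * l) * t) * K.polarWeight (t, l)) t := fun t ht =>
    ContDiffAt.mul (by fun_prop) ((polarWeight_contDiffAt (hdom t ht) hl).comp t
      (f := fun t : ℝ => (t, l)) (by fun_prop))
  have hφc : ∀ t ∈ uIcc 0 q, ContDiffAt ℝ ∞ φ t := fun t ht =>
    (contDiffAt_const.mul ((polarTime_contDiffAt (hdom t ht)).comp t
      (f := fun t : ℝ => (t, l)) (by fun_prop))).sub (hm t ht)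
  have hφd : ∀ t ∈ uIcc 0 q, deriv φ t = K.a ^ 2 / 2 * K.slowness (t, l)
      - deriv (fun t => (1 - (1 - 2 * l) * t) * K.polarWeight (t, l)) t := fun t ht =>
    (((hasDerivAt_polarTime (hdom t ht)).const_mul (K.a ^ 2 / 2)).sub
      ((hm t ht).differentiableAt (by simp)).hasDerivAt).deriv
  have h1 := hasDerivAt_integral_param (p' := deriv φ) (l := l)
    (fun t ht => polarAction_integrand (hdom t ht) hl) fun t ht => by
      rw [hφd t ht]
      exact hasDerivAt_polarAction_integrand (hdom t ht) hl
        ((hm t ht).differentiableAt (by simp)).hasDerivAt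
  refine h1.congr_deriv ?_
  rw [intervalIntegral.integral_deriv_eq_sub
    (fun t ht => (hφc t ht).differentiableAt (by simp))
    (ContinuousOn.intervalIntegrable fun t ht =>
      (hφc t ht).continuousAt_deriv_of_infty.continuousWithinAt)]
  simp only [hφ, polarTime_zero]
  ring

/-! ### Comparison of polar times -/

theorem scaled_mem_polarDomain {τ l : ℝ} (hτ : τ ∈ Ico (0 : ℝ) 1) (hl : l ∈ Ico (0 : ℝ) 1) :
    (τ / (1 - l), l) ∈ K.polarDomain := by
  have h1 : 0 < 1 - l := sub_pos.2 hl.2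
  refine mem_polarDomain hl.1 (div_nonneg hτ.1 h1.le) ?_
  rw [sinFactor, mul_div_cancel₀ _ h1.ne']
  linarith [hτ.2]

/-- `τ = (1 - l) q` equals `1 - sin² θ / sin² θ⋆`. In this variable only two factors of the radicand
depend on `l`, and both decrease with it. -/
theorem hasDerivAt_scaled_polarTime {τ l : ℝ} (hτ : τ ∈ Ico (0 : ℝ) 1) (hl : l ∈ Ico (0 : ℝ) 1) :
    HasDerivAt (fun τ => K.polarTime (τ / (1 - l), l))
      (1 / (2 * |K.a| * √((1 - τ) * (1 - l * (1 - τ)) * (K.kappa + τ - l * (K.kappa * (1 - τ))))))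
      τ := by
  have h1 : 0 < 1 - l := sub_pos.2 hl.2
  have h2 := (hasDerivAt_polarTime (scaled_mem_polarDomain (K := K) hτ hl)).comp τ
    ((hasDerivAt_id τ).div_const (1 - l))
  refine h2.congr_deriv ?_
  have h3 : (1 - τ) * (1 - l * (1 - τ)) * (K.kappa + τ - l * (K.kappa * (1 - τ))) =
      K.cubic (τ / (1 - l)) l * (1 - l) ^ 2 := by
    unfold cubic sinFactor cosFactor polarFactor
    field_simp
    ring
  rw [h3, sqrt_mul' _ (sq_nonneg _), sqrt_sq h1.le, slowness]
  field_simp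

/-- At a fixed ratio `sin² θ / sin² θ⋆` the integrand grows with `l`. This reduces existence for `l
< 1` to the case `l = 0`, and it drives `sinSq_strictMonoOn`. -/
theorem polarTime_scaled_mono {τ l l' : ℝ} (hτ : τ ∈ Ico (0 : ℝ) 1) (hl : 0 ≤ l) (hll : l ≤ l')
    (hl' : l' < 1) : K.polarTime (τ / (1 - l), l) ≤ K.polarTime (τ / (1 - l'), l') := by
  have hmem : ∀ t ∈ Icc 0 τ, t ∈ Ico (0 : ℝ) 1 := fun t ht => ⟨ht.1, ht.2.trans_lt hτ.2⟩
  have h := sub_le_sub_of_hasDerivAt_le hτ.1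
    (fun t ht => hasDerivAt_scaled_polarTime (K := K) (hmem t ht) ⟨hl, hll.trans_lt hl'⟩)
    (fun t ht => hasDerivAt_scaled_polarTime (K := K) (hmem t ht) ⟨hl.trans hll, hl'⟩)
    fun t ht => by
      have h0 := ht.1
      have h1 : 0 < 1 - t := sub_pos.2 (hmem t ht).2
      have hk := K.kappa_pos
      have ha := K.abs_a_pos
      have hl0' : 0 ≤ l' := hl.trans hll
      have h2 : 0 < 1 - l' * (1 - t) := by nlinarith
      have h3 : 0 < K.kappa + t - l' * (K.kappa * (1 - t)) := by
        have : 0 < (1 - l') * K.kappa := mul_pos (sub_pos.2 hl') hk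
        have : 0 ≤ l' * K.kappa * t := by positivity
        linarith
      refine one_div_le_one_div_of_le (by positivity) (mul_le_mul_of_nonneg_left
        (sqrt_le_sqrt ?_) (by positivity))
      have h4 : l * (1 - t) ≤ l' * (1 - t) := mul_le_mul_of_nonneg_right hll h1.le
      have h5 : l * (K.kappa * (1 - t)) ≤ l' * (K.kappa * (1 - t)) :=
        mul_le_mul_of_nonneg_right hll (by positivity)
      have h6 : 0 ≤ 1 - l * (1 - t) := by linarith
      gcongr
  simpa [polarTime_zero] using h

/-- At `l = 0` the cubic is `(1 - t)(κ + t)`, and both sides have the same derivative. The left side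
tends to `π/2 - arctan √κ` as `t → 1`. -/
theorem arctan_sub_le_polarTime_zero {t : ℝ} (ht : t ∈ Ico (0 : ℝ) 1) :
    arctan √((K.kappa + t) / (1 - t)) - arctan √K.kappa ≤ |K.a| * K.polarTime (t, 0) := by
  have ha := K.abs_a_pos
  have hk := K.kappa_pos
  have hmem : ∀ s ∈ Icc 0 t, s ∈ Ico (0 : ℝ) 1 := fun s hs => ⟨hs.1, hs.2.trans_lt ht.2⟩
  have h := sub_le_sub_of_hasDerivAt_le ht.1
    (f := fun t => arctan √((K.kappa + t) / (1 - t)))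
    (f' := fun t => 1 / (2 * √((1 - t) * (K.kappa + t))))
    (g := fun t => |K.a| * K.polarTime (t, 0))
    (g' := fun t => 1 / (2 * √((1 - t) * (K.kappa + t))))
    (fun s hs => ?_) (fun s hs => ?_) (fun s hs => le_rfl)
  · simpa [polarTime_zero] using h
  · have h0 := hs.1
    have h1 : 0 < 1 - s := sub_pos.2 (hmem s hs).2
    have h2 : 0 < (K.kappa + s) / (1 - s) := by positivity
    have h3 : HasDerivAt (fun t => (K.kappa + t) / (1 - t)) ((1 + K.kappa) / (1 - s) ^ 2) s := by
      refine (((hasDerivAt_id s).const_add K.kappa).div ((hasDerivAt_id s).const_sub 1)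
        h1.ne').congr_deriv ?_
      simp only [id]
      ring
    refine ((h3.sqrt h2.ne').arctan).congr_deriv ?_
    have h4 : (1 - s) * (K.kappa + s) = (K.kappa + s) / (1 - s) * (1 - s) ^ 2 := by field_simp
    rw [h4, sqrt_mul' _ (sq_nonneg _), sqrt_sq h1.le, sq_sqrt h2.le]
    have h5 := sqrt_pos.2 h2
    have h6 : 1 + (K.kappa + s) / (1 - s) = (1 + K.kappa) / (1 - s) := by field_simp; ring
    have h7 : 0 < 1 + K.kappa := by positivity
    rw [h6]
    field_simp
  · have h2 := (hasDerivAt_scaled_polarTime (K := K) (hmem s hs)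
      (left_mem_Ico.2 zero_lt_one)).const_mul |K.a|
    simp only [sub_zero, div_one, zero_mul, mul_one] at h2
    refine h2.congr_deriv ?_
    field_simp

/-- At `l = 1` the parameter runs over the whole half-line and the cubic is at most `Ξ (1 + t)²`, so
the polar time is unbounded. -/
theorem log_le_polarTime_one {q : ℝ} (hq : 0 ≤ q) :
    log (1 + q) / (2 * |K.a| * √K.Xi) ≤ K.polarTime (q, 1) := by
  have ha := K.abs_a_pos
  have hk := K.kappa_pos
  have hX := sqrt_pos.2 K.xi_pos
  have h := sub_le_sub_of_hasDerivAt_le hq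
    (f := fun t => log (1 + t) / (2 * |K.a| * √K.Xi))
    (f' := fun t => 1 / (1 + t) / (2 * |K.a| * √K.Xi))
    (g := fun t => K.polarTime (t, 1)) (g' := fun t => K.slowness (t, 1))
    (fun t ht => ?_)
    (fun t ht => hasDerivAt_polarTime (mem_polarDomain zero_le_one ht.1 (by simp [sinFactor])))
    (fun t ht => ?_)
  · simpa [polarTime_zero] using h
  · have := ht.1
    exact (((hasDerivAt_id t).const_add 1).log (by simp only [id]; positivity)).div_const _
  · have h0 := ht.1
    rw [slowness, div_div]
    refine one_div_le_one_div_of_le ?_ ?_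
    · have := sqrt_pos.2 (cubic_pos (K := K) (mem_polarDomain (l := 1) zero_le_one ht.1
        (by simp [sinFactor])))
      positivity
    · have h1 : √(K.cubic t 1) ≤ (1 + t) * √K.Xi := by
        rw [← sqrt_sq (show 0 ≤ 1 + t by positivity), ← sqrt_mul (sq_nonneg _)]
        refine sqrt_le_sqrt ?_
        simp only [cubic, sinFactor, cosFactor, polarFactor, xi_eq]
        nlinarith
      calc 2 * |K.a| * √(K.cubic t 1) ≤ 2 * |K.a| * ((1 + t) * √K.Xi) := by gcongr
        _ = (1 + t) * (2 * |K.a| * √K.Xi) := by ring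

theorem exists_le_polarTime {l T : ℝ} (hl : l ∈ Icc (0 : ℝ) 1)
    (hT : |K.a| * T < π / 2 - arctan √K.kappa) (hT0 : 0 ≤ T) :
    ∃ q, 0 ≤ q ∧ (q, l) ∈ K.polarDomain ∧ T ≤ K.polarTime (q, l) := by
  have ha := K.abs_a_pos
  have hk := K.kappa_pos
  rcases hl.2.lt_or_eq with hl1 | rfl
  -- With `τ = m² / (1 + m²)` one has `1 - τ = 1 / (1 + m²)`, hence `(κ + τ) / (1 - τ) ≥ m²`, while
  -- `arctan m - arctan √κ` is exactly `|a| T`.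
  · set m := tan (|K.a| * T + arctan √K.kappa) with hm
    have hτ : m ^ 2 / (1 + m ^ 2) ∈ Ico (0 : ℝ) 1 :=
      ⟨by positivity, by rw [div_lt_one (by positivity)]; linarith⟩
    set τ := m ^ 2 / (1 + m ^ 2) with hτ_def
    refine ⟨τ / (1 - l), div_nonneg hτ.1 (sub_pos.2 hl1).le,
      scaled_mem_polarDomain hτ ⟨hl.1, hl1⟩, ?_⟩
    have h1 := polarTime_scaled_mono (K := K) hτ le_rfl hl.1 hl1
    rw [sub_zero, div_one] at h1
    refine le_trans ?_ h1
    refine le_of_mul_le_mul_left ?_ ha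
    refine le_trans ?_ (arctan_sub_le_polarTime_zero hτ)
    have hpos : 0 < arctan √K.kappa := arctan_pos.2 (sqrt_pos.2 hk)
    have h2 : |K.a| * T + arctan √K.kappa = arctan m := by
      rw [hm, arctan_tan _ (by linarith)]
      have : 0 ≤ |K.a| * T := by positivity
      linarith [pi_pos]
    have h3 : m ≤ √((K.kappa + τ) / (1 - τ)) := by
      refine le_sqrt_of_sq_le ?_
      have h4 : 1 - τ = 1 / (1 + m ^ 2) := by rw [hτ_def]; field_simp; ring
      have h5 : τ * (1 + m ^ 2) = m ^ 2 := by rw [hτ_def]; field_simp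
      rw [h4, div_div_eq_mul_div, div_one, add_mul, h5]
      nlinarith [sq_nonneg m]
    linarith [arctan_mono h3]
  · have hX := sqrt_pos.2 K.xi_pos
    have h1 : 0 ≤ exp (T * (2 * |K.a| * √K.Xi)) - 1 :=
      sub_nonneg.2 (one_le_exp (by positivity))
    refine ⟨_, h1, mem_polarDomain zero_le_one h1 (by simp [sinFactor]), ?_⟩
    refine le_trans ?_ (log_le_polarTime_one h1)
    rw [add_sub_cancel, log_exp, mul_div_cancel_right₀ _ (by positivity)]

theorem exists_polarTime_eq {l T : ℝ} (hl : l ∈ Icc (0 : ℝ) 1)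
    (hT : |K.a| * T < π / 2 - arctan √K.kappa) (hT0 : 0 ≤ T) :
    ∃ q, (q, l) ∈ K.polarDomain ∧ K.polarTime (q, l) = T := by
  obtain ⟨q, hq, hdom, hle⟩ := exists_le_polarTime hl hT hT0
  have hmem : ∀ t ∈ Icc 0 q, (t, l) ∈ K.polarDomain := fun t ht =>
    mem_polarDomain_of_mem_uIcc hdom (by rwa [uIcc_of_le hq])
  have hc : ContinuousOn (fun q => K.polarTime (q, l)) (Icc 0 q) := fun t ht =>
    (hasDerivAt_polarTime (hmem t ht)).continuousAt.continuousWithinAt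
  obtain ⟨t, ht, hte⟩ := intermediate_value_Icc hq hc ⟨by rwa [polarTime_zero], hle⟩
  exact ⟨t, hmem t ht, hte⟩

/-! ### The polar parameter as a function of `r` and `l` -/

variable (K) in
/-- The parameter of the polar motion at which the polar time equals the radial time. -/
def polarParam (p : ℝ × ℝ) : ℝ :=
  Classical.epsilon fun q => (q, p.2) ∈ K.polarDomain ∧ K.polarTime (q, p.2) = K.radialTime p

/-- Strict monotonicity of the polar time leaves only one root, so any solution found by other means
is the chosen one. -/
theorem polarParam_eq {p : ℝ × ℝ} {q : ℝ} (hq : (q, p.2) ∈ K.polarDomain)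
    (hqT : K.polarTime (q, p.2) = K.radialTime p) : K.polarParam p = q := by
  have h := Classical.epsilon_spec
    (p := fun q => (q, p.2) ∈ K.polarDomain ∧ K.polarTime (q, p.2) = K.radialTime p) ⟨q, hq, hqT⟩
  exact (polarTime_strictMonoOn p.2).injOn h.1 hq (h.2.trans hqT.symm)

variable {r l : ℝ}

theorem polarParam_spec (hr : r ∈ Ioo K.rm K.rp) (hl : l ∈ Icc (0 : ℝ) 1) :
    (K.polarParam (r, l), l) ∈ K.polarDomain ∧
      K.polarTime (K.polarParam (r, l), l) = K.radialTime (r, l) := by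
  obtain ⟨q, hq, hqT⟩ := exists_polarTime_eq hl (K.abs_mul_radialTime_lt hr hl.1)
    (K.radialTime_pos hr hl.1).le
  rw [polarParam_eq (p := (r, l)) hq hqT]
  exact ⟨hq, hqT⟩

theorem polarParam_pos (hr : r ∈ Ioo K.rm K.rp) (hl : l ∈ Icc (0 : ℝ) 1) :
    0 < K.polarParam (r, l) := by
  obtain ⟨h1, h2⟩ := polarParam_spec hr hl
  refine (polarTime_strictMonoOn l).lt_iff_lt (zero_mem_polarDomain l) h1 |>.1 ?_
  simp only [polarTime_zero, h2]
  exact K.radialTime_pos hr hl.1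

/-- The branch from the implicit function theorem stays in the open set `polarDomain`, so uniqueness
identifies it with `polarParam` in a full neighbourhood, also when `l` is `0` or `1`. -/
theorem polarParam_contDiffAt (hr : r ∈ Ioo K.rm K.rp) (hl : l ∈ Icc (0 : ℝ) 1) :
    ContDiffAt ℝ ∞ K.polarParam (r, l) := by
  obtain ⟨hq, hqT⟩ := polarParam_spec hr hl
  obtain ⟨σ, hσ, hσq, hσe⟩ := exists_contDiffAt_partial_inverse (polarTime_contDiffAt hq)
    (hasDerivAt_polarTime hq) (slowness_pos hq).ne'
  rw [hqT] at hσ hσq hσe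
  have hT := K.radialTime_contDiffAt (K.mem_Icc_of_mem_Ioo hr) hl.1
  have hpair : ContDiffAt ℝ ∞ (fun z : ℝ × ℝ => (K.radialTime z, z.2)) (r, l) :=
    hT.prodMk contDiffAt_snd
  have hcomp : ContDiffAt ℝ ∞ (fun z : ℝ × ℝ => σ (K.radialTime z, z.2)) (r, l) :=
    ContDiffAt.comp (r, l) (g := σ) (f := fun z : ℝ × ℝ => (K.radialTime z, z.2)) hσ hpair
  refine hcomp.congr_of_eventuallyEq ?_
  have h1 := hpair.continuousAt.eventually hσe
  have h2 : ∀ᶠ z : ℝ × ℝ in 𝓝 (r, l), (σ (K.radialTime z, z.2), z.2) ∈ K.polarDomain := by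
    refine (hcomp.continuousAt.prodMk continuousAt_snd).eventually
      (isOpen_polarDomain.mem_nhds ?_)
    simpa only [hσq] using hq
  filter_upwards [h1, h2] with z hz1 hz2
  exact polarParam_eq hz2 hz1

theorem hasDerivAt_polarParam_fst (hr : r ∈ Ioo K.rm K.rp) (hl : l ∈ Icc (0 : ℝ) 1) :
    HasDerivAt (fun r => K.polarParam (r, l))
      (-(1 / (K.QHat r l * K.slowness (K.polarParam (r, l), l)))) r := by
  obtain ⟨hq, hqT⟩ := polarParam_spec hr hl
  have h1 : HasDerivAt (fun r => K.polarParam (r, l)) (deriv (fun r => K.polarParam (r, l)) r) r :=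
    (((polarParam_contDiffAt hr hl).comp r (f := fun r : ℝ => (r, l))
      (by fun_prop)).differentiableAt (by simp)).hasDerivAt
  have h2 := (hasDerivAt_polarTime hq).comp r h1
  have h3 := (K.hasDerivAt_radialTime (K.mem_Icc_of_mem_Ioo hr) hl.1).congr_of_eventuallyEq
    (f₁ := fun r => K.polarTime (K.polarParam (r, l), l)) (by
      filter_upwards [isOpen_Ioo.mem_nhds hr] with r' hr'
      exact (polarParam_spec hr' hl).2)
  have h4 := h2.unique h3
  have h5 := slowness_pos hq
  have h6 := K.qHat_pos (K.mem_Icc_of_mem_Ioo hr) hl.1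
  refine h1.congr_deriv ?_
  field_simp
  field_simp at h4
  linarith

/-! ### `sin² θ` as a function of `r` and `l` -/

variable (K) in
/-- `sin² θ` as a function of `r` and `l = sin² θ⋆`. -/
def sinSq (p : ℝ × ℝ) : ℝ := p.2 * sinFactor (K.polarParam p) p.2

theorem one_sub_sinSq (p : ℝ × ℝ) :
    1 - K.sinSq p = (1 - p.2) * cosFactor (K.polarParam p) p.2 := one_sub_mul_sinFactor _ _

theorem sinSq_zero (r : ℝ) : K.sinSq (r, 0) = 0 := by simp [sinSq]

theorem sinSq_one (r : ℝ) : K.sinSq (r, 1) = 1 := by simp [sinSq, sinFactor]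

theorem sinSq_contDiffAt (hr : r ∈ Ioo K.rm K.rp) (hl : l ∈ Icc (0 : ℝ) 1) :
    ContDiffAt ℝ ∞ K.sinSq (r, l) := by
  have := polarParam_contDiffAt hr hl
  unfold sinSq sinFactor
  fun_prop

theorem sinSq_le (hr : r ∈ Ioo K.rm K.rp) (hl : l ∈ Icc (0 : ℝ) 1) : K.sinSq (r, l) ≤ l := by
  have h1 := mul_nonneg (mul_nonneg hl.1 (sub_nonneg.2 hl.2)) (polarParam_pos hr hl).le
  simp only [sinSq, sinFactor]
  linarith

theorem sinSq_mem_Ioo (hr : r ∈ Ioo K.rm K.rp) (hl : l ∈ Ioo (0 : ℝ) 1) :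
    K.sinSq (r, l) ∈ Ioo (0 : ℝ) 1 := by
  obtain ⟨h, -⟩ := polarParam_spec hr (Ioo_subset_Icc_self hl)
  refine ⟨mul_pos hl.1 h.1, ?_⟩
  rw [← sub_pos, one_sub_sinSq]
  exact mul_pos (sub_pos.2 hl.2) h.2.1

/-- If `l < l'` but `sin² θ` did not increase, the ratio `sin² θ / l` would drop strictly. By
`polarTime_scaled_mono` the polar time would then be strictly larger at `l'`, whereas it equals the
radial time, which does not increase with `l`. -/
theorem sinSq_strictMonoOn (hr : r ∈ Ioo K.rm K.rp) :
    StrictMonoOn (fun l => K.sinSq (r, l)) (Icc 0 1) := by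
  intro l hl l' hl' hll
  rcases hl.1.eq_or_lt with rfl | hl0
  · rcases hl'.2.eq_or_lt with rfl | hl1
    · simp [sinSq_zero, sinSq_one]
    · simpa [sinSq_zero] using (sinSq_mem_Ioo hr ⟨hll, hl1⟩).1
  rcases hl'.2.eq_or_lt with rfl | hl1
  · simpa [sinSq_one] using (sinSq_mem_Ioo hr ⟨hl0, hll⟩).2
  by_contra hcon
  simp only [not_lt] at hcon
  have hl0' := hl0.trans hll
  obtain ⟨hd, hT⟩ := polarParam_spec hr hl
  obtain ⟨hd', hT'⟩ := polarParam_spec hr hl'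
  have hpos := polarParam_pos hr hl
  have hs' := (sinSq_mem_Ioo hr ⟨hl0', hl1⟩).1
  have ha : 0 < 1 - l := by linarith
  have ha' : 0 < 1 - l' := by linarith
  simp only [sinSq] at hcon hs'
  have h1 : sinFactor (K.polarParam (r, l')) l' < sinFactor (K.polarParam (r, l)) l := by
    have h2 : 0 < sinFactor (K.polarParam (r, l')) l' := hd'.1
    have h3 := mul_lt_mul_of_pos_right hll h2
    exact lt_of_mul_lt_mul_left (h3.trans_le hcon) hl0.le
  set τ := (1 - l) * K.polarParam (r, l) with hτ
  have hτmem : τ ∈ Ico (0 : ℝ) 1 := by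
    have := hd.1
    simp only [sinFactor] at this
    exact ⟨by positivity, by linarith⟩
  have h4 := polarTime_scaled_mono (K := K) hτmem hl.1 hll.le hl1
  have h5 : τ / (1 - l) = K.polarParam (r, l) := by rw [hτ]; field_simp
  rw [h5, hT] at h4
  have h6 : τ / (1 - l') < K.polarParam (r, l') := by
    rw [div_lt_iff₀ ha']
    simp only [sinFactor] at h1
    linarith
  have h7 := polarTime_strictMonoOn l' (scaled_mem_polarDomain hτmem ⟨hl'.1, hl1⟩) hd' h6
  simp only [hT'] at h7
  have h8 := K.radialTime_anti (K.mem_Icc_of_mem_Ioo hr) hl.1 hll.le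
  linarith

end KNdS

theorem hasDerivAt_comp_pair {f : ℝ × ℝ → ℝ} {u v : ℝ → ℝ} {f₁ f₂ u' v' t : ℝ}
    (hf : DifferentiableAt ℝ f (u t, v t)) (h₁ : HasDerivAt (fun x => f (x, v t)) f₁ (u t))
    (h₂ : HasDerivAt (fun y => f (u t, y)) f₂ (v t)) (hu : HasDerivAt u u' t)
    (hv : HasDerivAt v v' t) :
    HasDerivAt (fun t => f (u t, v t)) (f₁ * u' + f₂ * v') t := by
  have e₁ := h₁.unique (hf.hasFDerivAt.comp_hasDerivAt (f := fun x => (x, v t)) (u t)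
    ((hasDerivAt_id (u t)).prodMk (hasDerivAt_const (u t) (v t))))
  have e₂ := h₂.unique (hf.hasFDerivAt.comp_hasDerivAt (f := fun y => (u t, y)) (v t)
    ((hasDerivAt_const (v t) (u t)).prodMk (hasDerivAt_id (v t))))
  refine (hf.hasFDerivAt.comp_hasDerivAt (f := fun t => (u t, v t)) t
    (hu.prodMk hv)).congr_deriv ?_
  rw [e₁, e₂, mul_comm _ u', mul_comm _ v', ← smul_eq_mul, ← smul_eq_mul, ← map_smul, ← map_smul,
    ← map_add]
  simp

namespace KNdS

variable (K : KNdS)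

/-! ### `r⋆` as a function of `r` and `l` -/

/-- The radial part of `r⋆`. -/
def radialTortoise (p : ℝ × ℝ) : ℝ :=
  (∫ t in K.r0..p.1, (t ^ 2 + K.a ^ 2) / K.DeltaR t)
    - ∫ t in K.rp..p.1, K.a ^ 2 * p.2 / (t ^ 2 + K.a ^ 2 + K.QHat t p.2)

/-- The value of the polar part of `r⋆` at `θ = θ⋆`. -/
def axisAction (l : ℝ) : ℝ := ∫ t in (0 : ℝ)..l, K.polarWeight (0, t)

/-- `r⋆` as a function of `r` and `l = sin² θ⋆`. -/
def tortoise (p : ℝ × ℝ) : ℝ :=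
  K.radialTortoise p + K.axisAction p.2 - K.polarAction (K.polarParam p, p.2)

/-- `Υ` as a function of `r` and `s = sin² θ`. -/
def upsilonOf (r s : ℝ) : ℝ :=
  (r ^ 2 + K.a ^ 2) ^ 2 * (K.Xi - K.kappa * s) - K.a ^ 2 * s * K.DeltaR r

variable {K} {r l : ℝ}

theorem radialTortoise_integrand_one (hr : r ∈ Ioo K.rm K.rp) (l : ℝ) :
    ContDiffAt ℝ ∞ (fun p : ℝ × ℝ => (p.1 ^ 2 + K.a ^ 2) / K.DeltaR p.1) (r, l) := by
  have := K.deltaR_contDiff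
  exact ContDiffAt.div (by fun_prop) (by fun_prop) (K.deltaR_neg hr).ne

theorem add_qHat_pos (hr : r ∈ Icc K.rm K.rp) (hl : 0 ≤ l) :
    0 < r ^ 2 + K.a ^ 2 + K.QHat r l := add_pos (K.rSq_add_pos r) (K.qHat_pos hr hl)

theorem radialTortoise_integrand_two (hr : r ∈ Icc K.rm K.rp) (hl : 0 ≤ l) :
    ContDiffAt ℝ ∞ (fun p : ℝ × ℝ => K.a ^ 2 * p.2 / (p.1 ^ 2 + K.a ^ 2 + K.QHat p.1 p.2))
      (r, l) := by
  have := K.qHat_contDiffAt hr hl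
  exact ContDiffAt.div (by fun_prop) (by fun_prop) (add_qHat_pos hr hl).ne'

theorem radialTortoise_contDiffAt (hr : r ∈ Ioo K.rm K.rp) (hl : 0 ≤ l) :
    ContDiffAt ℝ ∞ K.radialTortoise (r, l) := by
  refine ContDiffAt.sub
    (contDiffAt_primitive (p := fun p : ℝ × ℝ => (p.1 ^ 2 + K.a ^ 2) / K.DeltaR p.1)
      fun t ht => radialTortoise_integrand_one (K.mem_Ioo_of_mem_uIcc_r0 hr ht) l)
    (contDiffAt_primitive
      (p := fun p : ℝ × ℝ => K.a ^ 2 * p.2 / (p.1 ^ 2 + K.a ^ 2 + K.QHat p.1 p.2))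
      fun t ht => radialTortoise_integrand_two
        (K.mem_Icc_of_mem_uIcc_rp (K.mem_Icc_of_mem_Ioo hr) ht) hl)

/-- Difference of squares: the zero of `Δ_r` at `r_+` cancels, so the integrand extends smoothly to
the horizon. -/
theorem sub_qHat_div_deltaR (hr : r ∈ Ioo K.rm K.rp) (hl : 0 ≤ l) :
    (r ^ 2 + K.a ^ 2 - K.QHat r l) / K.DeltaR r
      = K.a ^ 2 * l / (r ^ 2 + K.a ^ 2 + K.QHat r l) := by
  have hr' := K.mem_Icc_of_mem_Ioo hr
  have h1 := (K.deltaR_neg hr).ne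
  have h2 := (add_qHat_pos hr' hl).ne'
  have h3 := K.qHat_sq hr' hl
  rw [div_eq_div_iff h1 h2]
  linear_combination -h3

theorem hasDerivAt_radialTortoise_fst (hr : r ∈ Ioo K.rm K.rp) (hl : 0 ≤ l) :
    HasDerivAt (fun r => K.radialTortoise (r, l)) (K.QHat r l / K.DeltaR r) r := by
  refine (HasDerivAt.sub
    (hasDerivAt_primitive_fst (l := l)
      (p := fun p : ℝ × ℝ => (p.1 ^ 2 + K.a ^ 2) / K.DeltaR p.1)
      fun t ht => radialTortoise_integrand_one (K.mem_Ioo_of_mem_uIcc_r0 hr ht) l)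
    (hasDerivAt_primitive_fst
      (p := fun p : ℝ × ℝ => K.a ^ 2 * p.2 / (p.1 ^ 2 + K.a ^ 2 + K.QHat p.1 p.2))
      fun t ht => radialTortoise_integrand_two
        (K.mem_Icc_of_mem_uIcc_rp (K.mem_Icc_of_mem_Ioo hr) ht) hl)).congr_deriv ?_
  dsimp only
  rw [← sub_qHat_div_deltaR hr hl]
  ring

/-- The `l`-derivative of `(r² + a² - Q̂) / Δ_r` is `a² / (2 Q̂)`. This is the radial half of the
cancellation in `hasDerivAt_tortoise_snd`. -/
theorem hasDerivAt_radialTortoise_snd (hr : r ∈ Ioo K.rm K.rp) (hl : 0 ≤ l) :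
    HasDerivAt (fun l => K.radialTortoise (r, l)) (K.a ^ 2 / 2 * K.radialTime (r, l)) l := by
  have h := (hasDerivAt_integral_param (a := K.rp) (b := r) (l := l)
    (p := fun p : ℝ × ℝ => K.a ^ 2 * p.2 / (p.1 ^ 2 + K.a ^ 2 + K.QHat p.1 p.2))
    (p' := fun t => K.a ^ 2 / 2 * (1 / K.QHat t l))
    (fun t ht => radialTortoise_integrand_two
        (K.mem_Icc_of_mem_uIcc_rp (K.mem_Icc_of_mem_Ioo hr) ht) hl)
    fun t ht => by
      have ht' := K.mem_Icc_of_mem_uIcc_rp (K.mem_Icc_of_mem_Ioo hr) ht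
      have h1 := add_qHat_pos ht' hl
      have h2 := K.qHat_pos ht' hl
      have h3 := K.qHat_sq ht' hl
      refine (((hasDerivAt_id l).const_mul (K.a ^ 2)).div
        ((K.hasDerivAt_qHat_snd ht' hl).const_add _) h1.ne').congr_deriv ?_
      simp only [id]
      field_simp
      linear_combination K.a ^ 2 * h3).const_sub
    (∫ t in K.r0..r, (t ^ 2 + K.a ^ 2) / K.DeltaR t)
  refine h.congr_deriv ?_
  rw [intervalIntegral.integral_const_mul, radialTime]
  ring

theorem polarWeight_axis_contDiffAt (hl : l ∈ Icc (0 : ℝ) 1) (z : ℝ) :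
    ContDiffAt ℝ ∞ (fun p : ℝ × ℝ => K.polarWeight (0, p.1)) (l, z) :=
  ContDiffAt.comp (l, z) (f := fun p : ℝ × ℝ => ((0 : ℝ), p.1))
    (polarWeight_contDiffAt (zero_mem_polarDomain l) hl) (by fun_prop)

theorem mem_Icc_of_mem_uIcc_zero {l t : ℝ} (hl : l ∈ Icc (0 : ℝ) 1) (ht : t ∈ uIcc 0 l) :
    t ∈ Icc (0 : ℝ) 1 := by
  rw [uIcc_of_le hl.1] at ht
  exact ⟨ht.1, ht.2.trans hl.2⟩

theorem hasDerivAt_axisAction (hl : l ∈ Icc (0 : ℝ) 1) :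
    HasDerivAt K.axisAction (K.polarWeight (0, l)) l :=
  hasDerivAt_primitive_fst (p := fun p : ℝ × ℝ => K.polarWeight (0, p.1)) (l := 0)
    fun _ ht => polarWeight_axis_contDiffAt (mem_Icc_of_mem_uIcc_zero hl ht) 0

theorem axisAction_contDiffAt (hl : l ∈ Icc (0 : ℝ) 1) : ContDiffAt ℝ ∞ K.axisAction l :=
  ContDiffAt.comp l (f := fun l : ℝ => (l, (0 : ℝ)))
    (g := fun z : ℝ × ℝ => ∫ t in (0 : ℝ)..z.1, K.polarWeight (0, t))
    (contDiffAt_primitive (p := fun p : ℝ × ℝ => K.polarWeight (0, p.1))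
      fun _ ht => polarWeight_axis_contDiffAt (mem_Icc_of_mem_uIcc_zero hl ht) 0) (by fun_prop)

theorem tortoise_contDiffAt (hr : r ∈ Ioo K.rm K.rp) (hl : l ∈ Icc (0 : ℝ) 1) :
    ContDiffAt ℝ ∞ K.tortoise (r, l) := by
  refine ((radialTortoise_contDiffAt hr hl.1).add ?_).sub ?_
  · exact (axisAction_contDiffAt (K := K) hl).comp (r, l) contDiffAt_snd
  · exact ContDiffAt.comp (r, l) (f := fun p : ℝ × ℝ => (K.polarParam p, p.2))
      (polarAction_contDiffAt (polarParam_spec hr hl).1 hl)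
      ((polarParam_contDiffAt hr hl).prodMk contDiffAt_snd)

theorem hasDerivAt_sinSq_fst (hr : r ∈ Ioo K.rm K.rp) (hl : l ∈ Icc (0 : ℝ) 1) :
    HasDerivAt (fun r => K.sinSq (r, l))
      (l * (1 - l) / (K.QHat r l * K.slowness (K.polarParam (r, l), l))) r := by
  refine ((((hasDerivAt_polarParam_fst hr hl).const_mul (1 - l)).const_sub 1).const_mul
    l).congr_deriv ?_
  ring

theorem hasDerivAt_tortoise_fst (hr : r ∈ Ioo K.rm K.rp) (hl : l ∈ Icc (0 : ℝ) 1) :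
    HasDerivAt (fun r => K.tortoise (r, l)) (K.QHat r l / K.DeltaR r
      + K.polarWeight (K.polarParam (r, l), l)
        * (l * (1 - l) / (K.QHat r l * K.slowness (K.polarParam (r, l), l)))) r := by
  have h1 := (hasDerivAt_polarAction (polarParam_spec hr hl).1 hl).comp r
    (hasDerivAt_polarParam_fst hr hl)
  refine (((hasDerivAt_radialTortoise_fst hr hl.1).add_const (K.axisAction l)).sub
    h1).congr_deriv ?_
  ring

/-- The envelope property. The terms `a² / 2 * radialTime` and `a² / 2 * polarTime` cancel by the
equation for `θ⋆`, the axis terms cancel as well, and only the dependence through `sin² θ` survives.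
-/
theorem hasDerivAt_tortoise_snd (hr : r ∈ Ioo K.rm K.rp) (hl : l ∈ Icc (0 : ℝ) 1) {s' : ℝ}
    (hs : HasDerivAt (fun l => K.sinSq (r, l)) s' l) :
    HasDerivAt (fun l => K.tortoise (r, l)) (K.polarWeight (K.polarParam (r, l), l) * s') l := by
  obtain ⟨hq, hqT⟩ := polarParam_spec hr hl
  have h1 : HasDerivAt (fun l => K.polarParam (r, l)) (deriv (fun l => K.polarParam (r, l)) l) l :=
    (((polarParam_contDiffAt hr hl).comp l (f := fun l : ℝ => (r, l))
      (by fun_prop)).differentiableAt (by simp)).hasDerivAt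
  have h2 := hasDerivAt_comp_pair (u := fun l => K.polarParam (r, l)) (v := id)
    ((polarAction_contDiffAt hq hl).differentiableAt (by simp)) (hasDerivAt_polarAction hq hl)
    (hasDerivAt_polarAction_snd hq hl) h1 (hasDerivAt_id l)
  have h3 := (hasDerivAt_id l).mul ((((hasDerivAt_id l).const_sub 1).mul h1).const_sub 1)
  have h4 := hs.unique h3
  refine (((hasDerivAt_radialTortoise_snd hr hl.1).add (hasDerivAt_axisAction hl)).sub
    h2).congr_deriv ?_
  rw [h4]
  simp only [id, Pi.mul_apply, hqT]
  ring

theorem le_upsilonOf {s : ℝ} (hr : r ∈ Icc K.rm K.rp) (hs : 0 ≤ s) :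
    (r ^ 2 + K.a ^ 2) ^ 2 * (K.Xi - K.kappa * s) ≤ K.upsilonOf r s := by
  have h := mul_nonneg (mul_nonneg K.a_sq_pos.le hs) (neg_nonneg.2 (K.deltaR_nonpos hr))
  unfold upsilonOf
  linarith

theorem sinSq_nonneg (hr : r ∈ Ioo K.rm K.rp) (hl : l ∈ Icc (0 : ℝ) 1) : 0 ≤ K.sinSq (r, l) :=
  mul_nonneg hl.1 (polarParam_spec hr hl).1.1.le

/-- `Q̂² Δ_θ + P̂² Δ_r = Υ`: the separation constant `l` drops out. -/
theorem tortoise_deriv_eq (hr : r ∈ Ioo K.rm K.rp) (hl : l ∈ Icc (0 : ℝ) 1) :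
    K.QHat r l / K.DeltaR r + K.polarWeight (K.polarParam (r, l), l)
        * (l * (1 - l) / (K.QHat r l * K.slowness (K.polarParam (r, l), l)))
      = K.upsilonOf r (K.sinSq (r, l)) /
        (K.DeltaR r * (K.Xi - K.kappa * K.sinSq (r, l)) * K.QHat r l) := by
  obtain ⟨hq, -⟩ := polarParam_spec hr hl
  have h1 := slowness_pos hq
  have h2 := K.qHat_pos (K.mem_Icc_of_mem_Ioo hr) hl.1
  have h3 := (K.deltaR_neg hr).ne
  have h4 := polarDelta_pos hq hl
  have h5 : K.Xi - K.kappa * K.sinSq (r, l) = K.polarDelta (K.polarParam (r, l)) l := rfl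
  have h6 := K.pHatSq_eq (K.polarParam (r, l)) l
  have h7 := K.qHat_sq (K.mem_Icc_of_mem_Ioo hr) hl.1
  have h8 : l * sinFactor (K.polarParam (r, l)) l = K.sinSq (r, l) := rfl
  rw [h8] at h6
  rw [upsilonOf, h5, polarWeight]
  dsimp only
  field_simp
  linear_combination K.polarDelta (K.polarParam (r, l)) l * h7 - K.a ^ 2 * K.DeltaR r * h6

theorem delta_sinSq_pos (hr : r ∈ Ioo K.rm K.rp) (hl : l ∈ Icc (0 : ℝ) 1) :
    0 < K.Xi - K.kappa * K.sinSq (r, l) := polarDelta_pos (polarParam_spec hr hl).1 hl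

theorem upsilonOf_pos (hr : r ∈ Ioo K.rm K.rp) (hl : l ∈ Icc (0 : ℝ) 1) :
    0 < K.upsilonOf r (K.sinSq (r, l)) :=
  (mul_pos (pow_pos (K.rSq_add_pos r) 2) (delta_sinSq_pos hr hl)).trans_le
    (le_upsilonOf (K.mem_Icc_of_mem_Ioo hr) (sinSq_nonneg hr hl))

theorem hasDerivAt_tortoise_fst' (hr : r ∈ Ioo K.rm K.rp) (hl : l ∈ Icc (0 : ℝ) 1) :
    HasDerivAt (fun r => K.tortoise (r, l)) (K.upsilonOf r (K.sinSq (r, l)) /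
        (K.DeltaR r * (K.Xi - K.kappa * K.sinSq (r, l)) * K.QHat r l)) r := by
  rw [← tortoise_deriv_eq hr hl]
  exact hasDerivAt_tortoise_fst hr hl

theorem tortoise_deriv_neg (hr : r ∈ Ioo K.rm K.rp) (hl : l ∈ Icc (0 : ℝ) 1) :
    K.upsilonOf r (K.sinSq (r, l)) /
        (K.DeltaR r * (K.Xi - K.kappa * K.sinSq (r, l)) * K.QHat r l) < 0 :=
  div_neg_of_pos_of_neg (upsilonOf_pos hr hl) (mul_neg_of_neg_of_pos
    (mul_neg_of_neg_of_pos (K.deltaR_neg hr) (delta_sinSq_pos hr hl))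
    (K.qHat_pos (K.mem_Icc_of_mem_Ioo hr) hl.1))

theorem tortoise_strictAntiOn (hl : l ∈ Icc (0 : ℝ) 1) :
    StrictAntiOn (fun r => K.tortoise (r, l)) (Ioo K.rm K.rp) := by
  refine strictAntiOn_of_deriv_neg (convex_Ioo _ _)
    (fun r hr => (hasDerivAt_tortoise_fst hr hl).continuousAt.continuousWithinAt) fun r hr => ?_
  rw [interior_Ioo] at hr
  rw [(hasDerivAt_tortoise_fst' hr hl).deriv]
  exact tortoise_deriv_neg hr hl

/-- `Υ ≥ (r² + a²)² Δ_θ`, and `Δ_r` vanishes to first order at both horizons, so the slope has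
non-integrable poles there. This makes `r⋆` surjective. -/
theorem exists_tortoise_deriv_le (hl : l ∈ Icc (0 : ℝ) 1) :
    ∃ C : ℝ, 0 < C ∧ ∀ r ∈ Ioo K.rm K.rp, K.upsilonOf r (K.sinSq (r, l)) /
        (K.DeltaR r * (K.Xi - K.kappa * K.sinSq (r, l)) * K.QHat r l)
      ≤ -(1 / (C * ((r - K.rm) * (K.rp - r)))) := by
  have hc : ContinuousOn (fun r => K.Lam / 3 * ((K.rc - r) * (r + (K.rm + K.rp + K.rc)))
      * K.QHat r l / (r ^ 2 + K.a ^ 2) ^ 2) (Icc K.rm K.rp) := by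
    refine ContinuousOn.div ((by fun_prop : ContinuousOn _ _).mul fun r hr => ?_) (by fun_prop)
      fun r _ => (pow_pos (K.rSq_add_pos r) 2).ne'
    exact ((K.qHat_contDiffAt hr hl.1).continuousAt.comp (f := fun r : ℝ => (r, l))
      (by fun_prop)).continuousWithinAt
  obtain ⟨C, hC⟩ := isCompact_Icc.exists_bound_of_continuousOn hc
  refine ⟨max C 1, by positivity, fun r hr => ?_⟩
  have hr' := K.mem_Icc_of_mem_Ioo hr
  have h1 := (le_abs_self _).trans ((hC r hr').trans (le_max_left C 1))
  have hw := pow_pos (K.rSq_add_pos r) 2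
  rw [div_le_iff₀ hw] at h1
  have hD := delta_sinSq_pos hr hl
  have hQ := K.qHat_pos hr' hl.1
  have hU := le_upsilonOf hr' (sinSq_nonneg hr hl)
  have hcof := K.cofactor_pos hr'
  have hm : 0 < r - K.rm := sub_pos.2 hr.1
  have hp : 0 < K.rp - r := sub_pos.2 hr.2
  rw [K.deltaR_eq]
  generalize K.Lam / 3 * ((K.rc - r) * (r + (K.rm + K.rp + K.rc))) = c at *
  generalize K.Xi - K.kappa * K.sinSq (r, l) = D at *
  generalize K.upsilonOf r (K.sinSq (r, l)) = U at *
  generalize (r ^ 2 + K.a ^ 2) ^ 2 = w at *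
  generalize K.QHat r l = Q at *
  have hC0 : 0 < max C 1 := by positivity
  rw [neg_mul, neg_mul, div_neg, neg_le_neg_iff, div_le_div_iff₀ (by positivity) (by positivity)]
  have h2 : (c * Q) * D ≤ max C 1 * w * D := mul_le_mul_of_nonneg_right h1 hD.le
  have h3 : max C 1 * (w * D) ≤ max C 1 * U := mul_le_mul_of_nonneg_left hU hC0.le
  have h4 : 0 < (r - K.rm) * (K.rp - r) := mul_pos hm hp
  have h5 : c * Q * D ≤ max C 1 * U := by linarith
  have h6 := mul_le_mul_of_nonneg_right h5 h4.le
  linarith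

theorem exists_tortoise_eq (hl : l ∈ Icc (0 : ℝ) 1) (x : ℝ) :
    ∃ r ∈ Ioo K.rm K.rp, K.tortoise (r, l) = x := by
  obtain ⟨C, hC, hle⟩ := exists_tortoise_deriv_le (K := K) hl
  have hr0 := K.r0_mem
  have hm : 0 < K.r0 - K.rm := sub_pos.2 hr0.1
  have hp : 0 < K.rp - K.r0 := sub_pos.2 hr0.2
  have hw : 0 < K.rp - K.rm := by linarith
  set x₀ := K.tortoise (K.r0, l) with hx₀
  -- Chosen so that `log ε / (C (r_+ - r_-)) = -|x - x₀|`. Shrinking the distance to either horizon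
  -- by the factor `ε` then moves `r⋆` from `x₀` at least as far as `x`.
  set ε := exp (-(C * (K.rp - K.rm) * |x - x₀|)) with hε
  have hε0 : 0 < ε := exp_pos _
  have hε1 : ε ≤ 1 := exp_le_one_iff.2 (neg_nonpos.2 (by positivity))
  have hlog : log ε / (C * (K.rp - K.rm)) = -|x - x₀| := by rw [hε, log_exp]; field_simp
  set r₁ := K.rp - (K.rp - K.r0) * ε with hr₁
  set r₂ := K.rm + (K.r0 - K.rm) * ε with hr₂
  have h1 : K.r0 ≤ r₁ := by nlinarith
  have h1' : r₁ < K.rp := by have := mul_pos hp hε0; linarith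
  have h2 : r₂ ≤ K.r0 := by nlinarith
  have h2' : K.rm < r₂ := by have := mul_pos hm hε0; linarith
  have hx1 : K.tortoise (r₁, l) ≤ x := by
    have h := sub_le_sub_of_hasDerivAt_le h1
      (f := fun r => K.tortoise (r, l))
      (g := fun r => log (K.rp - r) / (C * (K.rp - K.rm)))
      (g' := fun r => -1 / (K.rp - r) / (C * (K.rp - K.rm)))
      (fun t ht => hasDerivAt_tortoise_fst' ⟨hr0.1.trans_le ht.1, ht.2.trans_lt h1'⟩ hl)
      (fun t ht => (((hasDerivAt_id t).const_sub K.rp).log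
        (sub_pos.2 (ht.2.trans_lt h1')).ne').div_const _)
      (fun t ht => ?_)
    · have h3 : K.rp - r₁ = (K.rp - K.r0) * ε := by rw [hr₁]; ring
      simp only [h3, log_mul hp.ne' hε0.ne', add_div, hlog] at h
      linarith [neg_abs_le (x - x₀)]
    · have h3 : 0 < K.rp - t := sub_pos.2 (ht.2.trans_lt h1')
      have h4 : 0 < t - K.rm := sub_pos.2 (hr0.1.trans_le ht.1)
      refine (hle t ⟨hr0.1.trans_le ht.1, ht.2.trans_lt h1'⟩).trans ?_
      rw [neg_div, neg_div, neg_le_neg_iff, div_div]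
      refine one_div_le_one_div_of_le (by positivity) ?_
      have h5 : C * (K.rp - t) * (t - K.rm) ≤ C * (K.rp - t) * (K.rp - K.rm) :=
        mul_le_mul_of_nonneg_left (by linarith) (by positivity)
      linarith
  have hx2 : x ≤ K.tortoise (r₂, l) := by
    have h := sub_le_sub_of_hasDerivAt_le h2
      (f := fun r => K.tortoise (r, l))
      (g := fun r => -(log (r - K.rm) / (C * (K.rp - K.rm))))
      (g' := fun r => -(1 / (r - K.rm) / (C * (K.rp - K.rm))))
      (fun t ht => hasDerivAt_tortoise_fst' ⟨h2'.trans_le ht.1, ht.2.trans_lt hr0.2⟩ hl)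
      (fun t ht => ((((hasDerivAt_id t).sub_const K.rm).log
        (sub_pos.2 (h2'.trans_le ht.1)).ne').div_const _).neg)
      (fun t ht => ?_)
    · have h3 : r₂ - K.rm = (K.r0 - K.rm) * ε := by rw [hr₂]; ring
      simp only [h3, log_mul hm.ne' hε0.ne', add_div, hlog] at h
      linarith [le_abs_self (x - x₀)]
    · have h3 : 0 < K.rp - t := sub_pos.2 (ht.2.trans_lt hr0.2)
      have h4 : 0 < t - K.rm := sub_pos.2 (h2'.trans_le ht.1)
      refine (hle t ⟨h2'.trans_le ht.1, ht.2.trans_lt hr0.2⟩).trans ?_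
      rw [neg_le_neg_iff, div_div]
      refine one_div_le_one_div_of_le (by positivity) ?_
      have h5 : C * (t - K.rm) * (K.rp - t) ≤ C * (t - K.rm) * (K.rp - K.rm) :=
        mul_le_mul_of_nonneg_left (by linarith) (by positivity)
      linarith
  have hc : ContinuousOn (fun r => K.tortoise (r, l)) (Icc r₂ r₁) := fun t ht =>
    (hasDerivAt_tortoise_fst ⟨h2'.trans_le ht.1, ht.2.trans_lt h1'⟩
      hl).continuousAt.continuousWithinAt
  obtain ⟨t, ht, hte⟩ := intermediate_value_Icc' (h2.trans h1) hc ⟨hx1, hx2⟩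
  exact ⟨t, ⟨h2'.trans_le ht.1, ht.2.trans_lt h1'⟩, hte⟩

end KNdS

namespace KNdS

variable {K : KNdS} {r l θ y : ℝ}

/-! ### The integrals over `θ` in terms of the parameter of the polar motion -/

theorem deltaTheta_eq (θ : ℝ) : K.DeltaTheta θ = K.Xi - K.kappa * sin θ ^ 2 := by
  rw [DeltaTheta, cos_sq', xi_eq, kappa]; ring

theorem deltaTheta_pos (θ : ℝ) : 0 < K.DeltaTheta θ := by
  have := K.kappa_pos
  have : K.DeltaTheta θ = 1 + K.kappa * cos θ ^ 2 := rfl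
  rw [this]
  positivity

/-- The parameter of the polar motion at the angle `θ`. -/
def paramAt (θ l : ℝ) : ℝ := (l - sin θ ^ 2) / (l * (1 - l))

theorem sinFactor_paramAt (hl : l ∈ Ioo (0 : ℝ) 1) :
    sinFactor (paramAt θ l) l = sin θ ^ 2 / l := by
  have := hl.1
  have := sub_pos.2 hl.2
  rw [sinFactor, paramAt]
  field_simp
  ring

theorem cosFactor_paramAt (hl : l ∈ Ioo (0 : ℝ) 1) :
    cosFactor (paramAt θ l) l = cos θ ^ 2 / (1 - l) := by
  have := hl.1
  have := sub_pos.2 hl.2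
  rw [cosFactor, paramAt, cos_sq']
  field_simp
  ring

theorem paramAt_mem (hl : l ∈ Ioo (0 : ℝ) 1) (hθ : 0 < sin θ) (hs : sin θ ^ 2 ≤ l) :
    (paramAt θ l, l) ∈ K.polarDomain := by
  refine mem_polarDomain hl.1.le (div_nonneg (sub_nonneg.2 hs)
    (mul_nonneg hl.1.le (sub_nonneg.2 hl.2.le))) ?_
  rw [sinFactor_paramAt hl]
  have := hl.1
  positivity

theorem polarDelta_paramAt (hl : l ∈ Ioo (0 : ℝ) 1) :
    K.polarDelta (paramAt θ l) l = K.DeltaTheta θ := by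
  rw [polarDelta, sinFactor_paramAt hl, deltaTheta_eq, mul_div_cancel₀ _ hl.1.ne']

theorem pHat_arg_eq (hl : l ∈ Ioo (0 : ℝ) 1) : K.a ^ 2 * (l * K.DeltaTheta θ - sin θ ^ 2) =
    K.a ^ 2 * (l * (1 - l) * K.polarFactor (paramAt θ l) l) := by
  rw [← K.pHatSq_eq, polarDelta_paramAt hl, sinFactor_paramAt hl, mul_div_cancel₀ _ hl.1.ne']

theorem pHat_arg_pos (hl : l ∈ Ioo (0 : ℝ) 1) (hs : sin θ ^ 2 ≤ l) :
    0 < K.a ^ 2 * (l * K.DeltaTheta θ - sin θ ^ 2) := by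
  rw [pHat_arg_eq hl]
  have h1 : 0 ≤ paramAt θ l := div_nonneg (sub_nonneg.2 hs)
    (mul_nonneg hl.1.le (sub_nonneg.2 hl.2.le))
  have := K.kappa_pos
  have := hl.1
  have := sub_pos.2 hl.2
  have := K.a_sq_pos
  have : 0 < K.polarFactor (paramAt θ l) l := by rw [polarFactor]; positivity
  positivity

theorem pHat_pos (hl : l ∈ Ioo (0 : ℝ) 1) (hs : sin θ ^ 2 ≤ l) : 0 < K.PHat θ l :=
  sqrt_pos.2 (pHat_arg_pos hl hs)

theorem pHat_sq (hl : l ∈ Ioo (0 : ℝ) 1) (hs : sin θ ^ 2 ≤ l) : K.PHat θ l ^ 2 =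
    K.a ^ 2 * (l * (1 - l) * K.polarFactor (paramAt θ l) l) := by
  rw [PHat, sq_sqrt (pHat_arg_pos hl hs).le, pHat_arg_eq hl]

/-- Together with `hasDerivAt_paramAt` this is the substitution rule: the slowness times `dq` equals
`-dθ / P̂`. It is proved by comparing the squares of two positive quantities. -/
theorem slowness_paramAt (hl : l ∈ Ioo (0 : ℝ) 1) (hθ : 0 < sin θ) (hθ' : 0 < cos θ)
    (hs : sin θ ^ 2 ≤ l) :
    K.slowness (paramAt θ l, l) = l * (1 - l) / (2 * sin θ * cos θ * K.PHat θ l) := by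
  have h0 := hl.1
  have h1 := sub_pos.2 hl.2
  have h2 := pHat_pos (K := K) hl hs
  have h3 := cubic_pos (paramAt_mem (K := K) hl hθ hs)
  have h4 := sqrt_pos.2 h3
  have ha := K.abs_a_pos
  have key : |K.a| * √(K.cubic (paramAt θ l) l) * (l * (1 - l)) = sin θ * cos θ * K.PHat θ l := by
    rw [← sq_eq_sq₀ (by positivity) (by positivity), mul_pow, mul_pow, mul_pow, sq_abs, sq_sqrt h3.le,
      mul_pow, pHat_sq hl hs, cubic, sinFactor_paramAt hl, cosFactor_paramAt hl]
    field_simp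
  rw [slowness, div_eq_div_iff (by positivity) (by positivity)]
  dsimp only
  linear_combination -2 * key

theorem hasDerivAt_paramAt (θ l : ℝ) :
    HasDerivAt (fun θ => paramAt θ l) (-(2 * sin θ * cos θ) / (l * (1 - l))) θ := by
  refine (((hasDerivAt_sin_sq θ).const_sub l).div_const (l * (1 - l))).congr_deriv ?_
  rw [sin_two_mul]

theorem hasDerivAt_polarTime_paramAt (hl : l ∈ Ioo (0 : ℝ) 1) (hθ : 0 < sin θ)
    (hθ' : 0 < cos θ) (hs : sin θ ^ 2 ≤ l) :
    HasDerivAt (fun θ => K.polarTime (paramAt θ l, l)) (-(1 / K.PHat θ l)) θ := by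
  refine ((hasDerivAt_polarTime (paramAt_mem hl hθ hs)).comp θ
    (hasDerivAt_paramAt θ l)).congr_deriv ?_
  have h0 := hl.1
  have h1 := sub_pos.2 hl.2
  have h2 := pHat_pos (K := K) hl hs
  rw [slowness_paramAt hl hθ hθ' hs]
  field_simp

theorem hasDerivAt_polarAction_paramAt (hl : l ∈ Ioo (0 : ℝ) 1) (hθ : 0 < sin θ)
    (hθ' : 0 < cos θ) (hs : sin θ ^ 2 ≤ l) :
    HasDerivAt (fun θ => K.polarAction (paramAt θ l, l)) (-(K.PHat θ l / K.DeltaTheta θ)) θ := by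
  refine ((hasDerivAt_polarAction (paramAt_mem hl hθ hs) (Ioo_subset_Icc_self hl)).comp θ
    (hasDerivAt_paramAt θ l)).congr_deriv ?_
  have h0 := hl.1
  have h1 := sub_pos.2 hl.2
  have h2 := pHat_pos (K := K) hl hs
  have h3 := deltaTheta_pos (K := K) θ
  have h4 := pHat_sq (K := K) hl hs
  rw [polarWeight]
  dsimp only
  rw [polarDelta_paramAt hl, slowness_paramAt hl hθ hθ' hs]
  field_simp
  linear_combination h4

theorem paramAt_self (h : sin y ^ 2 = l) : paramAt y l = 0 := by simp [paramAt, h]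

theorem continuous_pHat : Continuous fun p : ℝ × ℝ => K.PHat p.1 p.2 := by
  unfold PHat DeltaTheta; fun_prop

theorem continuous_deltaTheta : Continuous K.DeltaTheta := by unfold DeltaTheta; fun_prop

theorem continuous_pHat_div (l : ℝ) : Continuous fun θ => K.PHat θ l / K.DeltaTheta θ :=
  (continuous_pHat.comp (by fun_prop : Continuous fun θ : ℝ => (θ, l))).div continuous_deltaTheta
    fun θ => (deltaTheta_pos θ).ne'

theorem sin_sq_le_of_mem_Icc (hy : y ∈ Icc 0 (π / 2)) {t : ℝ} (ht : t ∈ Icc 0 y) :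
    sin t ^ 2 ≤ sin y ^ 2 :=
  pow_le_pow_left₀ (sin_nonneg_of_nonneg_of_le_pi ht.1 (by linarith [ht.2, hy.2, pi_pos]))
    (sin_le_sin_of_le_of_le_pi_div_two (by linarith [ht.1, pi_pos]) hy.2 ht.2) 2

theorem sin_sq_mem_Ioo (hy : y ∈ Ioo 0 (π / 2)) : sin y ^ 2 ∈ Ioo (0 : ℝ) 1 := by
  have h1 := sin_pos_of_pos_of_lt_pi hy.1 (by linarith [hy.2, pi_pos])
  have h2 := cos_pos_of_mem_Ioo ⟨by linarith [hy.1, pi_pos], hy.2⟩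
  exact ⟨by positivity, by nlinarith [sin_sq_add_cos_sq y]⟩

theorem sin_pos_of_mem_Icc {t : ℝ} (hθ : 0 < θ) (hy : y < π / 2) (ht : t ∈ Icc θ y) : 0 < sin t :=
  sin_pos_of_pos_of_lt_pi (hθ.trans_le ht.1) (by linarith [ht.2, pi_pos])

theorem cos_pos_of_mem_Icc {t : ℝ} (hθ : 0 < θ) (hy : y < π / 2) (ht : t ∈ Icc θ y) : 0 < cos t :=
  cos_pos_of_mem_Ioo ⟨by linarith [ht.1, pi_pos], by linarith [ht.2]⟩

theorem integral_one_div_pHat (hθ : 0 < θ) (hθy : θ ≤ y) (hy : y < π / 2) :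
    ∫ t in θ..y, 1 / K.PHat t (sin y ^ 2) = K.polarTime (paramAt θ (sin y ^ 2), sin y ^ 2) := by
  have hl := sin_sq_mem_Ioo ⟨hθ.trans_le hθy, hy⟩
  have hs : ∀ t ∈ Icc θ y, sin t ^ 2 ≤ sin y ^ 2 := fun t ht =>
    sin_sq_le_of_mem_Icc ⟨(hθ.trans_le hθy).le, hy.le⟩ ⟨hθ.le.trans ht.1, ht.2⟩
  have h := intervalIntegral.integral_eq_sub_of_hasDerivAt (a := θ) (b := y)
    (f := fun t => -K.polarTime (paramAt t (sin y ^ 2), sin y ^ 2))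
    (f' := fun t => 1 / K.PHat t (sin y ^ 2)) (fun t ht => ?_) ?_
  · rw [h, paramAt_self rfl, polarTime_zero]; ring
  · rw [uIcc_of_le hθy] at ht
    exact (hasDerivAt_polarTime_paramAt (K := K) hl (sin_pos_of_mem_Icc hθ hy ht)
      (cos_pos_of_mem_Icc hθ hy ht) (hs t ht)).neg.congr_deriv (by ring)
  · refine ContinuousOn.intervalIntegrable ?_
    rw [uIcc_of_le hθy]
    exact continuousOn_const.div (continuous_pHat.comp
      (by fun_prop : Continuous fun θ : ℝ => (θ, sin y ^ 2))).continuousOn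
      fun t ht => (pHat_pos hl (hs t ht)).ne'

theorem integral_pHat_div (hθ : 0 < θ) (hθy : θ ≤ y) (hy : y < π / 2) :
    ∫ t in θ..y, K.PHat t (sin y ^ 2) / K.DeltaTheta t =
      K.polarAction (paramAt θ (sin y ^ 2), sin y ^ 2) := by
  have hl := sin_sq_mem_Ioo ⟨hθ.trans_le hθy, hy⟩
  have hs : ∀ t ∈ Icc θ y, sin t ^ 2 ≤ sin y ^ 2 := fun t ht =>
    sin_sq_le_of_mem_Icc ⟨(hθ.trans_le hθy).le, hy.le⟩ ⟨hθ.le.trans ht.1, ht.2⟩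
  have h := intervalIntegral.integral_eq_sub_of_hasDerivAt (a := θ) (b := y)
    (f := fun t => -K.polarAction (paramAt t (sin y ^ 2), sin y ^ 2))
    (f' := fun t => K.PHat t (sin y ^ 2) / K.DeltaTheta t) (fun t ht => ?_)
    ((continuous_pHat_div _).intervalIntegrable _ _)
  · rw [h, paramAt_self rfl]; simp [polarAction]
  · rw [uIcc_of_le hθy] at ht
    exact (hasDerivAt_polarAction_paramAt (K := K) hl (sin_pos_of_mem_Icc hθ hy ht)
      (cos_pos_of_mem_Icc hθ hy ht) (hs t ht)).neg.congr_deriv (by ring)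

/-! ### The polar part of `r⋆` at `θ = θ⋆` -/

theorem sin_sq_le_of_mem_uIcc_arcsin (hl : l ∈ Ioo (0 : ℝ) 1) {t : ℝ}
    (ht : t ∈ uIcc 0 (arcsin √l)) : sin t ^ 2 ≤ l := by
  have h0 : 0 ≤ arcsin √l := arcsin_nonneg.2 (sqrt_nonneg _)
  rw [uIcc_of_le h0] at ht
  have h := sin_sq_le_of_mem_Icc ⟨h0, arcsin_le_pi_div_two _⟩ ht
  rwa [sin_arcsin (by linarith [sqrt_nonneg l]) (sqrt_le_one.2 hl.2.le), sq_sqrt hl.1.le] at h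

theorem hasDerivAt_arcsin_sqrt (hl : l ∈ Ioo (0 : ℝ) 1) :
    HasDerivAt (fun l => arcsin √l) (1 / (2 * √l * √(1 - l))) l := by
  have h0 := hl.1
  have h1 := sub_pos.2 hl.2
  have h2 := sqrt_pos.2 h0
  have h3 : √l < 1 := by rw [sqrt_lt' one_pos]; simpa using hl.2
  refine ((hasDerivAt_arcsin (by linarith) h3.ne).comp l (hasDerivAt_sqrt h0.ne')).congr_deriv ?_
  rw [sq_sqrt h0.le]
  field_simp

theorem pHat_div_contDiffAt (hl : l ∈ Ioo (0 : ℝ) 1) {t : ℝ} (hs : sin t ^ 2 ≤ l) :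
    ContDiffAt ℝ ∞ (fun p : ℝ × ℝ => K.PHat p.1 p.2 / K.DeltaTheta p.1) (t, l) := by
  have h1 : ContDiffAt ℝ ∞ (fun p : ℝ × ℝ => K.DeltaTheta p.1) (t, l) := by
    unfold DeltaTheta; fun_prop
  refine ContDiffAt.div (ContDiffAt.sqrt ?_ (pHat_arg_pos hl hs).ne') h1 (deltaTheta_pos t).ne'
  fun_prop

theorem hasDerivAt_pHat_div_snd (hl : l ∈ Ioo (0 : ℝ) 1) {t : ℝ} (hs : sin t ^ 2 ≤ l) :
    HasDerivAt (fun l => K.PHat t l / K.DeltaTheta t) (K.a ^ 2 / 2 * (1 / K.PHat t l)) l := by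
  have h1 : HasDerivAt (fun l => K.a ^ 2 * (l * K.DeltaTheta t - sin t ^ 2))
      (K.a ^ 2 * K.DeltaTheta t) l := by
    simpa using (((hasDerivAt_id l).mul_const (K.DeltaTheta t)).sub_const (sin t ^ 2)).const_mul
      (K.a ^ 2)
  have h2 := deltaTheta_pos (K := K) t
  have h3 := pHat_pos (K := K) hl hs
  refine ((h1.sqrt (pHat_arg_pos hl hs).ne').div_const (K.DeltaTheta t)).congr_deriv ?_
  change K.a ^ 2 * K.DeltaTheta t / (2 * K.PHat t l) / K.DeltaTheta t = _
  field_simp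

/-- The endpoint term in the derivative of `fullAction`, rewritten through `polarWeight`, which
stays smooth at `l = 0` and `l = 1`. -/
theorem pHat_div_arcsin (hl : l ∈ Ioo (0 : ℝ) 1) :
    K.PHat (arcsin √l) l / K.DeltaTheta (arcsin √l) * (1 / (2 * √l * √(1 - l)))
      = K.polarWeight (0, l) := by
  have hsin : sin (arcsin √l) ^ 2 = l := by
    rw [sin_arcsin (by linarith [sqrt_nonneg l]) (sqrt_le_one.2 hl.2.le), sq_sqrt hl.1.le]
  have h0 := sqrt_pos.2 hl.1
  have h1 := sqrt_pos.2 (sub_pos.2 hl.2)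
  have hk := sqrt_pos.2 K.kappa_pos
  have ha := K.abs_a_pos
  have h2 := deltaTheta_pos (K := K) (arcsin √l)
  have h3 : K.polarDelta 0 l = K.DeltaTheta (arcsin √l) := by
    rw [deltaTheta_eq, hsin, polarDelta, sinFactor]; ring
  have h4 : K.PHat (arcsin √l) l = |K.a| * (√l * √(1 - l) * √K.kappa) := by
    rw [PHat, pHat_arg_eq hl, paramAt_self hsin, sqrt_mul (sq_nonneg _), sqrt_sq_eq_abs,
      sqrt_mul (mul_nonneg hl.1.le (sub_nonneg.2 hl.2.le)), sqrt_mul hl.1.le]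
    simp [polarFactor]
  have h5 : K.slowness (0, l) = 1 / (2 * |K.a| * √K.kappa) := by
    simp [slowness, cubic, sinFactor, cosFactor, polarFactor]
  have h6 : K.polarFactor 0 l = √K.kappa ^ 2 := by
    rw [sq_sqrt K.kappa_pos.le]; simp [polarFactor]
  rw [polarWeight]
  dsimp only
  rw [h3, h4, h5, h6, ← sq_abs K.a]
  field_simp

variable (K) in
/-- The integral of `P̂ / Δ_θ` from the pole to `θ⋆`. -/
def fullAction (l : ℝ) : ℝ := ∫ t in (0 : ℝ)..arcsin √l, K.PHat t l / K.DeltaTheta t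

theorem continuous_fullAction : Continuous K.fullAction := by
  refine intervalIntegral.continuous_parametric_intervalIntegral_of_continuous
    (f := fun l t => K.PHat t l / K.DeltaTheta t) ?_ (by fun_prop)
  exact (continuous_pHat.comp continuous_swap).div (continuous_deltaTheta.comp continuous_snd)
    fun p => (deltaTheta_pos p.2).ne'

theorem hasDerivAt_fullAction (hl : l ∈ Ioo (0 : ℝ) 1) :
    HasDerivAt K.fullAction (K.polarWeight (0, l)
      + K.a ^ 2 / 2 * ∫ t in (0 : ℝ)..arcsin √l, 1 / K.PHat t l) l := by
  have hc : ∀ t ∈ uIcc 0 (arcsin √l),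
      ContDiffAt ℝ ∞ (fun p : ℝ × ℝ => K.PHat p.1 p.2 / K.DeltaTheta p.1) (t, l) := fun t ht =>
    pHat_div_contDiffAt hl (sin_sq_le_of_mem_uIcc_arcsin hl ht)
  have h := hasDerivAt_comp_pair (u := fun l => arcsin √l) (v := id)
    ((contDiffAt_primitive hc).differentiableAt (by simp)) (hasDerivAt_primitive_fst hc)
    (hasDerivAt_integral_param (p' := fun t => K.a ^ 2 / 2 * (1 / K.PHat t l)) hc fun t ht =>
      hasDerivAt_pHat_div_snd hl (sin_sq_le_of_mem_uIcc_arcsin hl ht))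
    (hasDerivAt_arcsin_sqrt hl) (hasDerivAt_id l)
  refine h.congr_deriv ?_
  dsimp only
  rw [pHat_div_arcsin hl, intervalIntegral.integral_const_mul, mul_one]

/-- The role of `f`: its derivative cancels the integral of `1 / P̂` produced by differentiating
`fullAction` under the integral sign. Only the endpoint term remains. -/
theorem fullAction_add_f (hl : l ∈ Icc (0 : ℝ) 1) :
    K.fullAction l + K.a ^ 2 / 2 * K.f l = K.axisAction l := by
  have hc : ContinuousOn (fun l => K.fullAction l - K.axisAction l) (Icc 0 l) :=
    continuous_fullAction.continuousOn.sub fun t ht =>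
      (hasDerivAt_axisAction ⟨ht.1, ht.2.trans hl.2⟩).continuousAt.continuousWithinAt
  have hd : ∀ t ∈ Ioo 0 l, HasDerivAt (fun l => K.fullAction l - K.axisAction l)
      (K.a ^ 2 / 2 * ∫ θ in (0 : ℝ)..arcsin √t, 1 / K.PHat θ t) t := fun t ht => by
    have ht' : t ∈ Ioo (0 : ℝ) 1 := ⟨ht.1, ht.2.trans_le hl.2⟩
    refine ((hasDerivAt_fullAction ht').sub
      (hasDerivAt_axisAction (Ioo_subset_Icc_self ht'))).congr_deriv ?_
    ring
  -- The derivative is available only in the open interval and no bound for it is at hand. Its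
  -- nonnegativity supplies integrability.
  have hint := intervalIntegral.integrableOn_deriv_of_nonneg hc hd fun t _ =>
    mul_nonneg (by positivity) (intervalIntegral.integral_nonneg (arcsin_nonneg.2 (sqrt_nonneg _))
      fun θ _ => one_div_nonneg.2 (sqrt_nonneg _))
  have h := intervalIntegral.integral_eq_sub_of_hasDerivAt_of_le hl.1 hc hd
    ((intervalIntegrable_iff_integrableOn_Ioc_of_le hl.1).2 hint)
  rw [intervalIntegral.integral_const_mul] at h
  have h0 : K.fullAction 0 - K.axisAction 0 = 0 := by simp [fullAction, axisAction]
  rw [f, intervalIntegral.integral_neg]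
  linarith

/-! ### `ϱ` and `F` -/

theorem varrho_radial (hr : r ∈ Ioo K.rm K.rp) (hl : 0 ≤ l) :
    (∫ t in K.r0..r, (t ^ 2 + K.a ^ 2) / K.DeltaR t)
      + (∫ t in r..K.rp, ((t ^ 2 + K.a ^ 2) - K.QHat t l) / K.DeltaR t)
      = K.radialTortoise (r, l) := by
  rw [radialTortoise, sub_eq_add_neg, ← intervalIntegral.integral_symm]
  congr 1
  refine intervalIntegral.integral_congr_Ioo_of_le hr.2.le fun t ht => ?_
  exact sub_qHat_div_deltaR ⟨hr.1.trans ht.1, ht.2⟩ hl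

theorem paramAt_polarParam (hl : l ∈ Ioo (0 : ℝ) 1) (h : K.sinSq (r, l) = sin θ ^ 2) :
    paramAt θ l = K.polarParam (r, l) := by
  have h0 := hl.1
  have h1 := sub_pos.2 hl.2
  rw [paramAt, ← h, sinSq, sinFactor]
  field_simp
  ring

/-- The integral of `P̂ / Δ_θ` up to `θ` is the one up to `θ⋆` minus `polarAction`, and
`fullAction_add_f` absorbs `f`. Pole and equator are treated apart because `paramAt` divides by `l
(1 - l)`. -/
theorem varrho_eq (hr : r ∈ Ioo K.rm K.rp) (hy : y ∈ Icc 0 (π / 2)) (hθ : θ ∈ Icc 0 (π / 2))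
    (h : K.sinSq (r, sin y ^ 2) = sin θ ^ 2) :
    K.varrho r θ (sin y ^ 2) = K.tortoise (r, sin y ^ 2) := by
  have hl := sin_sq_mem_Icc y
  have harc : arcsin √(sin y ^ 2) = y := by
    rw [sqrt_sq (sin_nonneg_of_nonneg_of_le_pi hy.1 (by linarith [hy.2, pi_pos])),
      arcsin_sin (by linarith [hy.1, pi_pos]) hy.2]
  have hfull := fullAction_add_f (K := K) hl
  rw [fullAction, harc] at hfull
  have hpol : (∫ t in θ..y, K.PHat t (sin y ^ 2) / K.DeltaTheta t)
      = K.polarAction (K.polarParam (r, sin y ^ 2), sin y ^ 2) := by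
    have hsin0 : 0 ≤ sin θ := sin_nonneg_of_nonneg_of_le_pi hθ.1 (by linarith [hθ.2, pi_pos])
    rcases hy.1.eq_or_lt with rfl | hy0
    · have h1 : sin θ = 0 := by simpa [sinSq_zero] using h.symm
      have h2 : θ = 0 := by
        by_contra hne
        exact (sin_pos_of_pos_of_lt_pi (lt_of_le_of_ne hθ.1 (Ne.symm hne))
          (by linarith [hθ.2, pi_pos])).ne' h1
      simp [h2, polarAction]
    rcases hy.2.eq_or_lt with rfl | hy1
    · have h1 : cos θ = 0 := by
        have h3 := h
        simp only [sin_pi_div_two, one_pow, sinSq_one] at h3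
        have := sin_sq_add_cos_sq θ
        nlinarith
      have h2 : θ = π / 2 := by
        by_contra hne
        exact (cos_pos_of_mem_Ioo ⟨by linarith [hθ.1, pi_pos],
          lt_of_le_of_ne hθ.2 hne⟩).ne' h1
      simp [h2, polarAction]
    · have hl' := sin_sq_mem_Ioo ⟨hy0, hy1⟩
      have h1 := sinSq_mem_Ioo hr hl'
      have hθ0 : 0 < θ := by
        rcases hθ.1.eq_or_lt with rfl | h2
        · simp [h] at h1
        · exact h2
      have hle : θ ≤ y := by
        have h2 := sinSq_le hr hl
        rw [h] at h2
        by_contra! hlt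
        have h4 := sin_lt_sin_of_lt_of_le_pi_div_two (by linarith [hy.1, pi_pos]) hθ.2 hlt
        have h5 := sin_pos_of_pos_of_lt_pi hy0 (by linarith [pi_pos])
        nlinarith
      rw [integral_pHat_div hθ0 hle hy1, paramAt_polarParam hl' h]
  have hadd := intervalIntegral.integral_add_adjacent_intervals
    ((continuous_pHat_div (K := K) (sin y ^ 2)).intervalIntegrable (μ := volume) 0 θ)
    ((continuous_pHat_div (K := K) (sin y ^ 2)).intervalIntegrable (μ := volume) θ y)
  rw [varrho, varrho_radial hr hl.1, tortoise]
  dsimp only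
  linarith

theorem F_eq (hθ : 0 < θ) (hθy : θ ≤ y) (hy : y < π / 2) :
    K.F r θ y = K.radialTime (r, sin y ^ 2)
      - K.polarTime (paramAt θ (sin y ^ 2), sin y ^ 2) := by
  rw [F, intervalIntegral.integral_symm, integral_one_div_pHat hθ hθy hy, radialTime_eq]
  ring

/-! ### `θ⋆` and `r⋆` as functions of `r` and `θ` -/

theorem sinSq_eq_of_F_eq_zero (hθ : 0 < θ) (hθy : θ ≤ y) (hy : y < π / 2) (h : K.F r θ y = 0) :
    K.sinSq (r, sin y ^ 2) = sin θ ^ 2 := by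
  have hl := sin_sq_mem_Ioo ⟨hθ.trans_le hθy, hy⟩
  rw [F_eq hθ hθy hy, sub_eq_zero] at h
  have hs := sin_sq_le_of_mem_Icc (y := y) ⟨(hθ.trans_le hθy).le, hy.le⟩ ⟨hθ.le, hθy⟩
  have h1 := polarParam_eq (p := (r, sin y ^ 2)) (paramAt_mem hl
    (sin_pos_of_mem_Icc hθ hy ⟨le_rfl, hθy⟩) hs) h.symm
  rw [sinSq, h1]
  dsimp only
  rw [sinFactor_paramAt hl, mul_div_cancel₀ _ hl.1.ne']

/-- The intermediate value theorem is applied to `sin² θ` as a function of `l`, which runs from `0`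
to `1`, and not to `F` itself. The zero is then `arcsin √l`. -/
theorem exists_F_eq_zero (hr : r ∈ Ioo K.rm K.rp) (hθ : θ ∈ Ioo 0 (π / 2)) :
    ∃ y ∈ Ico θ (π / 2), K.F r θ y = 0 := by
  have hsθ := sin_sq_mem_Ioo hθ
  have hsin := sin_pos_of_pos_of_lt_pi hθ.1 (by linarith [hθ.2, pi_pos])
  have hc : ContinuousOn (fun l => K.sinSq (r, l)) (Icc 0 1) := fun l hl =>
    ((sinSq_contDiffAt hr hl).continuousAt.comp (f := fun l : ℝ => (r, l))
      (by fun_prop)).continuousWithinAt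
  obtain ⟨l, hl, hle⟩ := intermediate_value_Icc zero_le_one hc
    (by simpa only [sinSq_zero, sinSq_one] using Ioo_subset_Icc_self hsθ)
  dsimp only at hle
  have hl0 : 0 < l := by
    rcases hl.1.eq_or_lt with rfl | h
    · rw [sinSq_zero] at hle; exact absurd hle hsθ.1.ne
    · exact h
  have hl1 : l < 1 := by
    rcases hl.2.eq_or_lt with rfl | h
    · rw [sinSq_one] at hle; exact absurd hle hsθ.2.ne'
    · exact h
  have hsq : √l < 1 := by rw [sqrt_lt' one_pos]; simpa using hl1
  have hsy : sin (arcsin √l) = √l := sin_arcsin (by linarith [sqrt_nonneg l]) hsq.le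
  have hsy2 : sin (arcsin √l) ^ 2 = l := by rw [hsy, sq_sqrt hl0.le]
  have hlt : arcsin √l < π / 2 := arcsin_lt_pi_div_two.2 hsq
  have hge : θ ≤ arcsin √l := by
    rw [← arcsin_sin (x := θ) (by linarith [hθ.1, pi_pos]) hθ.2.le]
    refine monotone_arcsin (le_sqrt_of_sq_le ?_)
    rw [← hle]
    exact sinSq_le hr hl
  refine ⟨arcsin √l, ⟨hge, hlt⟩, ?_⟩
  rw [F_eq hθ.1 hge hlt, hsy2, paramAt_polarParam ⟨hl0, hl1⟩ hle, (polarParam_spec hr hl).2, sub_self]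

theorem thetaStarNorth_spec (hr : r ∈ Ioo K.rm K.rp) (hθ : θ ∈ Icc 0 (π / 2)) :
    K.thetaStarNorth r θ ∈ Icc 0 (π / 2) ∧
      K.sinSq (r, sin (K.thetaStarNorth r θ) ^ 2) = sin θ ^ 2 := by
  by_cases h0 : θ = 0
  · have : K.thetaStarNorth r θ = 0 := if_pos h0
    rw [this, h0]
    exact ⟨left_mem_Icc.2 (by positivity), by simp [sinSq_zero]⟩
  by_cases h1 : θ = π / 2
  · have : K.thetaStarNorth r θ = π / 2 := by rw [thetaStarNorth, if_neg h0, if_pos h1]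
    rw [this, h1]
    exact ⟨right_mem_Icc.2 (by positivity), by simp [sinSq_one]⟩
  · have hθ' : θ ∈ Ioo 0 (π / 2) := ⟨lt_of_le_of_ne hθ.1 (Ne.symm h0), lt_of_le_of_ne hθ.2 h1⟩
    obtain ⟨y, hy, hF⟩ := exists_F_eq_zero hr hθ'
    have hs := Classical.epsilon_spec (p := fun y : ℝ => y ∈ Ico θ (π / 2) ∧ K.F r θ y = 0)
      ⟨y, hy, hF⟩
    have : K.thetaStarNorth r θ =
        Classical.epsilon fun y : ℝ => y ∈ Ico θ (π / 2) ∧ K.F r θ y = 0 := by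
      rw [thetaStarNorth, if_neg h0, if_neg h1]
    rw [← this] at hs
    exact ⟨⟨hθ.1.trans hs.1.1, hs.1.2.le⟩, sinSq_eq_of_F_eq_zero hθ'.1 hs.1.1 hs.1.2 hs.2⟩

theorem cos_eq_of_sinSq_eq (hy : y ∈ Icc 0 (π / 2)) (hθ : θ ∈ Icc 0 (π / 2))
    (h : K.sinSq (r, sin y ^ 2) = sin θ ^ 2) :
    cos θ = cos y * √(cosFactor (K.polarParam (r, sin y ^ 2)) (sin y ^ 2)) := by
  have h1 := one_sub_sinSq (K := K) (r, sin y ^ 2)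
  have hc : 0 ≤ cos θ := cos_nonneg_of_mem_Icc ⟨by linarith [hθ.1, pi_pos], hθ.2⟩
  have hc' : 0 ≤ cos y := cos_nonneg_of_mem_Icc ⟨by linarith [hy.1, pi_pos], hy.2⟩
  dsimp only at h1
  rw [h, ← cos_sq', ← cos_sq'] at h1
  rw [← sqrt_sq hc, h1, sqrt_mul (sq_nonneg _), sqrt_sq hc']

/-- Stated through `cos`, which changes sign under reflection in the equator while `sin² θ⋆` does
not, so one formula covers both hemispheres. -/
theorem thetaStar_spec (hr : r ∈ Ioo K.rm K.rp) (hθ : θ ∈ Icc 0 π) :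
    K.thetaStar r θ ∈ Icc 0 π ∧
      cos θ = cos (K.thetaStar r θ) * √(cosFactor (K.polarParam (r, sin (K.thetaStar r θ) ^ 2))
        (sin (K.thetaStar r θ) ^ 2)) ∧
      K.rStar r θ = K.tortoise (r, sin (K.thetaStar r θ) ^ 2) := by
  rcases le_or_gt θ (π / 2) with h | h
  · have hθ' : θ ∈ Icc 0 (π / 2) := ⟨hθ.1, h⟩
    have he : K.thetaStar r θ = K.thetaStarNorth r θ := if_pos h
    obtain ⟨hy, hs⟩ := thetaStarNorth_spec hr hθ'
    rw [rStar, min_eq_left (by linarith), he]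
    exact ⟨⟨hy.1, by linarith [hy.2, pi_pos]⟩, cos_eq_of_sinSq_eq hy hθ' hs, varrho_eq hr hy hθ' hs⟩
  · have hθ' : π - θ ∈ Icc 0 (π / 2) := ⟨by linarith [hθ.2], by linarith⟩
    have he : K.thetaStar r θ = π - K.thetaStarNorth r (π - θ) := if_neg (not_le.2 h)
    obtain ⟨hy, hs⟩ := thetaStarNorth_spec hr hθ'
    have hc := cos_eq_of_sinSq_eq hy hθ' hs
    rw [cos_pi_sub] at hc
    rw [rStar, min_eq_right (by linarith), he, sin_pi_sub, cos_pi_sub]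
    refine ⟨⟨by linarith [hy.2, pi_pos], by linarith [hy.1]⟩, ?_, varrho_eq hr hy hθ' hs⟩
    linarith

end KNdS

theorem derivSnd_unique {G : ℝ × ℝ → ℝ} (hG : ContDiffOn ℝ ∞ G strip) {x l g' : ℝ}
    (hl : l ∈ Icc (0 : ℝ) 1) (h : HasDerivWithinAt (fun l => G (x, l)) g' (Icc 0 1) l) :
    derivSnd G (x, l) = g' :=
  (uniqueDiffOn_Icc zero_lt_one l hl).eq_deriv _ (hasDerivWithinAt_strip_snd hG hl) h

namespace KNdS

variable {K : KNdS} {r l θ x y : ℝ}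

/-! ### `r` and `θ` as functions of `r⋆` and `l = sin² θ⋆` -/

variable (K) in
/-- `r` as a function of `r⋆` and `l`. -/
def radius (p : ℝ × ℝ) : ℝ :=
  Function.invFunOn (fun r => K.tortoise (r, p.2)) (Ioo K.rm K.rp) p.1

variable (K) in
/-- The parameter of the polar motion as a function of `r⋆` and `l`. -/
def param (p : ℝ × ℝ) : ℝ := K.polarParam (K.radius p, p.2)

variable (K) in
/-- `sin² θ / sin² θ⋆` as a function of `r⋆` and `l`. -/
def sinRatio (p : ℝ × ℝ) : ℝ := sinFactor (K.param p) p.2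

variable (K) in
/-- `cos² θ / cos² θ⋆` as a function of `r⋆` and `l`. -/
def cosRatio (p : ℝ × ℝ) : ℝ := cosFactor (K.param p) p.2

variable (K) in
/-- `sin² θ` as a function of `r⋆` and `l`. -/
def sinSqOf (p : ℝ × ℝ) : ℝ := p.2 * K.sinRatio p

theorem radius_mem (hl : l ∈ Icc (0 : ℝ) 1) (x : ℝ) : K.radius (x, l) ∈ Ioo K.rm K.rp :=
  Function.invFunOn_mem (exists_tortoise_eq hl x)

theorem tortoise_radius (hl : l ∈ Icc (0 : ℝ) 1) (x : ℝ) :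
    K.tortoise (K.radius (x, l), l) = x :=
  Function.invFunOn_eq (exists_tortoise_eq hl x)

theorem radius_eq (hl : l ∈ Icc (0 : ℝ) 1) (hr : r ∈ Ioo K.rm K.rp)
    (h : K.tortoise (r, l) = x) : K.radius (x, l) = r :=
  (tortoise_strictAntiOn hl).injOn (radius_mem hl x) hr ((tortoise_radius hl x).trans h.symm)

/-- Implicit function theorem plus injectivity of `r⋆` in `r`. Injectivity is known only for `l ∈
[0, 1]`, so the result is smoothness within the strip. -/
theorem radius_contDiffOn : ContDiffOn ℝ ∞ K.radius strip := by
  rintro ⟨x, l⟩ ⟨-, hl⟩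
  have hl : l ∈ Icc (0 : ℝ) 1 := hl
  have hr := radius_mem (K := K) hl x
  obtain ⟨σ, hσ, hσr, hσe⟩ := exists_contDiffAt_partial_inverse (tortoise_contDiffAt hr hl)
    (hasDerivAt_tortoise_fst' hr hl) (tortoise_deriv_neg hr hl).ne
  rw [tortoise_radius hl] at hσ hσr hσe
  refine hσ.contDiffWithinAt.congr_of_eventuallyEq ?_ hσr.symm
  have h1 : ∀ᶠ z in 𝓝 (x, l), σ z ∈ Ioo K.rm K.rp :=
    hσ.continuousAt.eventually (isOpen_Ioo.mem_nhds (by rwa [hσr]))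
  filter_upwards [nhdsWithin_le_nhds hσe, nhdsWithin_le_nhds h1, self_mem_nhdsWithin]
    with z hz1 hz2 hz3
  exact radius_eq hz3.2 hz2 hz1

theorem contDiffOn_comp_radius {g : ℝ × ℝ → ℝ}
    (hg : ∀ r ∈ Ioo K.rm K.rp, ∀ l ∈ Icc (0 : ℝ) 1, ContDiffAt ℝ ∞ g (r, l)) :
    ContDiffOn ℝ ∞ (fun p => g (K.radius p, p.2)) strip := by
  intro p hp
  exact (hg _ (radius_mem hp.2 p.1) _ hp.2).comp_contDiffWithinAt
    (f := fun p : ℝ × ℝ => (K.radius p, p.2)) p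
    ((radius_contDiffOn p hp).prodMk contDiffWithinAt_snd)

theorem param_contDiffOn : ContDiffOn ℝ ∞ K.param strip :=
  contDiffOn_comp_radius fun _ hr _ hl => polarParam_contDiffAt hr hl

theorem sinRatio_contDiffOn : ContDiffOn ℝ ∞ K.sinRatio strip := by
  have := param_contDiffOn (K := K)
  unfold sinRatio sinFactor
  fun_prop

theorem cosRatio_contDiffOn : ContDiffOn ℝ ∞ K.cosRatio strip := by
  have := param_contDiffOn (K := K)
  unfold cosRatio cosFactor
  fun_prop

theorem sinSqOf_contDiffOn : ContDiffOn ℝ ∞ K.sinSqOf strip := by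
  have := sinRatio_contDiffOn (K := K)
  unfold sinSqOf
  fun_prop

theorem param_mem (hl : l ∈ Icc (0 : ℝ) 1) (x : ℝ) : (K.param (x, l), l) ∈ K.polarDomain :=
  (polarParam_spec (radius_mem hl x) hl).1

theorem sinRatio_pos (hl : l ∈ Icc (0 : ℝ) 1) (x : ℝ) : 0 < K.sinRatio (x, l) :=
  (param_mem hl x).1

theorem cosRatio_pos (hl : l ∈ Icc (0 : ℝ) 1) (x : ℝ) : 0 < K.cosRatio (x, l) :=
  (param_mem hl x).2.1

theorem sinSqOf_eq (p : ℝ × ℝ) : K.sinSqOf p = K.sinSq (K.radius p, p.2) := rfl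

theorem one_sub_sinSqOf (p : ℝ × ℝ) : 1 - K.sinSqOf p = (1 - p.2) * K.cosRatio p :=
  one_sub_mul_sinFactor _ _

theorem sinSqOf_nonneg (hl : l ∈ Icc (0 : ℝ) 1) (x : ℝ) : 0 ≤ K.sinSqOf (x, l) :=
  mul_nonneg hl.1 (sinRatio_pos hl x).le

theorem cos_mul_sqrt_sq (x y : ℝ) : (cos y * √(K.cosRatio (x, sin y ^ 2))) ^ 2 =
    1 - K.sinSqOf (x, sin y ^ 2) := by
  rw [one_sub_sinSqOf, mul_pow, sq_sqrt (cosRatio_pos (sin_sq_mem_Icc y) x).le, cos_sq']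

theorem abs_cos_mul_sqrt_le (x y : ℝ) : |cos y * √(K.cosRatio (x, sin y ^ 2))| ≤ 1 := by
  rw [← sq_le_one_iff_abs_le_one, cos_mul_sqrt_sq]
  linarith [sinSqOf_nonneg (K := K) (sin_sq_mem_Icc y) x]

/-- Squaring the prescribed cosine and using `sinSq_strictMonoOn` recovers `sin² θ⋆`. The sign of
the cosine then recovers `θ⋆`. -/
theorem toStar_radius (hy : y ∈ Icc 0 π) (x : ℝ) :
    K.toStar (K.radius (x, sin y ^ 2), arccos (cos y * √(K.cosRatio (x, sin y ^ 2)))) = (x, y) := by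
  have hl := sin_sq_mem_Icc y
  have hr := radius_mem (K := K) hl x
  have habs := abs_le.1 (abs_cos_mul_sqrt_le (K := K) x y)
  have hcos := cos_arccos habs.1 habs.2
  have hsq := cos_mul_sqrt_sq (K := K) x y
  set θ := arccos (cos y * √(K.cosRatio (x, sin y ^ 2))) with hθ
  obtain ⟨hy', hc, hrs⟩ := thetaStar_spec hr (⟨arccos_nonneg _, arccos_le_pi _⟩ : θ ∈ Icc 0 π)
  set r := K.radius (x, sin y ^ 2) with hr_def
  set y' := K.thetaStar r θ with hy'_def
  have hl' := sin_sq_mem_Icc y'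
  have h1 : K.sinSq (r, sin y' ^ 2) = K.sinSq (r, sin y ^ 2) := by
    have h2 : cos θ ^ 2 = 1 - K.sinSq (r, sin y' ^ 2) := by
      rw [hc, one_sub_sinSq, mul_pow, sq_sqrt (polarParam_spec hr hl').1.2.1.le, cos_sq']
    rw [hcos, hsq, sinSqOf_eq] at h2
    simp only [← hr_def] at h2
    linarith
  have h2 : sin y' ^ 2 = sin y ^ 2 := (sinSq_strictMonoOn hr).injOn hl' hl h1
  rw [hcos, h2] at hc
  have h3 := sqrt_pos.2 (cosRatio_pos (K := K) hl x)
  have h4 : cos y = cos y' := mul_right_cancel₀ h3.ne' hc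
  have h5 : y = y' := injOn_cos hy hy' h4
  rw [toStar]
  dsimp only
  rw [hrs, ← hy'_def, h2, tortoise_radius hl, h5]

/-- `toStar_radius` gives existence of a preimage. For whichever preimage is chosen,
`thetaStar_spec` forces `r` and then `cos θ`, so injectivity needs no separate proof. -/
theorem ofStar_eq (hy : y ∈ Icc 0 π) (x : ℝ) : K.ofStar x y =
    (K.radius (x, sin y ^ 2), arccos (cos y * √(K.cosRatio (x, sin y ^ 2)))) := by
  have hl := sin_sq_mem_Icc y
  have hex : ∃ p ∈ Ioo K.rm K.rp ×ˢ Icc 0 π, K.toStar p = (x, y) :=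
    ⟨_, ⟨radius_mem hl x, arccos_nonneg _, arccos_le_pi _⟩, toStar_radius hy x⟩
  have hmem := Function.invFunOn_mem hex
  have heq := Function.invFunOn_eq hex
  change K.ofStar x y ∈ _ at hmem
  change K.toStar (K.ofStar x y) = _ at heq
  generalize K.ofStar x y = p at hmem heq ⊢
  obtain ⟨r, θ⟩ := p
  obtain ⟨hr, hθ⟩ := hmem
  change r ∈ Ioo K.rm K.rp at hr
  change θ ∈ Icc 0 π at hθ
  obtain ⟨-, hc, hrs⟩ := thetaStar_spec hr hθ
  rw [toStar, Prod.mk.injEq] at heq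
  dsimp only at heq
  rw [heq.2] at hc hrs
  rw [heq.1] at hrs
  have h1 := radius_eq hl hr hrs.symm
  rw [cosRatio, param, h1]
  dsimp only
  rw [← hc, arccos_cos hθ.1 hθ.2]

theorem rOf_eq (hy : y ∈ Icc 0 π) (x : ℝ) : K.rOf x y = K.radius (x, sin y ^ 2) := by
  rw [rOf, ofStar_eq hy]

theorem thetaOf_eq (hy : y ∈ Icc 0 π) (x : ℝ) :
    K.thetaOf x y = arccos (cos y * √(K.cosRatio (x, sin y ^ 2))) := by
  rw [thetaOf, ofStar_eq hy]

theorem sin_thetaOf (hy : y ∈ Icc 0 π) (x : ℝ) :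
    sin (K.thetaOf x y) = sin y * √(K.sinRatio (x, sin y ^ 2)) := by
  rw [thetaOf_eq hy, sin_arccos, cos_mul_sqrt_sq, sub_sub_cancel, sinSqOf, sqrt_mul (sq_nonneg _),
    sqrt_sq (sin_nonneg_of_mem_Icc hy)]

theorem sin_sq_thetaOf (hy : y ∈ Icc 0 π) (x : ℝ) :
    sin (K.thetaOf x y) ^ 2 = K.sinSqOf (x, sin y ^ 2) := by
  rw [sin_thetaOf hy, mul_pow, sq_sqrt (sinRatio_pos (sin_sq_mem_Icc y) x).le, sinSqOf]

/-! ### Derivatives of `r` and `θ` -/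

theorem hasDerivAt_radius_fst (hl : l ∈ Icc (0 : ℝ) 1) (x : ℝ) :
    HasDerivAt (fun x => K.radius (x, l)) (K.DeltaR (K.radius (x, l))
      * (K.Xi - K.kappa * K.sinSqOf (x, l)) * K.QHat (K.radius (x, l)) l
      / K.upsilonOf (K.radius (x, l)) (K.sinSqOf (x, l))) x := by
  have hr := radius_mem (K := K) hl x
  have h1 := hasDerivAt_strip_fst (radius_contDiffOn (K := K)) (x := x) hl
  have h2 := (hasDerivAt_tortoise_fst' hr hl).comp x h1
  have h3 : HasDerivAt ((fun r => K.tortoise (r, l)) ∘ fun x => K.radius (x, l)) 1 x := by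
    refine (hasDerivAt_id x).congr_of_eventuallyEq (Eventually.of_forall fun x' => ?_)
    exact tortoise_radius hl x'
  have h4 := h2.unique h3
  refine h1.congr_deriv ?_
  have h5 := upsilonOf_pos hr hl
  have h6 := (K.deltaR_neg hr).ne
  have h7 := delta_sinSq_pos hr hl
  have h8 := K.qHat_pos (K.mem_Icc_of_mem_Ioo hr) hl.1
  rw [sinSqOf_eq]
  dsimp only
  field_simp at h4 ⊢
  linarith

theorem hasDerivAt_param_fst (hl : l ∈ Icc (0 : ℝ) 1) {x R' : ℝ}
    (hR : HasDerivAt (fun x => K.radius (x, l)) R' x) :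
    HasDerivAt (fun x => K.param (x, l))
      (-(R' / (K.QHat (K.radius (x, l)) l * K.slowness (K.param (x, l), l)))) x := by
  refine ((hasDerivAt_polarParam_fst (radius_mem hl x) hl).comp x hR).congr_deriv ?_
  rw [param]
  ring

/-- Obtained from `cos² θ = (1 - l) cosRatio`, the form that arises when the arccosine is
differentiated. The variant through `sinRatio` is the one needed at the poles. -/
theorem derivSnd_sinSqOf_eq_cosRatio (hl : l ∈ Icc (0 : ℝ) 1) (x : ℝ) :
    derivSnd K.sinSqOf (x, l) = K.cosRatio (x, l) - (1 - l) * derivSnd K.cosRatio (x, l) := by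
  have key : ∀ l, K.sinSqOf (x, l) = 1 - (1 - l) * K.cosRatio (x, l) := fun l => by
    have := one_sub_sinSqOf (K := K) (x, l)
    dsimp only at this
    linarith
  have h1 := (((hasDerivWithinAt_id l (Icc 0 1)).const_sub 1).mul
    (hasDerivWithinAt_strip_snd (cosRatio_contDiffOn (K := K)) (x := x) hl)).const_sub 1
  rw [derivSnd_unique sinSqOf_contDiffOn hl (h1.congr (fun l _ => key l) (key l))]
  simp only [id]
  ring

theorem derivSnd_sinSqOf_eq_sinRatio (hl : l ∈ Icc (0 : ℝ) 1) (x : ℝ) :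
    derivSnd K.sinSqOf (x, l) = K.sinRatio (x, l) + l * derivSnd K.sinRatio (x, l) := by
  have h1 := (hasDerivWithinAt_id l (Icc 0 1)).mul
    (hasDerivWithinAt_strip_snd (sinRatio_contDiffOn (K := K)) (x := x) hl)
  rw [derivSnd_unique sinSqOf_contDiffOn hl h1]
  simp

theorem abs_cos_mul_sqrt_lt (hy : y ∈ Ioo 0 π) (x : ℝ) :
    |cos y * √(K.cosRatio (x, sin y ^ 2))| < 1 := by
  rw [← sq_lt_one_iff_abs_lt_one, cos_mul_sqrt_sq, sinSqOf]
  have h1 := sin_pos_of_mem_Ioo hy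
  have h2 := sinRatio_pos (K := K) (sin_sq_mem_Icc y) x
  have : 0 < sin y ^ 2 * K.sinRatio (x, sin y ^ 2) := by positivity
  linarith

theorem sqrt_one_sub_sq (hy : y ∈ Icc 0 π) (x : ℝ) :
    √(1 - (cos y * √(K.cosRatio (x, sin y ^ 2))) ^ 2) = sin y * √(K.sinRatio (x, sin y ^ 2)) := by
  rw [cos_mul_sqrt_sq, sub_sub_cancel, sinSqOf, sqrt_mul (sq_nonneg _),
    sqrt_sq (sin_nonneg_of_mem_Icc hy)]

theorem hasDerivAt_rOf_snd (hy : y ∈ Ioo 0 π) (x : ℝ) :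
    HasDerivAt (fun y => K.rOf x y) (sin (2 * y) * derivSnd K.radius (x, sin y ^ 2)) y := by
  refine (hasDerivAt_strip_sin_sq radius_contDiffOn x y).congr_of_eventuallyEq ?_
  filter_upwards [isOpen_Ioo.mem_nhds hy] with y' hy'
  exact rOf_eq (Ioo_subset_Icc_self hy') x

/-- The factor `sin y` of `sin θ` cancels against that of the derivative of `cos θ`. The result has
no zero in its denominator, even at the equator. -/
theorem hasDerivAt_thetaOf_snd (hy : y ∈ Ioo 0 π) (x : ℝ) :
    HasDerivAt (fun y => K.thetaOf x y) (derivSnd K.sinSqOf (x, sin y ^ 2)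
      / (√(K.sinRatio (x, sin y ^ 2)) * √(K.cosRatio (x, sin y ^ 2)))) y := by
  have hl := sin_sq_mem_Icc y
  have hc := cosRatio_pos (K := K) hl x
  have hs := sqrt_pos.2 (sinRatio_pos (K := K) hl x)
  have hc' := sqrt_pos.2 hc
  have hsin := sin_pos_of_mem_Ioo hy
  have habs := abs_lt.1 (abs_cos_mul_sqrt_lt (K := K) hy x)
  have h1 := (hasDerivAt_cos y).mul
    ((hasDerivAt_strip_sin_sq (cosRatio_contDiffOn (K := K)) x y).sqrt hc.ne')
  have h2 := (hasDerivAt_arccos habs.1.ne' habs.2.ne).comp y h1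
  refine (h2.congr_of_eventuallyEq ?_).congr_deriv ?_
  · filter_upwards [isOpen_Ioo.mem_nhds hy] with y' hy'
    exact thetaOf_eq (Ioo_subset_Icc_self hy') x
  · rw [sqrt_one_sub_sq (Ioo_subset_Icc_self hy), derivSnd_sinSqOf_eq_cosRatio hl, sin_two_mul,
      ← cos_sq']
    have h3 := sq_sqrt hc.le
    field_simp
    rw [h3]
    ring

theorem hasDerivAt_rOf_fst (hy : y ∈ Icc 0 π) {R' : ℝ}
    (hR : HasDerivAt (fun x => K.radius (x, sin y ^ 2)) R' x) :
    HasDerivAt (fun x => K.rOf x y) R' x := by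
  simpa only [rOf_eq hy] using hR

variable (K) in
/-- `P̂`, with the sign of `cos θ⋆`. -/
def signedP (x y : ℝ) : ℝ :=
  |K.a| * (sin y * cos y * √(K.polarFactor (K.param (x, sin y ^ 2)) (sin y ^ 2)))

theorem slowness_param (hl : l ∈ Icc (0 : ℝ) 1) (x : ℝ) : K.slowness (K.param (x, l), l) =
    1 / (2 * |K.a| * (√(K.sinRatio (x, l)) * √(K.cosRatio (x, l))
      * √(K.polarFactor (K.param (x, l)) l))) := by
  obtain ⟨h1, h2, h3⟩ := param_mem (K := K) hl x
  rw [slowness, cubic]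
  dsimp only at *
  rw [sqrt_mul (mul_nonneg h1.le h2.le), sqrt_mul h1.le]
  rfl

/-- At fixed `θ⋆` the defining equation gives `dθ / P̂ = dr / Q̂`, with the sign of `P̂` following
the hemisphere. -/
theorem hasDerivAt_thetaOf_fst (hy : y ∈ Ioo 0 π) {R' : ℝ}
    (hR : HasDerivAt (fun x => K.radius (x, sin y ^ 2)) R' x) :
    HasDerivAt (fun x => K.thetaOf x y)
      (K.signedP x y * R' / K.QHat (K.radius (x, sin y ^ 2)) (sin y ^ 2)) x := by
  have hl := sin_sq_mem_Icc y
  have hy' := Ioo_subset_Icc_self hy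
  have hc := cosRatio_pos (K := K) hl x
  have hs := sqrt_pos.2 (sinRatio_pos (K := K) hl x)
  have hc' := sqrt_pos.2 hc
  have hp := sqrt_pos.2 (param_mem (K := K) hl x).2.2
  have hsin := sin_pos_of_mem_Ioo hy
  have ha := K.abs_a_pos
  have hQ := K.qHat_pos (K.mem_Icc_of_mem_Ioo (radius_mem (K := K) hl x)) hl.1
  have habs := abs_lt.1 (abs_cos_mul_sqrt_lt (K := K) hy x)
  have h0 : HasDerivAt (fun x => K.cosRatio (x, sin y ^ 2)) _ x :=
    ((hasDerivAt_param_fst hl hR).const_mul (sin y ^ 2)).const_add 1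
  have h1 := (h0.sqrt hc.ne').const_mul (cos y)
  have h2 := (hasDerivAt_arccos habs.1.ne' habs.2.ne).comp x h1
  refine (h2.congr_of_eventuallyEq ?_).congr_deriv ?_
  · exact Eventually.of_forall fun x' => thetaOf_eq hy' x'
  · rw [sqrt_one_sub_sq hy', slowness_param hl, signedP]
    dsimp only at hp
    field_simp

theorem signedP_sq (x y : ℝ) : K.signedP x y ^ 2 = K.a ^ 2 *
    (sin y ^ 2 * (K.Xi - K.kappa * K.sinSqOf (x, sin y ^ 2)) - K.sinSqOf (x, sin y ^ 2)) := by
  have h := K.pHatSq_eq (K.param (x, sin y ^ 2)) (sin y ^ 2)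
  have h2 := (param_mem (K := K) (sin_sq_mem_Icc y) x).2.2
  have h3 : K.sinSqOf (x, sin y ^ 2)
    = sin y ^ 2 * sinFactor (K.param (x, sin y ^ 2)) (sin y ^ 2) := rfl
  rw [signedP, mul_pow, sq_abs, mul_pow, mul_pow, sq_sqrt h2.le, h3, cos_sq']
  dsimp only
  rw [← h, polarDelta]

/-- The differential of `r⋆` vanishes on `∂_{θ⋆}`. -/
theorem tortoise_differential (x y : ℝ) :
    K.QHat (K.radius (x, sin y ^ 2)) (sin y ^ 2) / K.DeltaR (K.radius (x, sin y ^ 2))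
        * (sin (2 * y) * derivSnd K.radius (x, sin y ^ 2))
      + K.signedP x y / (K.Xi - K.kappa * K.sinSqOf (x, sin y ^ 2))
        * (derivSnd K.sinSqOf (x, sin y ^ 2)
          / (√(K.sinRatio (x, sin y ^ 2)) * √(K.cosRatio (x, sin y ^ 2)))) = 0 := by
  have hl := sin_sq_mem_Icc y
  have hr := radius_mem (K := K) hl x
  have hs : HasDerivAt (fun l => K.sinSq (K.radius (x, sin y ^ 2), l)) _ (sin y ^ 2) :=
    (((sinSq_contDiffAt hr hl).comp (sin y ^ 2)
      (f := fun l : ℝ => (K.radius (x, sin y ^ 2), l))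
      (by fun_prop)).differentiableAt (by simp)).hasDerivAt
  have hR := hasDerivAt_strip_sin_sq (radius_contDiffOn (K := K)) x y
  have h1 := hasDerivAt_comp_pair (u := fun y => K.radius (x, sin y ^ 2)) (v := fun y => sin y ^ 2)
    ((tortoise_contDiffAt hr hl).differentiableAt (by simp)) (hasDerivAt_tortoise_fst hr hl)
    (hasDerivAt_tortoise_snd hr hl hs) hR (hasDerivAt_sin_sq y)
  have h2 := hasDerivAt_comp_pair (u := fun y => K.radius (x, sin y ^ 2)) (v := fun y => sin y ^ 2)
    ((sinSq_contDiffAt hr hl).differentiableAt (by simp)) (hasDerivAt_sinSq_fst hr hl)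
    hs hR (hasDerivAt_sin_sq y)
  -- `r⋆` is constant along this curve. Eliminating the `l`-derivative of `sin² θ` with `h4` leaves
  -- a linear relation between the `θ⋆`-derivatives of `r` and of `sin² θ`.
  have h3 := h1.unique ((hasDerivAt_const y x).congr_of_eventuallyEq
    (Eventually.of_forall fun y' => tortoise_radius (sin_sq_mem_Icc y') x))
  have h4 := h2.unique (hasDerivAt_strip_sin_sq (sinSqOf_contDiffOn (K := K)) x y)
  have h5 : K.QHat (K.radius (x, sin y ^ 2)) (sin y ^ 2) / K.DeltaR (K.radius (x, sin y ^ 2))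
        * (sin (2 * y) * derivSnd K.radius (x, sin y ^ 2))
      + K.polarWeight (K.param (x, sin y ^ 2), sin y ^ 2)
        * (sin (2 * y) * derivSnd K.sinSqOf (x, sin y ^ 2)) = 0 := by
    rw [← h4, ← h3]
    simp only [param]
    ring
  rw [← h5]
  congr 1
  have hs := sqrt_pos.2 (sinRatio_pos (K := K) hl x)
  have hc := sqrt_pos.2 (cosRatio_pos (K := K) hl x)
  have hp := (param_mem (K := K) hl x).2.2
  have hp' := sqrt_pos.2 hp
  have ha := K.abs_a_pos
  have hD : 0 < K.Xi - K.kappa * K.sinSqOf (x, sin y ^ 2) := delta_sinSq_pos hr hl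
  have hD' : K.polarDelta (K.param (x, sin y ^ 2)) (sin y ^ 2) =
    K.Xi - K.kappa * K.sinSqOf (x, sin y ^ 2) := rfl
  have hpp := sq_sqrt hp.le
  rw [polarWeight]
  dsimp only at *
  rw [slowness_param hl, hD', signedP, sin_two_mul, ← sq_abs K.a]
  nth_rewrite 2 [← hpp]
  field_simp

end KNdS

namespace KNdS

variable {K : KNdS} {r l θ x y : ℝ}

/-! ### The function `h` -/

variable (K) in
/-- A primitive of `-B` along the curves of constant `l`, as a function of `r` and `l`. -/
def twist (p : ℝ × ℝ) : ℝ :=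
  -(K.Xi * K.a) * ((∫ t in K.r0..p.1, (t ^ 2 + K.a ^ 2) / (K.DeltaR t * K.QHat t p.2))
    + K.polarTwist (K.polarParam p, p.2))

theorem twist_integrand (hr : r ∈ Ioo K.rm K.rp) (hl : 0 ≤ l) :
    ContDiffAt ℝ ∞ (fun p : ℝ × ℝ => (p.1 ^ 2 + K.a ^ 2) / (K.DeltaR p.1 * K.QHat p.1 p.2))
      (r, l) := by
  have hr' := K.mem_Icc_of_mem_Ioo hr
  have h1 := K.deltaR_contDiff
  have h2 := K.qHat_contDiffAt hr' hl
  exact ContDiffAt.div (by fun_prop) (by fun_prop)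
    (mul_ne_zero (K.deltaR_neg hr).ne (K.qHat_pos hr' hl).ne')

theorem twist_contDiffAt (hr : r ∈ Ioo K.rm K.rp) (hl : l ∈ Icc (0 : ℝ) 1) :
    ContDiffAt ℝ ∞ K.twist (r, l) := by
  refine contDiffAt_const.mul ((contDiffAt_primitive
    (p := fun p : ℝ × ℝ => (p.1 ^ 2 + K.a ^ 2) / (K.DeltaR p.1 * K.QHat p.1 p.2)) fun t ht =>
      twist_integrand (K.mem_Ioo_of_mem_uIcc_r0 hr ht) hl.1).add ?_)
  exact ContDiffAt.comp (r, l) (f := fun p : ℝ × ℝ => (K.polarParam p, p.2))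
    (polarTwist_contDiffAt (polarParam_spec hr hl).1 hl)
    ((polarParam_contDiffAt hr hl).prodMk contDiffAt_snd)

/-- Multiplied by `∂_{r⋆} r = Δ_r Δ_θ Q̂ / Υ`, this becomes `-B`. The term `-Δ_r` in the numerator
comes from `polarTwist`. -/
theorem hasDerivAt_twist_fst (hr : r ∈ Ioo K.rm K.rp) (hl : l ∈ Icc (0 : ℝ) 1) :
    HasDerivAt (fun r => K.twist (r, l)) (-(K.Xi * K.a)
      * ((r ^ 2 + K.a ^ 2) * (K.Xi - K.kappa * K.sinSq (r, l)) - K.DeltaR r)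
      / (K.DeltaR r * (K.Xi - K.kappa * K.sinSq (r, l)) * K.QHat r l)) r := by
  have hq := (polarParam_spec hr hl).1
  refine (((hasDerivAt_primitive_fst
    (p := fun p : ℝ × ℝ => (p.1 ^ 2 + K.a ^ 2) / (K.DeltaR p.1 * K.QHat p.1 p.2)) fun t ht =>
      twist_integrand (K.mem_Ioo_of_mem_uIcc_r0 hr ht) hl.1).add
      ((hasDerivAt_polarTwist hq hl).comp r (hasDerivAt_polarParam_fst hr hl))).const_mul
      (-(K.Xi * K.a))).congr_deriv ?_
  have h1 := slowness_pos hq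
  have h2 := K.qHat_pos (K.mem_Icc_of_mem_Ioo hr) hl.1
  have h3 := (K.deltaR_neg hr).ne
  have h4 := delta_sinSq_pos hr hl
  have h5 : K.polarDelta (K.polarParam (r, l)) l = K.Xi - K.kappa * K.sinSq (r, l) := rfl
  rw [h5]
  field_simp
  ring

variable (K) in
/-- `h` as a function of `r⋆` and `l`. -/
def twistOf (p : ℝ × ℝ) : ℝ := K.twist (K.radius p, p.2) - K.twist (K.radius (0, p.2), p.2)

theorem twistOf_contDiffOn : ContDiffOn ℝ ∞ K.twistOf strip := by
  have h := contDiffOn_comp_radius (K := K) fun _ hr _ hl => twist_contDiffAt hr hl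
  exact h.sub (h.comp (f := fun p : ℝ × ℝ => ((0 : ℝ), p.2)) (by fun_prop)
    fun p hp => mem_strip hp.2)

variable (K) in
/-- `Δ_r` as a function of `r⋆` and `l`. -/
def deltaROf (p : ℝ × ℝ) : ℝ := K.DeltaR (K.radius p)

variable (K) in
/-- `Δ_θ` as a function of `r⋆` and `l`. -/
def deltaThetaOf (p : ℝ × ℝ) : ℝ := K.Xi - K.kappa * K.sinSqOf p

variable (K) in
/-- `ρ²` as a function of `r⋆` and `l`. -/
def rhoSqOf (p : ℝ × ℝ) : ℝ := K.radius p ^ 2 + K.a ^ 2 * (1 - K.sinSqOf p)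

variable (K) in
/-- `Υ` as a function of `r⋆` and `l`. -/
def upsilonStar (p : ℝ × ℝ) : ℝ :=
  (K.radius p ^ 2 + K.a ^ 2) ^ 2 * K.deltaThetaOf p - K.a ^ 2 * K.sinSqOf p * K.deltaROf p

variable (K) in
/-- `B` as a function of `r⋆` and `l`. -/
def bOf (p : ℝ × ℝ) : ℝ :=
  K.Xi * K.a * ((K.radius p ^ 2 + K.a ^ 2) * K.deltaThetaOf p - K.deltaROf p) / K.upsilonStar p

variable (K) in
/-- The component `g_{φφ} / sin² θ` as a function of `r⋆` and `l`. -/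
def gPhiOf (p : ℝ × ℝ) : ℝ := K.upsilonStar p / (K.Xi ^ 2 * K.rhoSqOf p)

theorem deltaROf_neg {p : ℝ × ℝ} (hp : p ∈ strip) : K.deltaROf p < 0 :=
  K.deltaR_neg (radius_mem hp.2 p.1)

theorem deltaThetaOf_pos {p : ℝ × ℝ} (hp : p ∈ strip) : 0 < K.deltaThetaOf p :=
  delta_sinSq_pos (radius_mem hp.2 p.1) hp.2

theorem upsilonStar_pos {p : ℝ × ℝ} (hp : p ∈ strip) : 0 < K.upsilonStar p :=
  upsilonOf_pos (radius_mem hp.2 p.1) hp.2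

theorem rhoSqOf_pos {p : ℝ × ℝ} (hp : p ∈ strip) : 0 < K.rhoSqOf p := by
  have h1 := pow_pos (K.r_pos (K.mem_Icc_of_mem_Ioo (radius_mem (K := K) hp.2 p.1))) 2
  have h2 := mul_nonneg K.a_sq_pos.le (mul_nonneg (sub_nonneg.2 hp.2.2)
    (cosRatio_pos (K := K) hp.2 p.1).le)
  rw [rhoSqOf, one_sub_sinSqOf]
  exact add_pos_of_pos_of_nonneg h1 h2

theorem deltaROf_contDiffOn : ContDiffOn ℝ ∞ K.deltaROf strip :=
  K.deltaR_contDiff.comp_contDiffOn radius_contDiffOn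

theorem deltaThetaOf_contDiffOn : ContDiffOn ℝ ∞ K.deltaThetaOf strip :=
  contDiffOn_const.sub (contDiffOn_const.mul sinSqOf_contDiffOn)

theorem rhoSqOf_contDiffOn : ContDiffOn ℝ ∞ K.rhoSqOf strip :=
  (radius_contDiffOn.pow 2).add (contDiffOn_const.mul (contDiffOn_const.sub sinSqOf_contDiffOn))

theorem upsilonStar_contDiffOn : ContDiffOn ℝ ∞ K.upsilonStar strip :=
  ((((radius_contDiffOn.pow 2).add contDiffOn_const).pow 2).mul deltaThetaOf_contDiffOn).sub
    ((contDiffOn_const.mul sinSqOf_contDiffOn).mul deltaROf_contDiffOn)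

theorem bOf_contDiffOn : ContDiffOn ℝ ∞ K.bOf strip :=
  (contDiffOn_const.mul ((((radius_contDiffOn.pow 2).add contDiffOn_const).mul
    deltaThetaOf_contDiffOn).sub deltaROf_contDiffOn)).div upsilonStar_contDiffOn
    fun _ hp => (upsilonStar_pos hp).ne'

theorem gPhiOf_contDiffOn : ContDiffOn ℝ ∞ K.gPhiOf strip :=
  upsilonStar_contDiffOn.div (contDiffOn_const.mul rhoSqOf_contDiffOn) fun _ hp =>
    mul_ne_zero (pow_ne_zero 2 K.xi_pos.ne') (rhoSqOf_pos hp).ne'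

theorem deltaTheta_thetaOf (hy : y ∈ Icc 0 π) (x : ℝ) :
    K.DeltaTheta (K.thetaOf x y) = K.deltaThetaOf (x, sin y ^ 2) := by
  rw [deltaTheta_eq, sin_sq_thetaOf hy, deltaThetaOf]

theorem deltaR_rOf (hy : y ∈ Icc 0 π) (x : ℝ) :
    K.DeltaR (K.rOf x y) = K.deltaROf (x, sin y ^ 2) := by
  rw [rOf_eq hy, deltaROf]

theorem rhoSq_rOf (hy : y ∈ Icc 0 π) (x : ℝ) :
    K.rhoSq (K.rOf x y) (K.thetaOf x y) = K.rhoSqOf (x, sin y ^ 2) := by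
  rw [rhoSq, rOf_eq hy, cos_sq', sin_sq_thetaOf hy, rhoSqOf]

theorem upsilon_rOf (hy : y ∈ Icc 0 π) (x : ℝ) :
    K.Upsilon (K.rOf x y) (K.thetaOf x y) = K.upsilonStar (x, sin y ^ 2) := by
  rw [Upsilon, deltaTheta_thetaOf hy, deltaR_rOf hy, rOf_eq hy, sin_sq_thetaOf hy, upsilonStar]

theorem B_rOf (hy : y ∈ Icc 0 π) (x : ℝ) :
    K.B (K.rOf x y) (K.thetaOf x y) = K.bOf (x, sin y ^ 2) := by
  rw [B, upsilon_rOf hy, deltaTheta_thetaOf hy, deltaR_rOf hy, rOf_eq hy, bOf]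

theorem hasDerivAt_twistOf_fst (hl : l ∈ Icc (0 : ℝ) 1) (x : ℝ) :
    HasDerivAt (fun x => K.twistOf (x, l)) (-K.bOf (x, l)) x := by
  have hr := radius_mem (K := K) hl x
  have h0 := HasDerivAt.comp (h₂ := fun r => K.twist (r, l)) (h := fun x => K.radius (x, l)) x
    (hasDerivAt_twist_fst hr hl) (hasDerivAt_radius_fst hl x)
  refine (h0.sub_const (K.twist (K.radius (0, l), l))).congr_deriv ?_
  have h1 := deltaROf_neg (K := K) (mem_strip (x := x) hl)
  have h2 := deltaThetaOf_pos (K := K) (mem_strip (x := x) hl)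
  have h3 := K.qHat_pos (K.mem_Icc_of_mem_Ioo hr) hl.1
  have h4 := upsilonStar_pos (K := K) (mem_strip (x := x) hl)
  have e1 : K.DeltaR (K.radius (x, l)) = K.deltaROf (x, l) := rfl
  have e2 : K.Xi - K.kappa * K.sinSqOf (x, l) = K.deltaThetaOf (x, l) := rfl
  have e3 : K.upsilonOf (K.radius (x, l)) (K.sinSqOf (x, l)) = K.upsilonStar (x, l) := rfl
  have e4 : K.sinSq (K.radius (x, l), l) = K.sinSqOf (x, l) := rfl
  rw [e4, e1, e2, e3, bOf]
  have := h1.ne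
  field_simp

theorem h_eq (hy : y ∈ Icc 0 π) (x : ℝ) : K.h x y = K.twistOf (x, sin y ^ 2) := by
  have hl := sin_sq_mem_Icc y
  have hc : Continuous fun x => K.bOf (x, sin y ^ 2) := by
    rw [← continuousOn_univ]
    exact bOf_contDiffOn.continuousOn.comp (by fun_prop) fun x _ => mem_strip hl
  have h1 := intervalIntegral.integral_eq_sub_of_hasDerivAt (a := 0) (b := x)
    (fun t _ => hasDerivAt_twistOf_fst (K := K) hl t) (hc.neg.intervalIntegrable _ _)
  have h2 : K.twistOf (0, sin y ^ 2) = 0 := by simp [twistOf]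
  rw [h2, sub_zero] at h1
  rw [h, ← h1]
  simp only [B_rOf hy]

theorem hasDerivAt_h_fst (hy : y ∈ Icc 0 π) (x : ℝ) :
    HasDerivAt (fun x => K.h x y) (-K.bOf (x, sin y ^ 2)) x := by
  simpa only [h_eq hy] using hasDerivAt_twistOf_fst (K := K) (sin_sq_mem_Icc y) x

theorem hasDerivAt_h_snd (hy : y ∈ Ioo 0 π) (x : ℝ) :
    HasDerivAt (fun y => K.h x y) (sin (2 * y) * derivSnd K.twistOf (x, sin y ^ 2)) y := by
  refine (hasDerivAt_strip_sin_sq twistOf_contDiffOn x y).congr_of_eventuallyEq ?_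
  filter_upwards [isOpen_Ioo.mem_nhds hy] with y' hy'
  exact h_eq (Ioo_subset_Icc_self hy') x

/-! ### The metric -/

/-- The metric after completing the square in `dφ`. -/
theorem metricBL_eq (hy : y ∈ Icc 0 π) (x : ℝ) (X Y : Fin 4 → ℝ) :
    K.metricBL (K.rOf x y) (K.thetaOf x y) X Y =
      K.OmegaSq x y * (X 0 * Y 0)
      + K.rhoSqOf (x, sin y ^ 2) / K.deltaROf (x, sin y ^ 2) * (X 1 * Y 1)
      + K.rhoSqOf (x, sin y ^ 2) / K.deltaThetaOf (x, sin y ^ 2) * (X 2 * Y 2)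
      + K.sinSqOf (x, sin y ^ 2) * K.gPhiOf (x, sin y ^ 2)
        * ((X 3 - K.bOf (x, sin y ^ 2) * X 0) * (Y 3 - K.bOf (x, sin y ^ 2) * Y 0)) := by
  have hp : (x, sin y ^ 2) ∈ strip := mem_strip (sin_sq_mem_Icc y)
  have hU := (upsilonStar_pos (K := K) hp).ne'
  have hρ := (rhoSqOf_pos (K := K) hp).ne'
  have hX := K.xi_pos.ne'
  have hρe : K.rhoSqOf (x, sin y ^ 2) = K.radius (x, sin y ^ 2) ^ 2
    + K.a ^ 2 * (1 - K.sinSqOf (x, sin y ^ 2)) := rfl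
  have hUe : K.upsilonStar (x, sin y ^ 2) = (K.radius (x, sin y ^ 2) ^ 2 + K.a ^ 2) ^ 2
    * K.deltaThetaOf (x, sin y ^ 2)
    - K.a ^ 2 * K.sinSqOf (x, sin y ^ 2) * K.deltaROf (x, sin y ^ 2) := rfl
  have hb : K.bOf (x, sin y ^ 2) = K.Xi * K.a * ((K.radius (x, sin y ^ 2) ^ 2 + K.a ^ 2)
    * K.deltaThetaOf (x, sin y ^ 2) - K.deltaROf (x, sin y ^ 2))
      / K.upsilonStar (x, sin y ^ 2) := rfl
  have hg : K.gPhiOf (x, sin y ^ 2) = K.upsilonStar (x, sin y ^ 2)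
    / (K.Xi ^ 2 * K.rhoSqOf (x, sin y ^ 2)) := rfl
  have hφφ : K.gphiphi (K.rOf x y) (K.thetaOf x y) =
      K.sinSqOf (x, sin y ^ 2) * K.gPhiOf (x, sin y ^ 2) := by
    rw [gphiphi, rhoSq_rOf hy, deltaTheta_thetaOf hy, deltaR_rOf hy, rOf_eq hy, sin_sq_thetaOf hy,
      ← hUe, hg]
    ring
  have htφ : K.gtphi (K.rOf x y) (K.thetaOf x y) =
      -(K.sinSqOf (x, sin y ^ 2) * K.gPhiOf (x, sin y ^ 2) * K.bOf (x, sin y ^ 2)) := by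
    rw [gtphi, rhoSq_rOf hy, deltaTheta_thetaOf hy, deltaR_rOf hy, rOf_eq hy, sin_sq_thetaOf hy,
      hg, hb]
    field_simp
  have htt : K.gtt (K.rOf x y) (K.thetaOf x y) = K.OmegaSq x y
      + K.sinSqOf (x, sin y ^ 2) * K.gPhiOf (x, sin y ^ 2) * K.bOf (x, sin y ^ 2) ^ 2 := by
    rw [gtt, OmegaSq, upsilon_rOf hy, rhoSq_rOf hy, deltaTheta_thetaOf hy, deltaR_rOf hy,
      sin_sq_thetaOf hy, hg, hb]
    field_simp
    rw [hUe, hρe]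
    ring
  rw [metricBL, hφφ, htφ, htt, rhoSq_rOf hy, deltaTheta_thetaOf hy, deltaR_rOf hy]
  ring

variable (K) in
/-- `∂_{θ⋆} θ` -/
def thetaDeriv (x y : ℝ) : ℝ := derivSnd K.sinSqOf (x, sin y ^ 2)
  / (√(K.sinRatio (x, sin y ^ 2)) * √(K.cosRatio (x, sin y ^ 2)))

variable (K) in
/-- `∂_{r⋆} r` -/
def radiusDeriv (p : ℝ × ℝ) : ℝ :=
  K.deltaROf p * K.deltaThetaOf p * K.QHat (K.radius p) p.2 / K.upsilonStar p

theorem push_eq (hy : y ∈ Ioo 0 π) (x : ℝ) (V : Fin 4 → ℝ) :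
    K.push x y V = ![V 1 - V 0,
      K.radiusDeriv (x, sin y ^ 2) * (V 0 + V 1)
        + sin (2 * y) * derivSnd K.radius (x, sin y ^ 2) * V 2,
      K.signedP x y * K.radiusDeriv (x, sin y ^ 2)
        / K.QHat (K.radius (x, sin y ^ 2)) (sin y ^ 2) * (V 0 + V 1) + K.thetaDeriv x y * V 2,
      -K.bOf (x, sin y ^ 2) * (V 0 + V 1)
        + sin (2 * y) * derivSnd K.twistOf (x, sin y ^ 2) * V 2 + V 3] := by
  have hy' := Ioo_subset_Icc_self hy
  have hR : HasDerivAt (fun x => K.radius (x, sin y ^ 2)) (K.radiusDeriv (x, sin y ^ 2)) x :=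
    hasDerivAt_radius_fst (sin_sq_mem_Icc y) x
  rw [push, (hasDerivAt_rOf_fst hy' hR).deriv, (hasDerivAt_rOf_snd hy x).deriv,
    (hasDerivAt_thetaOf_fst hy hR).deriv, (hasDerivAt_thetaOf_snd hy x).deriv,
    (hasDerivAt_h_fst hy' x).deriv, (hasDerivAt_h_snd hy x).deriv, thetaDeriv]

theorem metric_eq (hy : y ∈ Ioo 0 π) (x : ℝ) (V W : Fin 4 → ℝ) :
    K.metric x y V W = -2 * K.OmegaSq x y * (V 0 * W 1 + V 1 * W 0)
      + (K.rhoSqOf (x, sin y ^ 2) / K.deltaROf (x, sin y ^ 2)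
          * (sin (2 * y) * derivSnd K.radius (x, sin y ^ 2)) ^ 2
        + K.rhoSqOf (x, sin y ^ 2) / K.deltaThetaOf (x, sin y ^ 2) * K.thetaDeriv x y ^ 2)
          * (V 2 * W 2)
      + K.sinSqOf (x, sin y ^ 2) * K.gPhiOf (x, sin y ^ 2)
        * ((V 3 - K.b x y * V 1 + sin (2 * y) * derivSnd K.twistOf (x, sin y ^ 2) * V 2)
          * (W 3 - K.b x y * W 1 + sin (2 * y) * derivSnd K.twistOf (x, sin y ^ 2) * W 2)) := by
  have hy' := Ioo_subset_Icc_self hy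
  have hl := sin_sq_mem_Icc y
  have hp : (x, sin y ^ 2) ∈ strip := mem_strip hl
  have hr := K.mem_Icc_of_mem_Ioo (radius_mem (K := K) hl x)
  have hQ := K.qHat_pos hr hl.1
  have hU := upsilonStar_pos (K := K) hp
  have hΔ := (deltaROf_neg (K := K) hp).ne
  have hD := deltaThetaOf_pos (K := K) hp
  have h1 := K.qHat_sq hr hl.1
  have h2 := signedP_sq (K := K) x y
  have h3 := tortoise_differential (K := K) x y
  have hO : K.OmegaSq x y = -(K.rhoSqOf (x, sin y ^ 2) * K.deltaROf (x, sin y ^ 2)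
      * K.deltaThetaOf (x, sin y ^ 2) / K.upsilonStar (x, sin y ^ 2)) := by
    rw [OmegaSq, upsilon_rOf hy', rhoSq_rOf hy', deltaTheta_thetaOf hy', deltaR_rOf hy']
  have hb : K.b x y = 2 * K.bOf (x, sin y ^ 2) := by rw [b, B_rOf hy']
  have hUe : K.upsilonStar (x, sin y ^ 2) =
    K.QHat (K.radius (x, sin y ^ 2)) (sin y ^ 2) ^ 2 * K.deltaThetaOf (x, sin y ^ 2)
      + K.signedP x y ^ 2 * K.deltaROf (x, sin y ^ 2) := by
    rw [h1, h2]
    simp only [upsilonStar, deltaThetaOf, deltaROf]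
    ring
  have hR : K.radiusDeriv (x, sin y ^ 2) = K.deltaROf (x, sin y ^ 2) * K.deltaThetaOf (x, sin y ^ 2)
    * K.QHat (K.radius (x, sin y ^ 2)) (sin y ^ 2) / K.upsilonStar (x, sin y ^ 2) := rfl
  change K.QHat (K.radius (x, sin y ^ 2)) (sin y ^ 2) / K.deltaROf (x, sin y ^ 2)
        * (sin (2 * y) * derivSnd K.radius (x, sin y ^ 2))
      + K.signedP x y / K.deltaThetaOf (x, sin y ^ 2) * K.thetaDeriv x y = 0 at h3
  rw [metric, metricBL_eq hy', push_eq hy, push_eq hy, hb]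
  simp only [Matrix.cons_val]
  generalize K.thetaDeriv x y = Ty at *
  generalize sin (2 * y) * derivSnd K.radius (x, sin y ^ 2) = Ry at *
  generalize sin (2 * y) * derivSnd K.twistOf (x, sin y ^ 2) = Hy at *
  generalize K.QHat (K.radius (x, sin y ^ 2)) (sin y ^ 2) = Q at *
  generalize K.signedP x y = P at *
  generalize K.radiusDeriv (x, sin y ^ 2) = R at *
  generalize K.deltaROf (x, sin y ^ 2) = Δ at *
  generalize K.deltaThetaOf (x, sin y ^ 2) = D at *
  generalize K.upsilonStar (x, sin y ^ 2) = U at *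
  generalize K.rhoSqOf (x, sin y ^ 2) = ρ at *
  generalize K.bOf (x, sin y ^ 2) = B at *
  generalize K.sinSqOf (x, sin y ^ 2) * K.gPhiOf (x, sin y ^ 2) = g at *
  -- The squared length of `∂_{r⋆}` in the `(r, θ)` block. Together with the `dt²` term it produces
  -- the double null form.
  have e1 : ρ / Δ * R ^ 2 + ρ / D * (P * R / Q) ^ 2 = -K.OmegaSq x y := by
    rw [hO, hR]
    field_simp
    rw [hUe]
    ring
  -- Orthogonality of `∂_{r⋆}` and `∂_{θ⋆}` in the `(r, θ)` block: the gradient of `r⋆` there is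
  -- proportional to `∂_{r⋆}`, and `dr⋆` vanishes on `∂_{θ⋆}`.
  have e2 : ρ / Δ * (R * Ry) + ρ / D * (P * R / Q * Ty) = 0 := by
    have : ρ / Δ * (R * Ry) + ρ / D * (P * R / Q * Ty) =
        ρ * R / Q * (Q / Δ * Ry + P / D * Ty) := by
      field_simp
    rw [this, h3, mul_zero]
  linear_combination (V 0 + V 1) * (W 0 + W 1) * e1
    + ((V 0 + V 1) * W 2 + V 2 * (W 0 + W 1)) * e2

theorem gammaThetaTheta_eq (hy : y ∈ Ioo 0 π) (x : ℝ) : K.gammaThetaTheta x y =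
    K.rhoSqOf (x, sin y ^ 2) / K.deltaROf (x, sin y ^ 2)
          * (sin (2 * y) * derivSnd K.radius (x, sin y ^ 2)) ^ 2
      + K.rhoSqOf (x, sin y ^ 2) / K.deltaThetaOf (x, sin y ^ 2) * K.thetaDeriv x y ^ 2
      + K.sinSqOf (x, sin y ^ 2) * K.gPhiOf (x, sin y ^ 2)
        * (sin (2 * y) * derivSnd K.twistOf (x, sin y ^ 2)) ^ 2 := by
  rw [gammaThetaTheta, metric_eq hy]
  simp only [Matrix.cons_val]
  ring

theorem gammaThetaPhi_eq (hy : y ∈ Ioo 0 π) (x : ℝ) : K.gammaThetaPhi x y =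
    K.sinSqOf (x, sin y ^ 2) * K.gPhiOf (x, sin y ^ 2)
      * (sin (2 * y) * derivSnd K.twistOf (x, sin y ^ 2)) := by
  rw [gammaThetaPhi, metric_eq hy]
  simp only [Matrix.cons_val]
  ring

theorem gammaPhiPhi_eq (hy : y ∈ Ioo 0 π) (x : ℝ) : K.gammaPhiPhi x y =
    K.sinSqOf (x, sin y ^ 2) * K.gPhiOf (x, sin y ^ 2) := by
  rw [gammaPhiPhi, metric_eq hy]
  simp only [Matrix.cons_val]
  ring

/-- The double null form of the metric. -/
theorem metric_doubleNull (hy : y ∈ Ioo 0 π) (x : ℝ) (V W : Fin 4 → ℝ) :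
    K.metric x y V W = -2 * K.OmegaSq x y * (V 0 * W 1 + V 1 * W 0)
      + K.gammaThetaTheta x y * (V 2 * W 2)
      + K.gammaThetaPhi x y * (V 2 * (W 3 - K.b x y * W 1))
      + K.gammaThetaPhi x y * ((V 3 - K.b x y * V 1) * W 2)
      + K.gammaPhiPhi x y * ((V 3 - K.b x y * V 1) * (W 3 - K.b x y * W 1)) := by
  rw [metric_eq hy, gammaThetaTheta_eq hy, gammaThetaPhi_eq hy, gammaPhiPhi_eq hy]
  ring

/-! ### Smoothness of the metric components -/

variable (K) in
/-- `(∂_{θ⋆} θ)²` as a function of `r⋆` and `l`. -/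
def thetaDerivSq (p : ℝ × ℝ) : ℝ := derivSnd K.sinSqOf p ^ 2 / (K.sinRatio p * K.cosRatio p)

variable (K) in
/-- The contribution to `γ_{θ⋆θ⋆}` that vanishes at the poles and at the equator. -/
def axisTerm (p : ℝ × ℝ) : ℝ :=
  4 * (1 - p.2) * (K.rhoSqOf p / K.deltaROf p * derivSnd K.radius p ^ 2
    + K.sinSqOf p * K.gPhiOf p * derivSnd K.twistOf p ^ 2)

variable (K) in
/-- `γ_{θ⋆θ⋆}` as a function of `r⋆` and `l`. -/
def gammaThetaThetaOf (p : ℝ × ℝ) : ℝ :=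
  p.2 * K.axisTerm p + K.rhoSqOf p / K.deltaThetaOf p * K.thetaDerivSq p

variable (K) in
/-- The difference quotient at `l = 0` of the part of `γ_{θ⋆θ⋆} - γ_{φ⋆φ⋆} / sin² θ⋆` that does not
involve derivatives. -/
def defect (p : ℝ × ℝ) : ℝ :=
  (-2 * (K.radius p ^ 2 + K.a ^ 2) * K.a ^ 2 * K.sinRatio p
      + K.a ^ 4 * p.2 * K.sinRatio p ^ 2) * K.Xi ^ 2
    + (K.radius p ^ 2 + K.a ^ 2) ^ 2
      * (2 * K.Xi * K.kappa * K.sinRatio p - K.kappa ^ 2 * p.2 * K.sinRatio p ^ 2)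
    + K.a ^ 2 * K.sinRatio p * K.deltaROf p * K.deltaThetaOf p * K.cosRatio p
    - (K.radius p ^ 2 + K.a ^ 2) ^ 2 * K.deltaThetaOf p ^ 2 * K.param p

variable (K) in
/-- `(γ_{θ⋆θ⋆} - γ_{φ⋆φ⋆} / sin² θ⋆) / sin² θ⋆` as a function of `r⋆` and `l`. -/
def differenceOf (p : ℝ × ℝ) : ℝ :=
  K.axisTerm p
    + K.rhoSqOf p / K.deltaThetaOf p
      * ((2 * derivSnd K.sinRatio p + p.2 * derivSnd K.sinRatio p ^ 2 / K.sinRatio p) / K.cosRatio p)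
    + K.sinRatio p * K.defect p / (K.deltaThetaOf p * K.cosRatio p * (K.Xi ^ 2 * K.rhoSqOf p))

theorem thetaDerivSq_contDiffOn : ContDiffOn ℝ ∞ K.thetaDerivSq strip :=
  ((contDiffOn_derivSnd sinSqOf_contDiffOn).pow 2).div
    (sinRatio_contDiffOn.mul cosRatio_contDiffOn) fun p hp =>
      mul_ne_zero (sinRatio_pos hp.2 p.1).ne' (cosRatio_pos hp.2 p.1).ne'

theorem axisTerm_contDiffOn : ContDiffOn ℝ ∞ K.axisTerm strip := by
  refine ContDiffOn.mul (by fun_prop) ?_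
  exact ((rhoSqOf_contDiffOn.div deltaROf_contDiffOn fun p hp => (deltaROf_neg hp).ne).mul
    ((contDiffOn_derivSnd radius_contDiffOn).pow 2)).add
    ((sinSqOf_contDiffOn.mul gPhiOf_contDiffOn).mul
      ((contDiffOn_derivSnd twistOf_contDiffOn).pow 2))

theorem rhoSqOf_div_contDiffOn : ContDiffOn ℝ ∞ (fun p => K.rhoSqOf p / K.deltaThetaOf p) strip :=
  rhoSqOf_contDiffOn.div deltaThetaOf_contDiffOn fun _ hp => (deltaThetaOf_pos hp).ne'

theorem gammaThetaThetaOf_contDiffOn : ContDiffOn ℝ ∞ K.gammaThetaThetaOf strip :=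
  (contDiffOn_snd.mul axisTerm_contDiffOn).add
    (rhoSqOf_div_contDiffOn.mul thetaDerivSq_contDiffOn)

theorem differenceOf_contDiffOn : ContDiffOn ℝ ∞ K.differenceOf strip := by
  have h1 := radius_contDiffOn (K := K)
  have h2 := param_contDiffOn (K := K)
  have h3 := sinRatio_contDiffOn (K := K)
  have h4 := cosRatio_contDiffOn (K := K)
  have h5 := deltaROf_contDiffOn (K := K)
  have h6 := deltaThetaOf_contDiffOn (K := K)
  have h7 := rhoSqOf_contDiffOn (K := K)
  have h8 := contDiffOn_derivSnd h3
  have hdef : ContDiffOn ℝ ∞ K.defect strip := by unfold defect; fun_prop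
  refine (axisTerm_contDiffOn.add (rhoSqOf_div_contDiffOn.mul (ContDiffOn.div ?_ h4
    fun p hp => (cosRatio_pos hp.2 p.1).ne'))).add ((h3.mul hdef).div
      ((h6.mul h4).mul (contDiffOn_const.mul h7)) fun p hp => ?_)
  · exact (contDiffOn_const.mul h8).add ((contDiffOn_snd.mul (h8.pow 2)).div h3
      fun p hp => (sinRatio_pos hp.2 p.1).ne')
  · exact mul_ne_zero (mul_ne_zero (deltaThetaOf_pos hp).ne' (cosRatio_pos hp.2 p.1).ne')
      (mul_ne_zero (pow_ne_zero 2 K.xi_pos.ne') (rhoSqOf_pos hp).ne')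

/-- `sin² 2θ⋆ = 4 l (1 - l)` and the square of `∂_{θ⋆} θ` contains no roots, so only `l` enters. -/
theorem gammaThetaTheta_eq_of (hy : y ∈ Ioo 0 π) (x : ℝ) :
    K.gammaThetaTheta x y = K.gammaThetaThetaOf (x, sin y ^ 2) := by
  have hl := sin_sq_mem_Icc y
  have h1 : K.thetaDeriv x y ^ 2 = K.thetaDerivSq (x, sin y ^ 2) := by
    rw [thetaDeriv, thetaDerivSq, div_pow, mul_pow, sq_sqrt (sinRatio_pos hl x).le,
      sq_sqrt (cosRatio_pos hl x).le]
  rw [gammaThetaTheta_eq hy, h1, gammaThetaThetaOf, axisTerm, sin_two_mul]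
  have h2 := cos_sq' y
  dsimp only
  rw [← h2]
  ring

theorem gammaPhiPhi_div (hy : y ∈ Ioo 0 π) (x : ℝ) : K.gammaPhiPhi x y / sin y ^ 2 =
    K.sinRatio (x, sin y ^ 2) * K.gPhiOf (x, sin y ^ 2) := by
  have := (sin_pos_of_mem_Ioo hy).ne'
  rw [gammaPhiPhi_eq hy, sinSqOf]
  field_simp

/-- Regularity at the axis. Apart from terms with explicit factor `l`, the difference is
proportional to `Ξ² (ρ²)² - Υ Δ_θ cosRatio`. Both products equal `Ξ² (r² + a²)²` at `l = 0`, and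
`defect` is the quotient by `l`. -/
theorem gammaThetaThetaOf_sub (hl : l ∈ Icc (0 : ℝ) 1) (x : ℝ) :
    K.gammaThetaThetaOf (x, l) - K.sinRatio (x, l) * K.gPhiOf (x, l) =
      l * K.differenceOf (x, l) := by
  have hp : (x, l) ∈ strip := mem_strip hl
  have hs := (sinRatio_pos (K := K) hl x).ne'
  have hc := (cosRatio_pos (K := K) hl x).ne'
  have hD := (deltaThetaOf_pos (K := K) hp).ne'
  have hρ := (rhoSqOf_pos (K := K) hp).ne'
  have hX := K.xi_pos.ne'
  have hce : K.cosRatio (x, l) = 1 + l * K.param (x, l) := rfl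
  have hDe : K.deltaThetaOf (x, l) = K.Xi - K.kappa * (l * K.sinRatio (x, l)) := rfl
  have hρe : K.rhoSqOf (x, l) =
    K.radius (x, l) ^ 2 + K.a ^ 2 * (1 - l * K.sinRatio (x, l)) := rfl
  rw [gammaThetaThetaOf, differenceOf, thetaDerivSq, gPhiOf, derivSnd_sinSqOf_eq_sinRatio hl,
    defect, upsilonStar, sinSqOf]
  dsimp only
  generalize derivSnd K.sinRatio (x, l) = s' at *
  generalize K.axisTerm (x, l) = A at *
  generalize K.rhoSqOf (x, l) = ρ at *
  generalize K.deltaThetaOf (x, l) = D at *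
  generalize K.cosRatio (x, l) = c at *
  generalize K.deltaROf (x, l) = Δ at *
  generalize K.sinRatio (x, l) = s at *
  generalize K.param (x, l) = q at *
  generalize K.radius (x, l) = r at *
  generalize K.Xi = X at *
  field_simp
  rw [hρe, hDe, hce]
  ring

theorem regularAngles_subset_Ioo : regularAngles ⊆ Ioo 0 π := sdiff_subset

theorem regularAngles_subset_Icc : regularAngles ⊆ Icc 0 π :=
  regularAngles_subset_Ioo.trans Ioo_subset_Icc_self

end KNdS

/-! ### The theorem -/

theorem mainTheorem7 (K : KNdS) :
    (∀ x : ℝ, ∀ y ∈ Set.Ioo 0 Real.pi, ∀ V W : Fin 4 → ℝ,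
      K.metric x y V W =
        -2 * K.OmegaSq x y * (V 0 * W 1 + V 1 * W 0)
        + K.gammaThetaTheta x y * (V 2 * W 2)
        + K.gammaThetaPhi x y * (V 2 * (W 3 - K.b x y * W 1))
        + K.gammaThetaPhi x y * ((V 3 - K.b x y * V 1) * W 2)
        + K.gammaPhiPhi x y * ((V 3 - K.b x y * V 1) * (W 3 - K.b x y * W 1))) ∧
    IsSmoothStar regularAngles
      (fun x y => 1 / Real.sin (2 * y) * deriv (fun y' => K.h x y') y) ∧
    IsSmoothStar (Set.Icc 0 Real.pi) (fun x y => K.b x y) ∧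
    IsSmoothStar (Set.Ioo 0 Real.pi) (fun x y => K.gammaThetaTheta x y) ∧
    IsSmoothStar regularAngles
      (fun x y => K.gammaThetaPhi x y / (Real.sin y ^ 2 * Real.sin (2 * y))) ∧
    IsSmoothStar (Set.Ioo 0 Real.pi) (fun x y => K.gammaPhiPhi x y / Real.sin y ^ 2) ∧
    IsSmoothStar (Set.Ioo 0 Real.pi)
      (fun x y => 1 / Real.sin y ^ 2 *
        (K.gammaThetaTheta x y - K.gammaPhiPhi x y / Real.sin y ^ 2)) := by
  refine ⟨fun x y hy V W => KNdS.metric_doubleNull hy x V W,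
    isSmoothStar_of_contDiffOn (contDiffOn_derivSnd (KNdS.twistOf_contDiffOn (K := K)))
      subset_rfl fun x y hy => ?_,
    isSmoothStar_of_contDiffOn ((contDiffOn_const (c := (2 : ℝ))).mul (KNdS.bOf_contDiffOn (K := K)))
      KNdS.regularAngles_subset_Icc fun x y hy => ?_,
    isSmoothStar_of_contDiffOn (KNdS.gammaThetaThetaOf_contDiffOn (K := K))
      KNdS.regularAngles_subset_Ioo fun x y hy => KNdS.gammaThetaTheta_eq_of hy x,
    isSmoothStar_of_contDiffOn (((KNdS.sinRatio_contDiffOn (K := K)).mul (KNdS.gPhiOf_contDiffOn (K := K))).mul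
      (contDiffOn_derivSnd (KNdS.twistOf_contDiffOn (K := K)))) subset_rfl fun x y hy => ?_,
    isSmoothStar_of_contDiffOn ((KNdS.sinRatio_contDiffOn (K := K)).mul (KNdS.gPhiOf_contDiffOn (K := K)))
      KNdS.regularAngles_subset_Ioo fun x y hy => KNdS.gammaPhiPhi_div hy x,
    isSmoothStar_of_contDiffOn (KNdS.differenceOf_contDiffOn (K := K))
      KNdS.regularAngles_subset_Ioo fun x y hy => ?_⟩
  · have h1 := sin_two_mul_ne_zero_of_mem_regularAngles hy
    rw [(KNdS.hasDerivAt_h_snd (KNdS.regularAngles_subset_Ioo hy) x).deriv]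
    field_simp
  · rw [KNdS.b, KNdS.B_rOf hy]
  · have hy' := KNdS.regularAngles_subset_Ioo hy
    have h1 := sin_two_mul_ne_zero_of_mem_regularAngles hy
    have h2 := (sin_pos_of_mem_Ioo hy').ne'
    rw [KNdS.gammaThetaPhi_eq hy', KNdS.sinSqOf]
    field_simp
  · have h2 := (sin_pos_of_mem_Ioo hy).ne'
    rw [KNdS.gammaPhiPhi_div hy, KNdS.gammaThetaTheta_eq_of hy,
      KNdS.gammaThetaThetaOf_sub (sin_sq_mem_Icc y)]
    field_simp

end
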